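/- Let $m\ge 2$, $\mathfrak g=\mathfrak{gl}_m(\mathbb C)$ with matrix units $e_{ij}$, Borel subalgebra $\mathfrak b$ of upper triangular matrices, $R=\mathbb C[[z_1,\dots,z_m]]$ with maximal ideal $\mathfrak m$, and $\rho=(0,-1,\dots,-m+1)$. For $\lambda\in\mathbb Z^m$ let $\widetilde M(\lambda)=U(\mathfrak g)\otimes_{U(\mathfrak b)}R_{\lambda-\rho}$ be the deformed Verma module, where $R_{\mu}=R$, $e_{ii}$ acts on $R_\mu$ by $\mu_i+z_i$ and $e_{ij}$ ($i<j$) by $0$; let $M(\lambda)=\widetilde M(\lambda)/\widetilde M(\lambda)\mathfrak m$ be the Verma module. For a $(\mathfrak g,R)$-bimodule $M$ put $M_{(\lambda)}=\{v\in M: (e_{ii}-\lambda_i)v=vz_i \text{ for all } i\}$, and let $M^\vee=\bigoplus_{\lambda\in\mathbb Z^m}\operatorname{Hom}_{\mathbb C}(M_{(\lambda)},\mathbb C)$ when $M=\bigoplus_\lambda M_{(\lambda)}$, with $\mathfrak g$ acting through the transpose. Let $\mathcal O$ be the BGG category of $\mathfrak g$ with integral weights, regarded as the category of finitely generated $(\mathfrak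 g,R)$-bimodules which are locally finite over the strictly upper triangular matrices, satisfy $M=\bigoplus_{\lambda\in\mathbb Z^m}M_{(\lambda)}$, and on which $R$ acts through $R/\mathfrak m=\mathbb C$. For $n\ge1$ let $H_n$ be the degenerate affine Hecke algebra of $GL_n$, generated by $x_1,\dots,x_n$, $s_1,\dots,s_{n-1}$ with relations $x_ix_j=x_jx_i$, $s_i^2=1$, the braid relations, $x_{i+1}s_i=s_ix_i+1$, and $x_js_i=s_ix_j$ for $j\ne i,i+1$. For a left $H_n$-module $N$, let $N^\circledast=\operatorname{Hom}_{\mathbb C}(N,\mathbb C)$ with the action twisted by the anti-involution of $H_n$ fixing all $x_i,s_i$. Let $V=\mathbb C^m$ be the vector representation. The formulas $s_i=\Omega^{(i,i+1)}$, $x_i=\sum_{0\le j<i}\Omega^{(j,i)}$, where $\Omega^{(a,b)}=\sum_{p,q}e_{pq}^{(a)}e_{qp}^{(b)}$ and the tensor factors are numbered $0,\dots,n$, define a right action of $H_n$ on $\widetilde M(\rho)\otimes V^{\otimes n}$, and the Arakawa–Suzuki functor sends a $(\mathfrak g,R)$-bimodule $M$ to the left $H_n$-module $\Phi(M)=\Phi^m_n(M)=\operatorname{Hom}_{(\mathfrak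 g,R)}(\widetilde M(\rho)\otimes V^{\otimes n},M)$. For integers $i<j$ let $\alpha(i,j)=\alpha_i+\alpha_{i+1}+\dots+\alpha_{j-1}$ be the positive roots of type $A_\infty$, totally ordered lexicographically in $(i,j)$. For a Kostant partition $\pi=\{\alpha(i_1,j_1)\succ\dots\succ\alpha(i_r,j_r)\}$ (with distinct parts) of $\beta\in\bigoplus_{i\in\mathbb Z}\mathbb Z_{\ge0}\alpha_i$ with $\operatorname{ht}(\beta)=n$, put $n_k=j_k-i_k$ and $a_k=n_1+\dots+n_{k-1}+1$. The standard module is the induced module $$\Delta_H(\pi)=H_n\otimes_{H_{n_1}\boxtimes\dots\boxtimes H_{n_r}}\mathbb C[[z_1,\dots,z_r]],$$ where $x_l$ acts on $\mathbb C[[z_1,\dots,z_r]]$ by $i_k+(l-a_k)+z_k$ for $a_k\le l<a_{k+1}$ and the symmetric groups act trivially. The proper standard module is $\overline\Delta_H(\pi)=\Delta_H(\pi)/(z_1,\dots,z_r)\Delta_H(\pi)$, and the proper costandard module is $\overline\nabla_H(\pi)=\overline\Delta_H(\pi)^\circledast$. Then the following hold. (1) Let $\lambda\in\mathbb Z^m$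 with $\lambda_1\ge\dots\ge\lambda_m>0$, let $\beta=\sum_{i=1}^m\alpha(-i+1,\lambda_i)$ and $n=\operatorname{ht}(\beta)$. For every $\mu$ in the $\mathfrak S_m$-orbit $\Pi_\lambda$ of $\lambda$, let $\pi_\mu=\{\alpha(0,\mu_1),\alpha(-1,\mu_2),\dots,\alpha(-m+1,\mu_m)\}$, a Kostant partition of $\beta$. Then there are isomorphisms of left $H_n$-modules $$\Phi(\widetilde M(\mu))\cong\Delta_H(\pi_\mu),\qquad \Phi(M(\mu))\cong\overline\Delta_H(\pi_\mu),\qquad \Phi(M(\mu)^\vee)\cong\overline\nabla_H(\pi_\mu).$$ (2) For every $n\ge1$ and every $M\in\mathcal O$, $\Phi(M^\vee)\cong\Phi(M)^\circledast$ as left $H_n$-modules. -/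

import Mathlib

open scoped TensorProduct

attribute [local instance 100] LieRing.ofAssociativeRing

namespace ArakawaSuzuki
section Casimir

variable {A : Type*} [Ring A] {m N : ℕ} (E : Fin N → Fin m → Fin m → A)

/-- `Ω^{(a,b)} = ∑_{i,j} e_{ij}^{(a)} e_{ji}^{(b)}`. -/
def Om (a b : Fin N) : A := ∑ i, ∑ j, E a i j * E b j i

/-- `∑_{a < b} Ω^{(a,b)}`. -/
def OmLt (b : Fin N) : A := ∑ a ∈ Finset.Iio b, Om E a b

/-- The relations between the operators `e_{ij}^{(a)}` on a tensor product
`M₀ ⊗ M₁ ⊗ ⋯` in which every `M_a` with `a ≠ 0` is the vector representation. -/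
structure SlotRel : Prop where
  comm : ∀ a b : Fin N, a ≠ b → ∀ i j k l, Commute (E a i j) (E b k l)
  lie : ∀ (a : Fin N) i j k l, E a i j * E a k l - E a k l * E a i j =
    (if j = k then E a i l else 0) - (if l = i then E a k j else 0)
  mul : ∀ a : Fin N, (a : ℕ) ≠ 0 → ∀ i j k l, E a i j * E a k l = if j = k then E a i l else 0
  one : ∀ a : Fin N, (a : ℕ) ≠ 0 → ∑ i, E a i i = 1

variable {E}

lemma Om_commute_of_forall {a b : Fin N} {y : A} (ha : ∀ i j, Commute (E a i j) y)
    (hb : ∀ i j, Commute (E b i j) y) : Commute (Om E a b) y :=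
  Commute.sum_left _ _ _ fun i _ => Commute.sum_left _ _ _ fun j _ => (ha i j).mul_left (hb j i)

lemma Om_symm (S : SlotRel E) {a b : Fin N} (hab : a ≠ b) : Om E a b = Om E b a := by
  unfold Om
  rw [Finset.sum_comm]
  exact Finset.sum_congr rfl fun i _ => Finset.sum_congr rfl fun j _ => (S.comm a b hab _ _ _ _).eq

lemma Om_diag (S : SlotRel E) {a b : Fin N} (hab : a ≠ b) (k l : Fin m) :
    Commute (Om E a b) (E a k l + E b k l) := by
  have h1 : ∀ i j, (E a i j * E b j i) * (E a k l + E b k l)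
      - (E a k l + E b k l) * (E a i j * E b j i) =
      ((if j = k then E a i l else 0) - (if l = i then E a k j else 0)) * E b j i
      + E a i j * ((if i = k then E b j l else 0) - (if l = j then E b k i else 0)) := by
    intro i j
    rw [← S.lie a i j k l, ← S.lie b j i k l]
    have e1 := (S.comm a b hab k l j i).eq
    have e2 := (S.comm a b hab i j k l).eq
    have e3 : E b j i * E a k l = E a k l * E b j i := e1.symm
    have e4 : E b k l * (E a i j * E b j i) = E a i j * (E b k l * E b j i) := by
      rw [← mul_assoc, ← e2, mul_assoc]
    have e5 : E a i j * E b j i * E a k l = E a i j * E a k l * E b j i := by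
      rw [mul_assoc, e3, mul_assoc]
    rw [mul_add, add_mul, e4, e5]
    noncomm_ring
  rw [commute_iff_eq, ← sub_eq_zero]
  unfold Om
  simp only [Finset.sum_mul, Finset.mul_sum, ← Finset.sum_sub_distrib]
  simp only [h1]
  simp only [sub_mul, mul_sub, Finset.sum_add_distrib, Finset.sum_sub_distrib, ite_mul, mul_ite,
    zero_mul, mul_zero, Finset.sum_ite_eq, Finset.sum_ite_eq', Finset.mem_univ, if_true]
  have : ∀ (f : Fin m → Fin m → A), (∑ x, ∑ y, if l = x then f x y else 0) = ∑ y, f l y := by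
    intro f; rw [Finset.sum_comm]; simp
  have h3 : ∀ (f : Fin m → Fin m → A), (∑ x, ∑ y, if x = k then f x y else 0) = ∑ y, f k y := by
    intro f; rw [Finset.sum_comm]; simp
  rw [this, h3]
  abel

lemma Om_conj (S : SlotRel E) {a b : Fin N} (hab : a ≠ b) (ha : (a : ℕ) ≠ 0) (hb : (b : ℕ) ≠ 0) (k l : Fin m) :
    Om E a b * E a k l = E b k l * Om E a b := by
  have e1 : ∀ i j, E a i j * E b j i * E a k l = if j = k then E a i l * E b k i else 0 := by
    intro i j
    rw [mul_assoc, ← (S.comm a b hab k l j i).eq, ← mul_assoc, S.mul a ha]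
    split_ifs with h
    · rw [h]
    · simp
  have e2 : ∀ i j, E b k l * (E a i j * E b j i) = if l = j then E a i l * E b k i else 0 := by
    intro i j
    rw [← mul_assoc, ← (S.comm a b hab i j k l).eq, mul_assoc, S.mul b hb]
    split_ifs with h
    · rw [h]
    · simp
  unfold Om
  simp only [Finset.sum_mul, Finset.mul_sum, e1, e2]
  simp

lemma Om_sq (S : SlotRel E) {a b : Fin N} (hab : a ≠ b) (ha : (a : ℕ) ≠ 0) (hb : (b : ℕ) ≠ 0) :
    Om E a b * Om E a b = 1 := by
  have e : ∀ i j k l, (E a i j * E b j i) * (E a k l * E b l k)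
      = if j = k then (if l = i then E a i i * E b j j else 0) else 0 := by
    intro i j k l
    have : (E a i j * E b j i) * (E a k l * E b l k)
        = (E a i j * E a k l) * (E b j i * E b l k) := by
      rw [mul_assoc, ← mul_assoc (E b j i), ← (S.comm a b hab k l j i).eq]
      simp only [mul_assoc]
    rw [this, S.mul a ha, S.mul b hb]
    by_cases h : j = k
    · by_cases h' : l = i
      · subst h h'; rw [if_pos rfl, if_pos rfl, if_pos rfl, if_pos rfl]
      · rw [if_pos h, if_pos h, if_neg h', if_neg (Ne.symm h'), mul_zero]
    · rw [if_neg h, if_neg h, zero_mul]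
  unfold Om
  simp only [Finset.sum_mul, Finset.mul_sum, e]
  have h2 : (∑ j, ∑ i, E a i i * E b j j) = 1 := by
    rw [Finset.sum_comm]
    simp only [← Finset.mul_sum, S.one b hb, mul_one, S.one a ha]
  rw [← h2]
  refine Finset.sum_congr rfl fun i _ => Finset.sum_congr rfl fun j _ => ?_
  rw [Finset.sum_eq_single j (fun k _ hk => by simp [hk.symm]) (by simp)]
  simp

lemma Om_conj' (S : SlotRel E) {a b c : Fin N} (hab : a ≠ b) (ha : (a : ℕ) ≠ 0) (hb : (b : ℕ) ≠ 0)
    (hca : c ≠ a) (hcb : c ≠ b) : Om E a b * Om E c a = Om E c b * Om E a b := by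
  have hq : ∀ i j, Om E a b * E c i j = E c i j * Om E a b := fun i j =>
    (Om_commute_of_forall (fun _ _ => S.comm _ _ hca.symm _ _ _ _)
      (fun _ _ => S.comm _ _ hcb.symm _ _ _ _)).eq
  conv_lhs => rw [Om.eq_def E c a]
  conv_rhs => rw [Om.eq_def E c b]
  simp only [Finset.sum_mul, Finset.mul_sum]
  refine Finset.sum_congr rfl fun i _ => Finset.sum_congr rfl fun j _ => ?_
  rw [← mul_assoc, hq, mul_assoc, Om_conj S hab ha hb, mul_assoc]

lemma Om_braid (S : SlotRel E) {a b c : Fin N} (hab : a ≠ b) (hbc : b ≠ c) (hac : a ≠ c) (ha : (a : ℕ) ≠ 0)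
    (hb : (b : ℕ) ≠ 0) (hcc : (c : ℕ) ≠ 0) :
    Om E a b * Om E b c * Om E a b = Om E b c * Om E a b * Om E b c := by
  have e1 : Om E a b * Om E b c = Om E a c * Om E a b := by
    have := Om_conj' S hab.symm hb ha hbc.symm hac.symm
    rwa [Om_symm S hab.symm, Om_symm S hbc.symm, Om_symm S hac.symm] at this
  have e2 : Om E b c * Om E a b = Om E a c * Om E b c :=
    Om_conj' S hbc hb hcc hab hac
  rw [e1, e2, mul_assoc, mul_assoc, Om_sq S hab ha hb, Om_sq S hbc hb hcc]

lemma Om_commute_of_ne (S : SlotRel E) {a b c : Fin N} (hca : c ≠ a) (hcb : c ≠ b) (i j : Fin m) :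
    Commute (Om E a b) (E c i j) :=
  Om_commute_of_forall (fun _ _ => S.comm _ _ hca.symm _ _ _ _)
    (fun _ _ => S.comm _ _ hcb.symm _ _ _ _)

lemma Om_commute_Om (S : SlotRel E) {a b c d : Fin N} (hca : c ≠ a) (hcb : c ≠ b) (hda : d ≠ a)
    (hdb : d ≠ b) : Commute (Om E a b) (Om E c d) :=
  (Om_commute_of_forall (fun i j => (Om_commute_of_ne S hca hcb i j).symm)
    (fun i j => (Om_commute_of_ne S hda hdb i j).symm)).symm

lemma OmLt_commute_of_lt (S : SlotRel E) {b c : Fin N} (hbc : b < c) : Commute (OmLt E b) (OmLt E c) := by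
  unfold OmLt
  refine Commute.sum_left _ _ _ fun a ha => ?_
  have ha : a < b := Finset.mem_Iio.1 ha
  have hsub : ({a, b} : Finset (Fin N)) ⊆ Finset.Iio c := by
    intro d hd
    simp only [Finset.mem_insert, Finset.mem_singleton] at hd
    rcases hd with rfl | rfl
    · exact Finset.mem_Iio.2 (ha.trans hbc)
    · exact Finset.mem_Iio.2 hbc
  rw [← Finset.sum_sdiff hsub]
  refine Commute.add_right (Commute.sum_right _ _ _ fun d hd => ?_) ?_
  · simp only [Finset.mem_sdiff, Finset.mem_Iio, Finset.mem_insert, Finset.mem_singleton,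
      not_or] at hd
    refine Om_commute_of_forall (fun i j => ?_) (fun i j => ?_)
    · exact (Om_commute_of_forall (fun _ _ => S.comm _ _ hd.2.1 _ _ _ _)
        (fun _ _ => S.comm _ _ (ha.trans hbc).ne' _ _ _ _)).symm
    · exact (Om_commute_of_forall (fun _ _ => S.comm _ _ hd.2.2 _ _ _ _)
        (fun _ _ => S.comm _ _ hbc.ne' _ _ _ _)).symm
  · rw [Finset.sum_pair ha.ne]
    have : Om E a c + Om E b c = ∑ i, ∑ j, (E a i j + E b i j) * E c j i := by
      simp only [Om, add_mul, Finset.sum_add_distrib]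
    rw [this]
    refine Commute.sum_right _ _ _ fun i _ => Commute.sum_right _ _ _ fun j _ => ?_
    refine (Om_diag S ha.ne i j).mul_right ?_
    exact Om_commute_of_forall (fun _ _ => S.comm _ _ (ha.trans hbc).ne _ _ _ _)
        (fun _ _ => S.comm _ _ hbc.ne _ _ _ _)

lemma OmLt_commute (S : SlotRel E) (b c : Fin N) : Commute (OmLt E b) (OmLt E c) := by
  rcases lt_trichotomy b c with h | rfl | h
  · exact OmLt_commute_of_lt S h
  · exact Commute.refl _
  · exact (OmLt_commute_of_lt S h).symm

lemma Om_OmLt_succ (S : SlotRel E) {b c : Fin N} (hbc : (b : ℕ) + 1 = c) (hb : (b : ℕ) ≠ 0) :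
    Om E b c * OmLt E c = OmLt E b * Om E b c + 1 := by
  have hlt : b < c := by rw [Fin.lt_def]; omega
  have hcc : (c : ℕ) ≠ 0 := by omega
  have hI : Finset.Iio c = insert b (Finset.Iio b) := by
    ext d
    simp only [Finset.mem_Iio, Finset.mem_insert, Fin.lt_def, Fin.ext_iff]
    omega
  unfold OmLt
  rw [hI, Finset.sum_insert (by simp), mul_add, Om_sq S hlt.ne hb hcc, add_comm]
  congr 1
  rw [Finset.mul_sum, Finset.sum_mul]
  refine Finset.sum_congr rfl fun a ha => ?_
  have ha : a < b := Finset.mem_Iio.1 ha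
  have := Om_conj' S hlt.ne' hcc hb (ha.trans hlt).ne ha.ne
  rwa [Om_symm S hlt.ne'] at this

lemma Om_commute_OmLt (S : SlotRel E) {b c d : Fin N} (hbc : (b : ℕ) + 1 = c) (hdb : d ≠ b) (hdc : d ≠ c) :
    Commute (Om E b c) (OmLt E d) := by
  have hbc' : b ≠ c := by rw [Ne, Fin.ext_iff]; omega
  have hd : ∀ i j, Commute (Om E b c) (E d i j) := fun i j =>
    Om_commute_of_forall (fun _ _ => S.comm _ _ hdb.symm _ _ _ _) (fun _ _ => S.comm _ _ hdc.symm _ _ _ _)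
  unfold OmLt
  rcases lt_or_ge d b with h | h
  · refine Commute.sum_right _ _ _ fun a ha => (Om_commute_of_forall (fun i j => ?_)
      (fun i j => (hd i j).symm)).symm
    have ha : a < d := Finset.mem_Iio.1 ha
    have hac : a ≠ c := by rw [Fin.lt_def] at *; rw [Ne, Fin.ext_iff]; omega
    exact (Om_commute_of_forall (fun _ _ => S.comm _ _ (ha.trans h).ne' _ _ _ _)
      (fun _ _ => S.comm _ _ hac.symm _ _ _ _)).symm
  · have h : b ≤ d := h
    have hcd : c < d := by
      rw [Ne, Fin.ext_iff] at hdb hdc; rw [Fin.le_def] at h; rw [Fin.lt_def]; omega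
    have hbd : b < d := lt_of_le_of_ne h hdb.symm
    have hsub : ({b, c} : Finset (Fin N)) ⊆ Finset.Iio d := by
      intro x hx
      simp only [Finset.mem_insert, Finset.mem_singleton] at hx
      rcases hx with rfl | rfl <;> simpa
    rw [← Finset.sum_sdiff hsub]
    refine Commute.add_right (Commute.sum_right _ _ _ fun x hx => ?_) ?_
    · simp only [Finset.mem_sdiff, Finset.mem_Iio, Finset.mem_insert, Finset.mem_singleton,
        not_or] at hx
      refine (Om_commute_of_forall (fun i j => ?_) (fun i j => (hd i j).symm)).symm
      exact (Om_commute_of_forall (fun _ _ => S.comm _ _ (Ne.symm hx.2.1) _ _ _ _)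
        (fun _ _ => S.comm _ _ (Ne.symm hx.2.2) _ _ _ _)).symm
    · rw [Finset.sum_pair hbc']
      have : Om E b d + Om E c d = ∑ i, ∑ j, (E b i j + E c i j) * E d j i := by
        simp only [Om, add_mul, Finset.sum_add_distrib]
      rw [this]
      refine Commute.sum_right _ _ _ fun i _ => Commute.sum_right _ _ _ fun j _ => ?_
      exact (Om_diag S hbc' i j).mul_right (hd _ _)

end Casimir

/-! ### The degenerate affine Hecke algebra -/

section Hecke

/-- Elements `x_i` and `s_i` (`i ∈ J`) of a ring satisfy the defining relations of the
degenerate affine Hecke algebra. Indices start at `0`: `s i` exchanges `i` and `i + 1`. -/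
structure HeckeRelations (n : ℕ) (J : Set ℕ) {B : Type*} [Ring B] (x : Fin n → B)
    (s : ∀ i : ℕ, i + 1 < n → i ∈ J → B) : Prop where
  x_comm : ∀ i j, x i * x j = x j * x i
  s_sq : ∀ i h hJ, s i h hJ * s i h hJ = 1
  braid : ∀ i h hJ h' hJ', s i h hJ * s (i + 1) h' hJ' * s i h hJ =
    s (i + 1) h' hJ' * s i h hJ * s (i + 1) h' hJ'
  s_comm : ∀ i h hJ j h' hJ', i + 1 < j ∨ j + 1 < i → s i h hJ * s j h' hJ' = s j h' hJ' * s i h hJ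
  x_succ_s : ∀ i h hJ, x ⟨i + 1, h⟩ * s i h hJ = s i h hJ * x ⟨i, by omega⟩ + 1
  x_s : ∀ i h hJ (j : Fin n), (j : ℕ) ≠ i → (j : ℕ) ≠ i + 1 → x j * s i h hJ = s i h hJ * x j

/-- Generators `x_i` and `s_i` (`i ∈ J`). -/
inductive HeckeGen (n : ℕ) (J : Set ℕ) : Type
  | x (i : Fin n) : HeckeGen n J
  | s (i : ℕ) (h : i + 1 < n) (hJ : i ∈ J) : HeckeGen n J

/-- The free generator `x_i`. -/
def freeX (n : ℕ) (J : Set ℕ) (i : Fin n) : FreeAlgebra ℂ (HeckeGen n J) :=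
  FreeAlgebra.ι ℂ (HeckeGen.x i)

/-- The free generator `s_i`. -/
def freeS (n : ℕ) (J : Set ℕ) (i : ℕ) (h : i + 1 < n) (hJ : i ∈ J) :
    FreeAlgebra ℂ (HeckeGen n J) :=
  FreeAlgebra.ι ℂ (HeckeGen.s i h hJ)

/-- The defining relations, imposed on the free algebra. -/
inductive HeckeRel (n : ℕ) (J : Set ℕ) :
    FreeAlgebra ℂ (HeckeGen n J) → FreeAlgebra ℂ (HeckeGen n J) → Prop
  | x_comm (i j) : HeckeRel n J (freeX n J i * freeX n J j) (freeX n J j * freeX n J i)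
  | s_sq (i h hJ) : HeckeRel n J (freeS n J i h hJ * freeS n J i h hJ) 1
  | braid (i h hJ h' hJ') : HeckeRel n J
      (freeS n J i h hJ * freeS n J (i + 1) h' hJ' * freeS n J i h hJ)
      (freeS n J (i + 1) h' hJ' * freeS n J i h hJ * freeS n J (i + 1) h' hJ')
  | s_comm (i h hJ j h' hJ') (hij : i + 1 < j ∨ j + 1 < i) : HeckeRel n J
      (freeS n J i h hJ * freeS n J j h' hJ') (freeS n J j h' hJ' * freeS n J i h hJ)
  | x_succ_s (i) (h : i + 1 < n) (hJ) : HeckeRel n J (freeX n J ⟨i + 1, h⟩ * freeS n J i h hJ)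
      (freeS n J i h hJ * freeX n J ⟨i, Nat.lt_of_succ_lt h⟩ + 1)
  | x_s (i h hJ) (j : Fin n) (h₀ : (j : ℕ) ≠ i) (h₁ : (j : ℕ) ≠ i + 1) : HeckeRel n J
      (freeX n J j * freeS n J i h hJ) (freeS n J i h hJ * freeX n J j)

/-- The algebra generated by `x_0, …, x_{n-1}` and the `s_i` with `i ∈ J`, subject to the
relations of the degenerate affine Hecke algebra. If `J` is the set of all `i` such that `i` and
`i + 1` are in the same block of a composition `(n_1, …, n_k)` of `n`, this is the presentation
of `H_{n_1} ⊗ ⋯ ⊗ H_{n_k}`. -/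
def ParHecke (n : ℕ) (J : Set ℕ) : Type := RingQuot (HeckeRel n J)

noncomputable instance (n : ℕ) (J : Set ℕ) : Ring (ParHecke n J) :=
  inferInstanceAs (Ring (RingQuot (HeckeRel n J)))

noncomputable instance (n : ℕ) (J : Set ℕ) : Algebra ℂ (ParHecke n J) :=
  inferInstanceAs (Algebra ℂ (RingQuot (HeckeRel n J)))

/-- The degenerate affine Hecke algebra `H_n` of `GL_n`. -/
abbrev Hecke (n : ℕ) : Type := ParHecke n Set.univ

namespace ParHecke

variable (n : ℕ) (J : Set ℕ)

/-- The projection from the free algebra. -/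
noncomputable def mk : FreeAlgebra ℂ (HeckeGen n J) →ₐ[ℂ] ParHecke n J :=
  RingQuot.mkAlgHom ℂ (HeckeRel n J)

variable {n J} in
lemma mk_rel {a b : FreeAlgebra ℂ (HeckeGen n J)} (h : HeckeRel n J a b) : mk n J a = mk n J b :=
  RingQuot.mkAlgHom_rel ℂ h

/-- The generator `x_i`. -/
noncomputable def x (i : Fin n) : ParHecke n J := mk n J (freeX n J i)

/-- The generator `s_i`. -/
noncomputable def s (i : ℕ) (h : i + 1 < n) (hJ : i ∈ J) : ParHecke n J :=
  mk n J (freeS n J i h hJ)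

lemma relations : HeckeRelations n J (x n J) (s n J) where
  x_comm i j := by
    have H := mk_rel (HeckeRel.x_comm (J := J) i j)
    simp only [map_mul] at H
    exact H
  s_sq i h hJ := by
    have H := mk_rel (HeckeRel.s_sq i h hJ)
    simp only [map_mul, map_one] at H
    exact H
  braid i h hJ h' hJ' := by
    have H := mk_rel (HeckeRel.braid i h hJ h' hJ')
    simp only [map_mul] at H
    exact H
  s_comm i h hJ j h' hJ' hij := by
    have H := mk_rel (HeckeRel.s_comm i h hJ j h' hJ' hij)
    simp only [map_mul] at H
    exact H
  x_succ_s i h hJ := by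
    have H := mk_rel (HeckeRel.x_succ_s i h hJ)
    simp only [map_mul, map_add, map_one] at H
    exact H
  x_s i h hJ j h₀ h₁ := by
    have H := mk_rel (HeckeRel.x_s i h hJ j h₀ h₁)
    simp only [map_mul] at H
    exact H

variable {n J} {B : Type*} [Ring B] [Algebra ℂ B]

/-- The homomorphism to `B` given by elements of `B` that satisfy the relations. -/
noncomputable def lift {x' : Fin n → B} {s' : ∀ i : ℕ, i + 1 < n → i ∈ J → B}
    (H : HeckeRelations n J x' s') : ParHecke n J →ₐ[ℂ] B :=
  RingQuot.liftAlgHom ℂ ⟨FreeAlgebra.lift ℂ fun g : HeckeGen n J => match g with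
      | HeckeGen.x i => x' i
      | HeckeGen.s i h hJ => s' i h hJ, by
    intro a b hab
    cases hab with
    | x_comm i j => simpa [freeX, freeS] using H.x_comm i j
    | s_sq i h hJ => simpa [freeX, freeS] using H.s_sq i h hJ
    | braid i h hJ h' hJ' => simpa [freeX, freeS] using H.braid i h hJ h' hJ'
    | s_comm i h hJ j h' hJ' hij => simpa [freeX, freeS] using H.s_comm i h hJ j h' hJ' hij
    | x_succ_s i h hJ => simpa [freeX, freeS] using H.x_succ_s i h hJ
    | x_s i h hJ j h₀ h₁ => simpa [freeX, freeS] using H.x_s i h hJ j h₀ h₁⟩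

@[simp] lemma lift_x {x' : Fin n → B} {s' : ∀ i : ℕ, i + 1 < n → i ∈ J → B}
    (H : HeckeRelations n J x' s') (i : Fin n) : lift H (x n J i) = x' i := by
  unfold lift x mk
  erw [RingQuot.liftAlgHom_mkAlgHom_apply]
  simp [freeX]

@[simp] lemma lift_s {x' : Fin n → B} {s' : ∀ i : ℕ, i + 1 < n → i ∈ J → B}
    (H : HeckeRelations n J x' s') (i : ℕ) (h hJ) : lift H (s n J i h hJ) = s' i h hJ := by
  unfold lift s mk
  erw [RingQuot.liftAlgHom_mkAlgHom_apply]
  simp [freeS]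

variable (n J)

/-- The natural map of the parabolic algebra to `H_n`. -/
noncomputable def toHecke : ParHecke n J →ₐ[ℂ] Hecke n :=
  lift (x' := x n Set.univ) (s' := fun i h _ => s n Set.univ i h trivial)
    { x_comm := (relations n Set.univ).x_comm
      s_sq := fun i h _ => (relations n Set.univ).s_sq i h trivial
      braid := fun i h _ h' _ => (relations n Set.univ).braid i h trivial h' trivial
      s_comm := fun i h _ j h' _ => (relations n Set.univ).s_comm i h trivial j h' trivial
      x_succ_s := fun i h _ => (relations n Set.univ).x_succ_s i h trivial
      x_s := fun i h _ => (relations n Set.univ).x_s i h trivial }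

/-- The anti-involution `ψ` of `H_n` that fixes all generators. -/
noncomputable def psi : Hecke n →ₐ[ℂ] (Hecke n)ᵐᵒᵖ :=
  lift (x' := fun i => MulOpposite.op (x n Set.univ i))
    (s' := fun i h hJ => MulOpposite.op (s n Set.univ i h hJ))
    { x_comm := fun i j => MulOpposite.unop_injective ((relations n Set.univ).x_comm j i)
      s_sq := fun i h hJ => MulOpposite.unop_injective ((relations n Set.univ).s_sq i h hJ)
      braid := fun i h hJ h' hJ' => MulOpposite.unop_injective (by
        simpa [mul_assoc] using (relations n Set.univ).braid i h hJ h' hJ')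
      s_comm := fun i h hJ j h' hJ' hij => MulOpposite.unop_injective
        ((relations n Set.univ).s_comm j h' hJ' i h hJ hij.symm)
      x_succ_s := fun i h hJ => MulOpposite.unop_injective (by
        have h1 := (relations n Set.univ).x_succ_s i h hJ
        have h2 := (relations n Set.univ).s_sq i h hJ
        simp only [MulOpposite.unop_mul, MulOpposite.unop_op, MulOpposite.unop_add,
          MulOpposite.unop_one]
        calc s n Set.univ i h hJ * x n Set.univ ⟨i + 1, h⟩
            = s n Set.univ i h hJ * (x n Set.univ ⟨i + 1, h⟩ * s n Set.univ i h hJ)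
                * s n Set.univ i h hJ := by rw [mul_assoc, mul_assoc, h2, mul_one]
          _ = _ := by rw [h1, mul_add, add_mul, ← mul_assoc, h2, one_mul, mul_one, h2])
      x_s := fun i h hJ j h₀ h₁ => MulOpposite.unop_injective
        ((relations n Set.univ).x_s i h hJ j h₀ h₁).symm }

end ParHecke

end Hecke

/-! ### The dual of a module over the Hecke algebra -/

section HeckeDual

variable (n : ℕ) (N : Type*) [AddCommGroup N] [Module ℂ N] [Module (Hecke n) N]

/-- `N^⊛`, the full dual space with the action twisted by `ψ`. -/
def CDual [IsScalarTower ℂ (Hecke n) N] : Type _ := Module.Dual ℂ N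

variable [IsScalarTower ℂ (Hecke n) N]

instance : AddCommGroup (CDual n N) := inferInstanceAs (AddCommGroup (Module.Dual ℂ N))

instance : Module ℂ (CDual n N) := inferInstanceAs (Module ℂ (Module.Dual ℂ N))

variable {N} in
/-- `h • f` is the functional `v ↦ f(ψ(h) v)`. -/
noncomputable def CDual.act (h : Hecke n) (f : Module.Dual ℂ N) : Module.Dual ℂ N :=
  f ∘ₗ Module.toModuleEnd ℂ (S := Hecke n) N (ParHecke.psi n h).unop

variable {N} in
lemma CDual.act_apply (h : Hecke n) (f : Module.Dual ℂ N) (v : N) :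
    CDual.act n h f v = f ((ParHecke.psi n h).unop • v) := rfl

noncomputable instance : Module (Hecke n) (CDual n N) where
  smul h f := CDual.act n h f
  one_smul f := LinearMap.ext fun v => by
    refine (CDual.act_apply n 1 f v).trans ?_
    rw [map_one, MulOpposite.unop_one, one_smul]
  mul_smul a b f := LinearMap.ext fun v => by
    refine (CDual.act_apply n (a * b) f v).trans ?_
    rw [map_mul, MulOpposite.unop_mul, mul_smul]
    rfl
  smul_zero a := LinearMap.zero_comp _
  smul_add a f g := LinearMap.add_comp _ _ _
  add_smul a b f := LinearMap.ext fun v => by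
    refine (CDual.act_apply n (a + b) f v).trans ?_
    rw [map_add, MulOpposite.unop_add, add_smul]
    exact LinearMap.map_add (f : Module.Dual ℂ N) _ _
  zero_smul f := LinearMap.ext fun v => by
    refine (CDual.act_apply n 0 f v).trans ?_
    rw [map_zero, MulOpposite.unop_zero, zero_smul]
    exact LinearMap.map_zero (f : Module.Dual ℂ N)

end HeckeDual

/-! ### Induction of a character -/

section Ind

variable {A B S : Type*} [Ring A] [Algebra ℂ A] [Ring B] [Algebra ℂ B] [CommRing S] [Algebra ℂ S]
  (φ : A →ₐ[ℂ] B) (χ : A →ₐ[ℂ] S)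

/-- The relations `bφ(a) ⊗ r = b ⊗ χ(a)r`. -/
def indRel : Submodule (B ⊗[ℂ] S) (B ⊗[ℂ] S) :=
  Submodule.span _ {t | ∃ (b : B) (a : A) (r : S), t = (b * φ a) ⊗ₜ[ℂ] r - b ⊗ₜ[ℂ] (χ a * r)}

/-- The induced `(B, S)`-bimodule `B ⊗_A S`, where `A` acts on `B` from the right through `φ`
and on `S` through `χ`. -/
def Ind : Type _ := (B ⊗[ℂ] S) ⧸ indRel φ χ

instance : AddCommGroup (Ind φ χ) := inferInstanceAs (AddCommGroup ((B ⊗[ℂ] S) ⧸ indRel φ χ))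

instance : Module (B ⊗[ℂ] S) (Ind φ χ) :=
  inferInstanceAs (Module (B ⊗[ℂ] S) ((B ⊗[ℂ] S) ⧸ indRel φ χ))

/-- The class of `b ⊗ r`. -/
def Ind.mk (b : B) (r : S) : Ind φ χ := Submodule.Quotient.mk (b ⊗ₜ[ℂ] r)

noncomputable instance : Module B (Ind φ χ) :=
  Module.compHom _ (Algebra.TensorProduct.includeLeft : B →ₐ[ℂ] B ⊗[ℂ] S).toRingHom

noncomputable instance : Module S (Ind φ χ) :=
  Module.compHom _ (Algebra.TensorProduct.includeRight : S →ₐ[ℂ] B ⊗[ℂ] S).toRingHom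

noncomputable instance : Module ℂ (Ind φ χ) :=
  Module.compHom _ (algebraMap ℂ (B ⊗[ℂ] S))

lemma Ind.smul_left_def (b : B) (v : Ind φ χ) : b • v = (b ⊗ₜ[ℂ] (1 : S)) • v := rfl

lemma Ind.smul_right_def (r : S) (v : Ind φ χ) : r • v = ((1 : B) ⊗ₜ[ℂ] r) • v := rfl

lemma Ind.smul_scalar_def (c : ℂ) (v : Ind φ χ) : c • v = (algebraMap ℂ (B ⊗[ℂ] S) c) • v := rfl

instance : IsScalarTower ℂ B (Ind φ χ) := ⟨fun c b v => by
  rw [Ind.smul_left_def, Ind.smul_left_def, Ind.smul_scalar_def, ← mul_smul, ← Algebra.smul_def,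
    TensorProduct.smul_tmul']⟩

instance : IsScalarTower ℂ S (Ind φ χ) := ⟨fun c r v => by
  rw [Ind.smul_right_def, Ind.smul_right_def, Ind.smul_scalar_def, ← mul_smul, ← Algebra.smul_def,
    TensorProduct.tmul_smul]⟩

instance : SMulCommClass B S (Ind φ χ) := ⟨fun b r v => by
  rw [Ind.smul_left_def, Ind.smul_left_def, Ind.smul_right_def, Ind.smul_right_def, ← mul_smul,
    ← mul_smul]
  simp⟩

end Ind

/-! ### Specialization at the maximal ideal -/

section Special

variable (S : Type*) [CommRing S] [IsLocalRing S] (M : Type*) [AddCommGroup M] [Module S M]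

/-- `M / M𝔪`, where `𝔪` is the maximal ideal of `S`. -/
def Special : Type _ := M ⧸ (IsLocalRing.maximalIdeal S • ⊤ : Submodule S M)

instance : AddCommGroup (Special S M) :=
  inferInstanceAs (AddCommGroup (M ⧸ (IsLocalRing.maximalIdeal S • ⊤ : Submodule S M)))

instance : Module S (Special S M) :=
  inferInstanceAs (Module S (M ⧸ (IsLocalRing.maximalIdeal S • ⊤ : Submodule S M)))

instance [Algebra ℂ S] [Module ℂ M] [IsScalarTower ℂ S M] : Module ℂ (Special S M) :=
  inferInstanceAs (Module ℂ (M ⧸ (IsLocalRing.maximalIdeal S • ⊤ : Submodule S M)))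

instance [Algebra ℂ S] [Module ℂ M] [IsScalarTower ℂ S M] : IsScalarTower ℂ S (Special S M) :=
  inferInstanceAs (IsScalarTower ℂ S (M ⧸ (IsLocalRing.maximalIdeal S • ⊤ : Submodule S M)))

variable {M}

/-- The quotient map. -/
def Special.mk : M →ₗ[S] Special S M :=
  (IsLocalRing.maximalIdeal S • ⊤ : Submodule S M).mkQ

lemma Special.mk_surjective : Function.Surjective (Special.mk S (M := M)) :=
  Submodule.mkQ_surjective _

/-- The endomorphism induced by an endomorphism. -/
def Special.map (f : M →ₗ[S] M) : Special S M →ₗ[S] Special S M :=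
  Submodule.mapQ _ _ f (Submodule.smul_top_le_comap_smul_top _ f)

@[simp] lemma Special.map_mk (f : M →ₗ[S] M) (v : M) :
    Special.map S f (Special.mk S v) = Special.mk S (f v) := rfl

variable (n : ℕ) [Module (Hecke n) M] [SMulCommClass (Hecke n) S M]

noncomputable instance : Module (Hecke n) (Special S M) where
  smul b v := Special.map S (Module.toModuleEnd S (S := Hecke n) M b) v
  one_smul v := by
    obtain ⟨v, rfl⟩ := Special.mk_surjective S v
    exact congrArg (Special.mk S) (one_smul (Hecke n) v)
  mul_smul a b v := by
    obtain ⟨v, rfl⟩ := Special.mk_surjective S v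
    exact congrArg (Special.mk S) (mul_smul a b v)
  smul_zero b := map_zero _
  smul_add b := map_add _
  add_smul a b v := by
    obtain ⟨v, rfl⟩ := Special.mk_surjective S v
    exact congrArg (Special.mk S) (add_smul a b v)
  zero_smul v := by
    obtain ⟨v, rfl⟩ := Special.mk_surjective S v
    exact congrArg (Special.mk S) (zero_smul (Hecke n) v)

instance [Algebra ℂ S] [Module ℂ M] [IsScalarTower ℂ S M] [IsScalarTower ℂ (Hecke n) M] :
    IsScalarTower ℂ (Hecke n) (Special S M) := ⟨fun c b v => by
  obtain ⟨v, rfl⟩ := Special.mk_surjective S v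
  exact congrArg (Special.mk S) (smul_assoc c b v)⟩

end Special

/-! ### `(𝔤𝔩_m, R)`-bimodules -/

/-- The Lie algebra `𝔤𝔩_m(ℂ)`. -/
abbrev gl (m : ℕ) : Type := Matrix (Fin m) (Fin m) ℂ

/-- The ring `R = ℂ⟦z_1, …, z_m⟧`. -/
abbrev PS (m : ℕ) : Type := MvPowerSeries (Fin m) ℂ

/-- The matrix unit `e_{ij}`. -/
def eu {m : ℕ} (i j : Fin m) : gl m := Matrix.single i j 1

/-- A `(𝔤𝔩_m, R)`-bimodule: a complex vector space with commuting actions of the Lie algebra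
`𝔤𝔩_m` and of the commutative `ℂ`-algebra `R`. -/
class IsBimodule (m : ℕ) (M : Type*) [AddCommGroup M] [Module ℂ M] [Module (PS m) M]
    [LieRingModule (gl m) M] : Prop where
  scalar : IsScalarTower ℂ (PS m) M
  lieMod : LieModule ℂ (gl m) M
  lie_ps : ∀ (X : gl m) (r : PS m) (v : M), ⁅X, r • v⁆ = r • ⁅X, v⁆

attribute [instance] IsBimodule.scalar IsBimodule.lieMod

section Bimodule

variable (m : ℕ) (M : Type*) [AddCommGroup M] [Module ℂ M] [Module (PS m) M]
  [LieRingModule (gl m) M] [IsBimodule m M]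
  (N : Type*) [AddCommGroup N] [Module ℂ N] [Module (PS m) N]
  [LieRingModule (gl m) N] [IsBimodule m N]

variable {m} in
/-- The action of `X ∈ 𝔤𝔩_m` as an `R`-linear operator. -/
noncomputable def lieOp (X : gl m) : M →ₗ[PS m] M where
  toFun v := ⁅X, v⁆
  map_add' := lie_add X
  map_smul' r v := IsBimodule.lie_ps X r v

/-- Homomorphisms of `(𝔤𝔩_m, R)`-bimodules. -/
def BHom : Submodule ℂ (M →ₗ[PS m] N) where
  carrier := {f | ∀ (X : gl m) (v : M), f ⁅X, v⁆ = ⁅X, f v⁆}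
  add_mem' {f g} hf hg X v := by
    rw [LinearMap.add_apply, hf X v, hg X v, LinearMap.add_apply, lie_add]
  zero_mem' X v := by simp
  smul_mem' c f hf X v := by
    rw [LinearMap.smul_apply, hf X v, LinearMap.smul_apply, lie_smul]

/-- Bimodule endomorphisms: `R`-linear operators that commute with `𝔤𝔩_m`. -/
noncomputable def BEnd : Subalgebra ℂ (Module.End (PS m) M) :=
  Subalgebra.centralizer ℂ (Set.range fun X : gl m => lieOp M X)

lemma BEnd.map_lie (c : BEnd m M) (X : gl m) (v : M) : (c : Module.End (PS m) M) ⁅X, v⁆ =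
    ⁅X, (c : Module.End (PS m) M) v⁆ :=
  (LinearMap.congr_fun (Subalgebra.mem_centralizer_iff ℂ |>.1 c.2 (lieOp M X) ⟨X, rfl⟩) v).symm

/-- Precomposition: `Hom(M, N)` is a right module over `End(M)`. -/
noncomputable instance : Module (BEnd m M)ᵐᵒᵖ (BHom m M N) where
  smul c f := ⟨(f : M →ₗ[PS m] N) ∘ₗ (c.unop : Module.End (PS m) M), fun X v => by
    rw [LinearMap.comp_apply, BEnd.map_lie, f.2, LinearMap.comp_apply]⟩
  one_smul f := rfl
  mul_smul a b f := rfl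
  smul_zero c := rfl
  smul_add c f g := rfl
  add_smul a b f := Subtype.ext (LinearMap.ext fun v => map_add (f : M →ₗ[PS m] N) _ _)
  zero_smul f := Subtype.ext (LinearMap.ext fun v => map_zero (f : M →ₗ[PS m] N))

/-- The generalized weight space `M_{(λ)} = {v | (e_{ii} - λ_i) v = v z_i for all i}`. -/
def wtSpace (lam : Fin m → ℤ) : Submodule (PS m) M where
  carrier := {v | ∀ i, ⁅eu i i, v⁆ - (lam i : ℂ) • v = (MvPowerSeries.X i : PS m) • v}
  add_mem' {v w} hv hw i := by
    rw [lie_add, smul_add, smul_add, ← hv i, ← hw i]; abel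
  zero_mem' i := by simp
  smul_mem' r v hv i := by
    rw [IsBimodule.lie_ps, smul_comm, ← smul_sub, hv i, smul_comm]

/-- Membership in the deformed BGG category. -/
structure IsDefBGG : Prop where
  /-- `M` is finitely generated as a bimodule. -/
  fg : ∃ s : Finset M, ∀ W : Submodule (PS m) M, (∀ (X : gl m), ∀ v ∈ W, ⁅X, v⁆ ∈ W) →
    (∀ v ∈ s, v ∈ W) → W = ⊤
  /-- `M` is locally finite over the strictly upper triangular matrices. -/
  locFin : ∀ v : M, ∃ W : Submodule ℂ M, v ∈ W ∧ FiniteDimensional ℂ W ∧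
    ∀ X : gl m, (∀ i j, j ≤ i → X i j = 0) → ∀ w ∈ W, ⁅X, w⁆ ∈ W
  /-- `M` is the direct sum of its generalized weight spaces of integral weight. -/
  weights : DirectSum.IsInternal fun lam : Fin m → ℤ => wtSpace m M lam

/-- Membership in the usual BGG category `𝒪` (with integral weights): the objects of the deformed
category on which `R` acts through its residue field `ℂ`. -/
structure IsBGG : Prop extends IsDefBGG m M where
  trivial : ∀ (r : PS m) (v : M), r • v = MvPowerSeries.constantCoeff r • v

end Bimodule


/-! ### Minimal specialization of a bimodule -/

section SpecialBimodule

variable (m : ℕ) (M : Type*) [AddCommGroup M] [Module ℂ M] [Module (PS m) M]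
  [LieRingModule (gl m) M] [IsBimodule m M]

noncomputable instance : LieRingModule (gl m) (Special (PS m) M) where
  bracket X v := Special.map (PS m) (lieOp M X) v
  add_lie X Y v := by
    obtain ⟨v, rfl⟩ := Special.mk_surjective (PS m) v
    exact congrArg (Special.mk (PS m)) (add_lie X Y v)
  lie_add X := map_add _
  leibniz_lie X Y v := by
    obtain ⟨v, rfl⟩ := Special.mk_surjective (PS m) v
    exact congrArg (Special.mk (PS m)) (leibniz_lie X Y v)

lemma Special.lie_mk (X : gl m) (v : M) :
    ⁅X, Special.mk (PS m) v⁆ = Special.mk (PS m) ⁅X, v⁆ := rfl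

instance : IsBimodule m (Special (PS m) M) where
  scalar := inferInstance
  lieMod :=
    { smul_lie := fun c X v => by
        obtain ⟨v, rfl⟩ := Special.mk_surjective (PS m) v
        exact congrArg (Special.mk (PS m)) (smul_lie c X v)
      lie_smul := fun c X v => by
        obtain ⟨v, rfl⟩ := Special.mk_surjective (PS m) v
        exact congrArg (Special.mk (PS m)) (lie_smul c X v) }
  lie_ps X r v := map_smul (Special.map (PS m) (lieOp M X)) r v

end SpecialBimodule

/-! ### The restricted dual -/

section RDual

variable (m : ℕ) (M : Type*) [AddCommGroup M] [Module ℂ M] [Module (PS m) M]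
  [LieRingModule (gl m) M] [IsBimodule m M]

/-- The functionals on `M` that vanish on all but finitely many generalized weight spaces. -/
def rdual : Submodule ℂ (Module.Dual ℂ M) where
  carrier := {f | {lam : Fin m → ℤ | ∃ v ∈ wtSpace m M lam, f v ≠ 0}.Finite}
  add_mem' {f g} hf hg := by
    refine (Set.Finite.union hf hg).subset ?_
    rintro lam ⟨v, hv, h⟩
    by_cases hfv : f v = 0
    · refine Or.inr ⟨v, hv, fun hgv => h ?_⟩
      rw [LinearMap.add_apply, hfv, hgv, add_zero]
    · exact Or.inl ⟨v, hv, hfv⟩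
  zero_mem' := by
    refine Set.finite_empty.subset ?_
    rintro lam ⟨v, hv, h⟩
    exact h rfl
  smul_mem' c f hf := by
    refine Set.Finite.subset hf ?_
    rintro lam ⟨v, hv, h⟩
    refine ⟨v, hv, fun hfv => h ?_⟩
    rw [LinearMap.smul_apply, hfv, smul_zero]

lemma eu_lie (k i j : Fin m) : ⁅eu k k, eu i j⁆ =
    (((if k = i then 1 else 0) - (if k = j then 1 else 0) : ℤ) : ℂ) • eu i j := by
  rw [LieRing.of_associative_ring_bracket]
  unfold eu
  by_cases h1 : k = i <;> by_cases h2 : k = j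
  · subst h1; subst h2; simp
  · subst h1; simp [Matrix.single_mul_single_of_ne, Ne.symm h2, h2]
  · subst h2; simp [Matrix.single_mul_single_of_ne, h1]
  · simp [Matrix.single_mul_single_of_ne, h1, h2, Ne.symm h2]

lemma eu_wtSpace (i j : Fin m) {lam : Fin m → ℤ} {v : M} (hv : v ∈ wtSpace m M lam) :
    ⁅eu i j, v⁆ ∈ wtSpace m M (lam + (Pi.single i 1 - Pi.single j 1)) := by
  intro k
  have h := hv k
  rw [sub_eq_iff_eq_add] at h
  rw [leibniz_lie, eu_lie, h, lie_add, IsBimodule.lie_ps, smul_lie, lie_smul]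
  simp only [Pi.add_apply, Pi.sub_apply, Pi.single_apply]
  generalize (MvPowerSeries.X k : PS m) • ⁅eu i j, v⁆ = w
  push_cast
  module

lemma eu_sum (X : gl m) : X = ∑ i, ∑ j, X i j • eu i j := by
  conv_lhs => rw [Matrix.matrix_eq_sum_single X]
  simp [eu, Matrix.smul_single]

variable {M}

/-- The functional `X f : v ↦ f(Xᵗ v)`. -/
def rdualLie (X : gl m) (f : Module.Dual ℂ M) : Module.Dual ℂ M :=
  f ∘ₗ LieModule.toEnd ℂ (gl m) M X.transpose

lemma rdualLie_mem (X : gl m) {f : Module.Dual ℂ M} (hf : f ∈ rdual m M) :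
    rdualLie m X f ∈ rdual m M := by
  have hf' : {lam : Fin m → ℤ | ∃ v ∈ wtSpace m M lam, f v ≠ 0}.Finite := hf
  refine Set.Finite.subset (Set.finite_iUnion fun i : Fin m => Set.finite_iUnion fun j : Fin m =>
    hf'.preimage (f := fun lam => lam + (Pi.single i 1 - Pi.single j 1))
      (add_left_injective _).injOn) ?_
  rintro lam ⟨v, hv, h⟩
  have h' : f ⁅X.transpose, v⁆ ≠ 0 := h
  rw [eu_sum m X.transpose] at h'
  simp only [sum_lie, smul_lie, map_sum, map_smul] at h'
  obtain ⟨i, -, hi⟩ := Finset.exists_ne_zero_of_sum_ne_zero h'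
  obtain ⟨j, -, hj⟩ := Finset.exists_ne_zero_of_sum_ne_zero hi
  refine Set.mem_iUnion.2 ⟨i, Set.mem_iUnion.2 ⟨j, ?_⟩⟩
  exact ⟨_, eu_wtSpace m M i j hv, (smul_ne_zero_iff.1 hj).2⟩

/-- The functional `r f : v ↦ f(r v)`. -/
noncomputable def rdualPS (r : PS m) (f : Module.Dual ℂ M) : Module.Dual ℂ M :=
  f ∘ₗ Module.toModuleEnd ℂ (S := PS m) M r

lemma rdualPS_mem (r : PS m) {f : Module.Dual ℂ M} (hf : f ∈ rdual m M) :
    rdualPS m r f ∈ rdual m M := by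
  refine Set.Finite.subset hf ?_
  rintro lam ⟨v, hv, h⟩
  exact ⟨r • v, Submodule.smul_mem _ r hv, h⟩

variable (M)

/-- The restricted dual `M^∨ = ⨁_λ Hom_ℂ(M_{(λ)}, ℂ)` of a bimodule that is the direct sum of its
generalized weight spaces, with `𝔤𝔩_m` acting through the transpose. -/
def RDual : Type _ := rdual m M

instance : AddCommGroup (RDual m M) := inferInstanceAs (AddCommGroup (rdual m M))

instance : Module ℂ (RDual m M) := inferInstanceAs (Module ℂ (rdual m M))

noncomputable instance : Module (PS m) (RDual m M) where
  smul r f := (⟨rdualPS m r f.1, rdualPS_mem m r f.2⟩ : rdual m M)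
  one_smul f := Subtype.ext (LinearMap.ext fun v => congrArg f.1 (one_smul (PS m) v))
  mul_smul a b f := Subtype.ext (LinearMap.ext fun v =>
    congrArg f.1 ((congrArg (· • v) (mul_comm a b)).trans (mul_smul b a v)))
  smul_zero _ := rfl
  smul_add _ _ _ := rfl
  add_smul a b f := Subtype.ext (LinearMap.ext fun v =>
    (congrArg f.1 (add_smul a b v)).trans (LinearMap.map_add f.1 _ _))
  zero_smul f := Subtype.ext (LinearMap.ext fun v =>
    (congrArg f.1 (zero_smul (PS m) v)).trans (LinearMap.map_zero f.1))

noncomputable instance : LieRingModule (gl m) (RDual m M) where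
  bracket X f := (⟨rdualLie m X f.1, rdualLie_mem m X f.2⟩ : rdual m M)
  add_lie X Y f := Subtype.ext (LinearMap.ext fun v =>
    (congrArg f.1 (add_lie X.transpose Y.transpose v)).trans (LinearMap.map_add f.1 _ _))
  lie_add X f g := rfl
  leibniz_lie X Y f := Subtype.ext (LinearMap.ext fun v => by
    change f.1 ⁅Y.transpose, ⁅X.transpose, v⁆⁆ =
      f.1 ⁅⁅X, Y⁆.transpose, v⁆ + f.1 ⁅X.transpose, ⁅Y.transpose, v⁆⁆
    have : ⁅X, Y⁆.transpose = ⁅Y.transpose, X.transpose⁆ := by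
      simp only [LieRing.of_associative_ring_bracket, Matrix.transpose_sub, Matrix.transpose_mul]
    rw [this, leibniz_lie Y.transpose, map_add])

instance : IsBimodule m (RDual m M) where
  scalar := ⟨fun c r f => Subtype.ext (LinearMap.ext fun v => by
    change f.1 ((c • r) • v) = c • f.1 (r • v)
    rw [smul_assoc, map_smul])⟩
  lieMod :=
    { smul_lie := fun c X f => Subtype.ext (LinearMap.ext fun v => by
        change f.1 ⁅(c • X).transpose, v⁆ = c • f.1 ⁅X.transpose, v⁆
        rw [Matrix.transpose_smul, smul_lie, map_smul])
      lie_smul := fun c X f => rfl }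
  lie_ps X r f := Subtype.ext (LinearMap.ext fun v => by
    change f.1 (r • ⁅X.transpose, v⁆) = f.1 ⁅X.transpose, r • v⁆
    rw [IsBimodule.lie_ps])

end RDual

/-! ### The tensor product with tensor powers of the vector representation -/

lemma sum_mul_sum_of_comm {A ι : Type*} [Ring A] [Fintype ι] [DecidableEq ι] {f g h : ι → A}
    (hc : ∀ k l, k ≠ l → f k * g l = g l * f k) (hs : ∀ k, f k * g k = h k + g k * f k) :
    (∑ k, f k) * (∑ k, g k) = (∑ k, h k) + (∑ k, g k) * (∑ k, f k) := by
  refine sub_eq_iff_eq_add.1 ?_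
  simp only [Finset.sum_mul_sum]
  rw [Finset.sum_comm (f := fun i j => g i * f j), ← Finset.sum_sub_distrib]
  refine Finset.sum_congr rfl fun k _ => ?_
  rw [← Finset.sum_sub_distrib, Finset.sum_eq_single k]
  · rw [hs, add_sub_cancel_right]
  · intro l _ hl
    rw [hc k l hl.symm, sub_self]
  · simp

section Tensor

variable (m n : ℕ)

/-- The tensor power `V^{⊗n}` of the vector representation `V = ℂ^m`. -/
abbrev VPow : Type := ⨂[ℂ] _ : Fin n, (Fin m → ℂ)

/-- `X` acting on the `k`-th factor of `V^{⊗n}`. -/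
noncomputable def slotV (k : Fin n) : gl m →ₗ[ℂ] Module.End ℂ (VPow m n) :=
  (PiTensorProduct.mapMultilinear ℂ (fun _ : Fin n => Fin m → ℂ)
    (fun _ : Fin n => Fin m → ℂ)).toLinearMap (fun _ => LinearMap.id) k ∘ₗ
      (Matrix.toLin' : gl m ≃ₗ[ℂ] _).toLinearMap

lemma slotV_apply (k : Fin n) (X : gl m) : slotV m n k X =
    PiTensorProduct.map (Function.update (fun _ => LinearMap.id) k (Matrix.toLin' X)) := rfl

lemma slotV_mul (k : Fin n) (X Y : gl m) :
    slotV m n k X * slotV m n k Y = slotV m n k (X * Y) := by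
  simp only [slotV_apply]
  rw [← PiTensorProduct.map_mul]
  congr 1
  funext i
  rcases eq_or_ne i k with rfl | h
  · simp [Matrix.toLin'_mul, Module.End.mul_eq_comp]
  · simp [h, Module.End.mul_eq_comp]

lemma slotV_one (k : Fin n) : slotV m n k 1 = 1 := by
  rw [slotV_apply, Matrix.toLin'_one, Function.update_eq_self_iff.2 rfl]
  exact PiTensorProduct.map_one

lemma slotV_comm {k l : Fin n} (hkl : k ≠ l) (X Y : gl m) :
    slotV m n k X * slotV m n l Y = slotV m n l Y * slotV m n k X := by
  simp only [slotV_apply]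
  rw [← PiTensorProduct.map_mul, ← PiTensorProduct.map_mul]
  congr 1
  funext i
  rcases eq_or_ne i k with rfl | h
  · simp [hkl, Module.End.mul_eq_comp]
  · rcases eq_or_ne i l with rfl | h'
    · simp [h, Module.End.mul_eq_comp]
    · simp [h, h', Module.End.mul_eq_comp]

/-- `X ∈ 𝔤𝔩_m` acts on `V^{⊗n}` as the sum of its actions on the factors. -/
noncomputable instance : LieRingModule (gl m) (VPow m n) where
  bracket X w := (∑ k, slotV m n k X) w
  add_lie X Y w := by
    simp only [map_add, Finset.sum_add_distrib, LinearMap.add_apply]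
  lie_add X := map_add _
  leibniz_lie X Y w := by
    have h := sum_mul_sum_of_comm (f := fun k => slotV m n k X) (g := fun k => slotV m n k Y)
      (h := fun k => slotV m n k ⁅X, Y⁆) (fun k l hkl => slotV_comm m n hkl X Y) (fun k => by
        rw [slotV_mul, slotV_mul, ← map_add, LieRing.of_associative_ring_bracket, sub_add_cancel])
    exact LinearMap.congr_fun h w

lemma VPow.lie_def (X : gl m) (w : VPow m n) : ⁅X, w⁆ = ∑ k, slotV m n k X w :=
  LinearMap.sum_apply _ _ _

instance : LieModule ℂ (gl m) (VPow m n) where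
  smul_lie c X w := by simp only [VPow.lie_def, map_smul, LinearMap.smul_apply, Finset.smul_sum]
  lie_smul c X w := by simp only [VPow.lie_def, map_smul, Finset.smul_sum]

variable (M : Type*) [AddCommGroup M] [Module ℂ M] [Module (PS m) M]
  [LieRingModule (gl m) M] [IsBimodule m M]

/-- The bimodule `M ⊗ V^{⊗n}`; `𝔤𝔩_m` acts diagonally and `R` acts on `M`. -/
abbrev Tens : Type _ := M ⊗[ℂ] VPow m n

instance : IsBimodule m (Tens m n M) where
  scalar := inferInstance
  lieMod := inferInstance
  lie_ps X r t := by
    induction t using TensorProduct.induction_on with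
    | zero => simp
    | add a b ha hb => rw [smul_add, lie_add, lie_add, smul_add, ha, hb]
    | tmul v w =>
      rw [TensorProduct.smul_tmul', TensorProduct.LieModule.lie_tmul_right,
        TensorProduct.LieModule.lie_tmul_right, smul_add, TensorProduct.smul_tmul',
        TensorProduct.smul_tmul', IsBimodule.lie_ps]

/-- `X^{(a)}`: the element `X` acting on the `a`-th factor of
`M ⊗ V ⊗ ⋯ ⊗ V`, where `M` is the factor number `0`. -/
noncomputable def slot : Fin (n + 1) → gl m → Module.End (PS m) (Tens m n M) :=
  Fin.cases (fun X => TensorProduct.AlgebraTensorModule.map (lieOp M X) LinearMap.id)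
    (fun k X => TensorProduct.AlgebraTensorModule.map LinearMap.id (slotV m n k X))

lemma slot_zero_tmul (X : gl m) (v : M) (w : VPow m n) :
    slot m n M 0 X (v ⊗ₜ w) = ⁅X, v⁆ ⊗ₜ w := rfl

lemma slot_succ_tmul (k : Fin n) (X : gl m) (v : M) (w : VPow m n) :
    slot m n M k.succ X (v ⊗ₜ w) = v ⊗ₜ slotV m n k X w := rfl

variable {m n M} in
lemma Tens.ext {f g : Module.End (PS m) (Tens m n M)} (h : ∀ v w, f (v ⊗ₜ w) = g (v ⊗ₜ w)) :
    f = g := by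
  refine LinearMap.ext fun t => ?_
  induction t using TensorProduct.induction_on with
  | zero => rw [map_zero, map_zero]
  | add a b ha hb => rw [map_add, map_add, ha, hb]
  | tmul v w => exact h v w

lemma slot_comm {a b : Fin (n + 1)} (hab : a ≠ b) (X Y : gl m) :
    slot m n M a X * slot m n M b Y = slot m n M b Y * slot m n M a X := by
  refine Tens.ext fun v w => ?_
  simp only [Module.End.mul_apply]
  induction a using Fin.cases with
  | zero =>
    induction b using Fin.cases with
    | zero => exact absurd rfl hab
    | succ l => rfl
  | succ k =>
    induction b using Fin.cases with
    | zero => rfl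
    | succ l =>
      simp only [slot_succ_tmul]
      rw [← Module.End.mul_apply, slotV_comm m n (fun h => hab (congrArg _ h)),
        Module.End.mul_apply]

lemma slot_lie (a : Fin (n + 1)) (X Y : gl m) :
    slot m n M a X * slot m n M a Y - slot m n M a Y * slot m n M a X = slot m n M a ⁅X, Y⁆ := by
  refine Tens.ext fun v w => ?_
  simp only [Module.End.mul_apply, LinearMap.sub_apply]
  induction a using Fin.cases with
  | zero => simp only [slot_zero_tmul, lie_lie, TensorProduct.sub_tmul]
  | succ k =>
    simp only [slot_succ_tmul]
    rw [← Module.End.mul_apply, ← Module.End.mul_apply, slotV_mul, slotV_mul,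
      LieRing.of_associative_ring_bracket, map_sub, LinearMap.sub_apply, TensorProduct.tmul_sub]

lemma slot_sub (a : Fin (n + 1)) (X Y : gl m) :
    slot m n M a (X - Y) = slot m n M a X - slot m n M a Y := by
  refine Tens.ext fun v w => ?_
  rw [LinearMap.sub_apply]
  induction a using Fin.cases with
  | zero => simp only [slot_zero_tmul, sub_lie, TensorProduct.sub_tmul]
  | succ k => simp only [slot_succ_tmul, map_sub, LinearMap.sub_apply, TensorProduct.tmul_sub]

lemma slot_zero (a : Fin (n + 1)) : slot m n M a 0 = 0 := by
  have := slot_sub m n M a 0 0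
  rwa [sub_zero, sub_self] at this

lemma slot_succ_mul (k : Fin n) (X Y : gl m) :
    slot m n M k.succ X * slot m n M k.succ Y = slot m n M k.succ (X * Y) := by
  refine Tens.ext fun v w => ?_
  simp only [Module.End.mul_apply, slot_succ_tmul]
  rw [← Module.End.mul_apply, slotV_mul]

lemma lieOp_Tens (X : gl m) : lieOp (Tens m n M) X = ∑ a, slot m n M a X := by
  refine Tens.ext fun v w => ?_
  rw [Fin.sum_univ_succ, LinearMap.add_apply, LinearMap.sum_apply]
  simp only [slot_zero_tmul, slot_succ_tmul]
  change ⁅X, v ⊗ₜ[ℂ] w⁆ = _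
  rw [TensorProduct.LieModule.lie_tmul_right, VPow.lie_def, TensorProduct.tmul_sum]

lemma slot_eu_sum (a : Fin (n + 1)) (X : gl m) :
    slot m n M a X = ∑ i, ∑ j, X i j • slot m n M a (eu i j) := by
  refine Tens.ext fun v w => ?_
  conv_lhs => rw [eu_sum m X]
  simp only [LinearMap.sum_apply, LinearMap.smul_apply]
  induction a using Fin.cases with
  | zero => simp only [slot_zero_tmul, sum_lie, smul_lie, TensorProduct.sum_tmul,
      TensorProduct.smul_tmul']
  | succ k => simp only [slot_succ_tmul, map_sum, map_smul, LinearMap.sum_apply,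
      LinearMap.smul_apply, TensorProduct.tmul_sum, TensorProduct.tmul_smul]

/-- `e_{ij}^{(a)}`. -/
noncomputable def slotE (a : Fin (n + 1)) (i j : Fin m) : Module.End (PS m) (Tens m n M) :=
  slot m n M a (eu i j)

lemma eu_mul (i j k l : Fin m) : (eu i j * eu k l : gl m) = if j = k then eu i l else 0 := by
  unfold eu
  split_ifs with h
  · subst h; simp
  · exact Matrix.single_mul_single_of_ne _ _ _ _ h _

lemma slotRel : SlotRel (slotE m n M) where
  comm a b hab i j k l := slot_comm m n M hab _ _
  lie a i j k l := by
    unfold slotE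
    rw [slot_lie, LieRing.of_associative_ring_bracket, slot_sub, eu_mul, eu_mul]
    congr 1 <;> split_ifs <;> first | rfl | exact slot_zero m n M a
  mul a ha i j k l := by
    obtain ⟨k', rfl⟩ := Fin.exists_succ_eq.2 (fun h : a = 0 => ha (congrArg Fin.val h))
    unfold slotE
    rw [slot_succ_mul, eu_mul]
    split_ifs <;> first | rfl | exact slot_zero m n M _
  one a ha := by
    obtain ⟨k', rfl⟩ := Fin.exists_succ_eq.2 (fun h : a = 0 => ha (congrArg Fin.val h))
    refine Tens.ext fun v w => ?_
    simp only [slotE, LinearMap.sum_apply, slot_succ_tmul, Module.End.one_apply]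
    rw [← TensorProduct.tmul_sum, ← LinearMap.sum_apply, ← map_sum]
    have : (∑ i, eu i i : gl m) = 1 := by
      rw [eu_sum m (1 : gl m)]
      simp [Matrix.one_apply]
    rw [this, slotV_one, Module.End.one_apply]

lemma Om_mem_BEnd {a b : Fin (n + 1)} (hab : a ≠ b) :
    Om (slotE m n M) a b ∈ BEnd m (Tens m n M) := by
  have S := slotRel m n M
  refine (Subalgebra.mem_centralizer_iff ℂ).2 ?_
  rintro _ ⟨X, rfl⟩
  have hsub : ({a, b} : Finset (Fin (n + 1))) ⊆ Finset.univ := Finset.subset_univ _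
  change Commute (lieOp (Tens m n M) X) _
  rw [lieOp_Tens, ← Finset.sum_sdiff hsub, Finset.sum_pair hab]
  refine Commute.add_left (Commute.sum_left _ _ _ fun c hc => ?_) ?_
  · simp only [Finset.mem_sdiff, Finset.mem_insert, Finset.mem_singleton, not_or] at hc
    rw [slot_eu_sum m n M c X]
    exact Commute.sum_left _ _ _ fun i _ => Commute.sum_left _ _ _ fun j _ =>
      ((Om_commute_of_ne S hc.2.1 hc.2.2 i j).symm).smul_left (X i j)
  · rw [slot_eu_sum m n M a X, slot_eu_sum m n M b X]
    simp only [← Finset.sum_add_distrib, ← smul_add]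
    refine Commute.sum_left _ _ _ fun i _ => Commute.sum_left _ _ _ fun j _ => ?_
    exact ((Om_diag S hab i j).symm).smul_left (X i j)

/-- `Ω^{(a,b)}` as a bimodule endomorphism of `M ⊗ V^{⊗n}`, for `a ≠ b`. -/
noncomputable def casimir (a b : Fin (n + 1)) (hab : a ≠ b) : BEnd m (Tens m n M) :=
  ⟨Om (slotE m n M) a b, Om_mem_BEnd m n M hab⟩

/-- `∑_{a < b} Ω^{(a,b)}` as a bimodule endomorphism of `M ⊗ V^{⊗n}`. -/
noncomputable def casimirLt (b : Fin (n + 1)) : BEnd m (Tens m n M) :=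
  ⟨OmLt (slotE m n M) b, Subalgebra.sum_mem _ fun _ ha =>
    Om_mem_BEnd m n M (Finset.mem_Iio.1 ha).ne⟩

/-- The right action of `H_n` on `M ⊗ V^{⊗n}`: in the numbering of the factors of the tensor
product by `0, …, n`, the generators `x_1, …, x_n` and `s_1, …, s_{n-1}` act as
`∑_{j < i} Ω^{(j,i)}` and `Ω^{(i,i+1)}`. -/
noncomputable def actHom : Hecke n →ₐ[ℂ] (BEnd m (Tens m n M))ᵐᵒᵖ :=
  ParHecke.lift (x' := fun i => MulOpposite.op (casimirLt m n M i.succ))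
    (s' := fun i h _ => MulOpposite.op (casimir m n M ⟨i + 1, by omega⟩ ⟨i + 2, by omega⟩
      (by simp)))
    { x_comm := fun i j => MulOpposite.unop_injective (Subtype.ext
        (OmLt_commute (slotRel m n M) _ _).eq)
      s_sq := fun i h _ => MulOpposite.unop_injective (Subtype.ext
        (Om_sq (slotRel m n M) (by simp) (by simp) (by simp)))
      braid := fun i h _ h' _ => MulOpposite.unop_injective (Subtype.ext (by
        have := Om_braid (slotRel m n M) (a := ⟨i + 1, by omega⟩) (b := ⟨i + 2, by omega⟩)
          (c := ⟨i + 3, by omega⟩) (by simp) (by simp) (by simp) (by simp) (by simp) (by simp)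
        rw [mul_assoc, mul_assoc] at this
        exact this))
      s_comm := fun i h _ j h' _ hij => MulOpposite.unop_injective (Subtype.ext
        (Om_commute_Om (slotRel m n M) (by simp; omega) (by simp; omega) (by simp; omega)
          (by simp; omega)).eq)
      x_succ_s := fun i h _ => MulOpposite.unop_injective (Subtype.ext
        (Om_OmLt_succ (slotRel m n M) (b := ⟨i + 1, by omega⟩) (c := ⟨i + 2, by omega⟩) rfl
          (by simp)))
      x_s := fun i h _ j h₀ h₁ => MulOpposite.unop_injective (Subtype.ext
        (Om_commute_OmLt (slotRel m n M) (b := ⟨i + 1, by omega⟩) (c := ⟨i + 2, by omega⟩)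
          (d := j.succ) rfl (by rw [Ne, Fin.ext_iff]; simp; omega)
          (by rw [Ne, Fin.ext_iff]; simp; omega)).eq) }

end Tensor

/-! ### Verma modules -/

section Verma

variable (m : ℕ)

/-- The Borel subalgebra `𝔟` of upper triangular matrices. -/
def borel : LieSubalgebra ℂ (gl m) where
  carrier := {X | ∀ i j, j < i → X i j = 0}
  add_mem' {X Y} hX hY i j h := by rw [Matrix.add_apply, hX i j h, hY i j h, add_zero]
  zero_mem' i j h := rfl
  smul_mem' c X hX i j h := by rw [Matrix.smul_apply, hX i j h, smul_zero]
  lie_mem' {X Y} hX hY i j h := by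
    have key : ∀ X Y : gl m, (∀ i j, j < i → X i j = 0) → (∀ i j, j < i → Y i j = 0) →
        (X * Y) i j = 0 := by
      intro X Y hX hY
      rw [Matrix.mul_apply]
      refine Finset.sum_eq_zero fun k _ => ?_
      rcases lt_or_ge k i with hk | hk
      · rw [hX i k hk, zero_mul]
      · rw [hY k j (lt_of_lt_of_le h hk), mul_zero]
    rw [LieRing.of_associative_ring_bracket, Matrix.sub_apply, key X Y hX hY, key Y X hY hX,
      sub_zero]

lemma borel_mul_diag {X Y : gl m} (hX : X ∈ borel m) (hY : Y ∈ borel m) (i : Fin m) :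
    (X * Y) i i = X i i * Y i i := by
  rw [Matrix.mul_apply]
  refine Finset.sum_eq_single i (fun k _ hk => ?_) (by simp)
  rcases lt_or_gt_of_ne hk with h | h
  · rw [hX i k h, zero_mul]
  · rw [hY k i h, mul_zero]

/-- The action of `𝔟` on `R_μ`: `e_{ii}` acts as `μ_i + z_i`, and `e_{ij}` acts as `0` for
`i < j`. -/
noncomputable def borelChar (mu : Fin m → ℤ) : borel m →ₗ⁅ℂ⁆ PS m where
  toFun X := ∑ i, X.1 i i • (MvPowerSeries.C (mu i : ℂ) + MvPowerSeries.X i)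
  map_add' X Y := by
    rw [← Finset.sum_add_distrib]
    exact Finset.sum_congr rfl fun i _ => add_smul _ _ _
  map_smul' c X := by
    rw [RingHom.id_apply, Finset.smul_sum]
    exact Finset.sum_congr rfl fun i _ => mul_smul _ _ _
  map_lie' {X Y} := by
    rw [LieRing.of_associative_ring_bracket, mul_comm, sub_self]
    refine Finset.sum_eq_zero fun i _ => ?_
    have : (⁅X, Y⁆ : borel m).1 i i = 0 := by
      rw [LieSubalgebra.coe_bracket, LieRing.of_associative_ring_bracket, Matrix.sub_apply,
        borel_mul_diag m X.2 Y.2, borel_mul_diag m Y.2 X.2, mul_comm, sub_self]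
    rw [this, zero_smul]

/-- The inclusion `U(𝔟) → U(𝔤𝔩_m)`. -/
noncomputable def borelIncl :
    UniversalEnvelopingAlgebra ℂ (borel m) →ₐ[ℂ] UniversalEnvelopingAlgebra ℂ (gl m) :=
  UniversalEnvelopingAlgebra.lift ℂ ((UniversalEnvelopingAlgebra.ι ℂ).comp (borel m).incl)

/-- The weight `ρ = (0, -1, …, -m + 1)`. -/
def rho : Fin m → ℤ := fun i => -(i : ℤ)

/-- The deformed Verma module `U(𝔤𝔩_m) ⊗_{U(𝔟)} R_{λ - ρ}`. -/
def DVerma (lam : Fin m → ℤ) : Type :=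
  Ind (borelIncl m) (UniversalEnvelopingAlgebra.lift ℂ (borelChar m (lam - rho m)))

variable (lam : Fin m → ℤ)

noncomputable instance : AddCommGroup (DVerma m lam) :=
  inferInstanceAs (AddCommGroup (Ind (borelIncl m) (UniversalEnvelopingAlgebra.lift ℂ _)))

noncomputable instance : Module ℂ (DVerma m lam) :=
  inferInstanceAs (Module ℂ (Ind (borelIncl m) (UniversalEnvelopingAlgebra.lift ℂ _)))

noncomputable instance : Module (PS m) (DVerma m lam) :=
  inferInstanceAs (Module (PS m) (Ind (borelIncl m) (UniversalEnvelopingAlgebra.lift ℂ _)))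

noncomputable instance : Module (UniversalEnvelopingAlgebra ℂ (gl m)) (DVerma m lam) :=
  inferInstanceAs (Module (UniversalEnvelopingAlgebra ℂ (gl m))
    (Ind (borelIncl m) (UniversalEnvelopingAlgebra.lift ℂ _)))

instance : IsScalarTower ℂ (PS m) (DVerma m lam) :=
  inferInstanceAs (IsScalarTower ℂ (PS m)
    (Ind (borelIncl m) (UniversalEnvelopingAlgebra.lift ℂ _)))

instance : IsScalarTower ℂ (UniversalEnvelopingAlgebra ℂ (gl m)) (DVerma m lam) :=
  inferInstanceAs (IsScalarTower ℂ (UniversalEnvelopingAlgebra ℂ (gl m))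
    (Ind (borelIncl m) (UniversalEnvelopingAlgebra.lift ℂ _)))

instance : SMulCommClass (UniversalEnvelopingAlgebra ℂ (gl m)) (PS m) (DVerma m lam) :=
  inferInstanceAs (SMulCommClass (UniversalEnvelopingAlgebra ℂ (gl m)) (PS m)
    (Ind (borelIncl m) (UniversalEnvelopingAlgebra.lift ℂ _)))

noncomputable instance : LieRingModule (gl m) (DVerma m lam) where
  bracket X v := UniversalEnvelopingAlgebra.ι ℂ X • v
  add_lie X Y v := by
    change UniversalEnvelopingAlgebra.ι ℂ (X + Y) • v = _
    rw [map_add, add_smul]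
  lie_add X v w := smul_add _ _ _
  leibniz_lie X Y v := by
    change UniversalEnvelopingAlgebra.ι ℂ X • UniversalEnvelopingAlgebra.ι ℂ Y • v =
      UniversalEnvelopingAlgebra.ι ℂ ⁅X, Y⁆ • v +
        UniversalEnvelopingAlgebra.ι ℂ Y • UniversalEnvelopingAlgebra.ι ℂ X • v
    rw [LieHom.map_lie, LieRing.of_associative_ring_bracket, sub_smul, mul_smul, mul_smul,
      sub_add_cancel]

lemma DVerma.lie_def (X : gl m) (v : DVerma m lam) :
    ⁅X, v⁆ = UniversalEnvelopingAlgebra.ι ℂ X • v := rfl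

instance : IsBimodule m (DVerma m lam) where
  scalar := inferInstance
  lieMod :=
    { smul_lie := fun c X v => by
        rw [DVerma.lie_def, DVerma.lie_def, map_smul, smul_assoc]
      lie_smul := fun c X v => by
        rw [DVerma.lie_def, DVerma.lie_def, smul_algebra_smul_comm] }
  lie_ps X r v := smul_comm (UniversalEnvelopingAlgebra.ι ℂ X) r v

/-- The Verma module `M(λ)` of highest weight `λ - ρ`, the minimal specialization of the deformed
Verma module. -/
abbrev Verma : Type := Special (PS m) (DVerma m lam)

end Verma

/-! ### The Arakawa–Suzuki functor -/

section Functor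

variable (m n : ℕ) (M : Type*) [AddCommGroup M] [Module ℂ M] [Module (PS m) M]
  [LieRingModule (gl m) M] [IsBimodule m M]

/-- `Φ(M) = Hom(M̃(ρ) ⊗ V^{⊗n}, M)`. -/
def Phi : Type _ := BHom m (Tens m n (DVerma m (rho m))) M

noncomputable instance : AddCommGroup (Phi m n M) :=
  inferInstanceAs (AddCommGroup (BHom m (Tens m n (DVerma m (rho m))) M))

noncomputable instance : Module ℂ (Phi m n M) :=
  inferInstanceAs (Module ℂ (BHom m (Tens m n (DVerma m (rho m))) M))

/-- `(h f)(t) = f(t h)`. -/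
noncomputable instance : Module (Hecke n) (Phi m n M) :=
  letI : Module (BEnd m (Tens m n (DVerma m (rho m))))ᵐᵒᵖ (Phi m n M) :=
    inferInstanceAs (Module (BEnd m (Tens m n (DVerma m (rho m))))ᵐᵒᵖ
      (BHom m (Tens m n (DVerma m (rho m))) M))
  Module.compHom _ (actHom m n (DVerma m (rho m))).toRingHom

lemma Phi.smul_apply (h : Hecke n) (f : Phi m n M) (t : Tens m n (DVerma m (rho m))) :
    (h • f).1 t = f.1 ((actHom m n (DVerma m (rho m)) h).unop.1 t) := rfl

instance : IsScalarTower ℂ (Hecke n) (Phi m n M) := ⟨fun c h f => by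
  refine Subtype.ext (LinearMap.ext fun t => ?_)
  rw [Phi.smul_apply, map_smul]
  change f.1 (c • (actHom m n (DVerma m (rho m)) h).unop.1 t) = c • (h • f).1 t
  rw [Phi.smul_apply]
  exact map_smul ((f.1).restrictScalars ℂ) c _⟩

end Functor

/-! ### Kostant partitions and the modules of the Hecke algebra attached to them -/

section Kostant

/-- The element `α(i,j) = α_i + ⋯ + α_{j-1}` of the positive root cone `Q⁺ = ⨁_{i ∈ ℤ} ℕ α_i` of
type `A_∞`. -/
noncomputable def alpha (i j : ℤ) : ℤ →₀ ℕ := ∑ k ∈ Finset.Ico i j, Finsupp.single k 1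

/-- The height of an element of `Q⁺`. -/
noncomputable def ht (β : ℤ →₀ ℕ) : ℕ := Finsupp.degree β

/-- A positive root `α(i,j)`, `i < j`. -/
@[ext] structure PosRoot where
  i : ℤ
  j : ℤ
  lt : i < j

/-- The lexicographic total order on positive roots. -/
noncomputable instance : LinearOrder PosRoot :=
  LinearOrder.lift' (fun a => (toLex (a.i, a.j) : ℤ ×ₗ ℤ)) fun a b h => by
    have h' : (a.i, a.j) = (b.i, b.j) := toLex.injective h
    exact PosRoot.ext (congrArg Prod.fst h') (congrArg Prod.snd h')

/-- The Kostant partitions of `β`. -/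
def KP (β : ℤ →₀ ℕ) : Type := {π : Multiset PosRoot // (π.map fun a => alpha a.i a.j).sum = β}

variable {β : ℤ →₀ ℕ} (π : KP β)

namespace KP

/-- The roots of a Kostant partition in decreasing order. -/
noncomputable def roots : List PosRoot := π.1.sort (· ≥ ·)

/-- The number of roots. -/
noncomputable def size : ℕ := π.roots.length

/-- The `k`-th root `α(i_k, j_k)`, in decreasing order. -/
noncomputable def root (k : Fin π.size) : PosRoot := π.roots.get k

/-- The number `n_k = j_k - i_k`. -/
noncomputable def len (k : Fin π.size) : ℕ := ((π.root k).j - (π.root k).i).toNat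

lemma ht_alpha (i j : ℤ) : ht (alpha i j) = (j - i).toNat := by
  unfold ht alpha
  rw [map_sum]
  simp

lemma sum_len : ∑ k, π.len k = ht β := by
  have h1 : (∑ k, alpha (π.root k).i (π.root k).j) = (π.1.map fun a => alpha a.i a.j).sum := by
    conv_rhs => rw [← Multiset.sort_eq π.1 (· ≥ ·), Multiset.map_coe, Multiset.sum_coe]
    refine (List.sum_ofFn (f := fun k => alpha (π.root k).i (π.root k).j)).symm.trans
      (congrArg List.sum ?_)
    conv_rhs => rw [← List.ofFn_get (l := Multiset.sort π.1 (· ≥ ·)), List.map_ofFn]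
    rfl
  have h2 := h1.trans π.2
  refine Eq.trans ?_ (congrArg ht h2)
  unfold ht
  rw [map_sum]
  exact Finset.sum_congr rfl fun k _ => (ht_alpha _ _).symm

/-- Writes a position `l` as `a_k + c` with `0 ≤ c < n_k`, where the `k`-th block starts at the
position `a_k = n_1 + ⋯ + n_{k-1}` (positions start at `0`). -/
noncomputable def pos (l : Fin (ht β)) : (k : Fin π.size) × Fin (π.len k) :=
  finSigmaFinEquiv.symm (Fin.cast π.sum_len.symm l)

lemma pos_spec (l : Fin (ht β)) :
    (l : ℕ) = ∑ i : Fin (π.pos l).1, π.len (Fin.castLE (π.pos l).1.2.le i) + (π.pos l).2 := by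
  rw [← finSigmaFinEquiv_apply]
  simp [pos]

/-- The `l` such that the positions `l` and `l + 1` are in the same block. -/
def simpleRefl : Set ℕ :=
  {l | ∃ h : l + 1 < ht β, (π.pos ⟨l, Nat.lt_of_succ_lt h⟩).1 = (π.pos ⟨l + 1, h⟩).1}

lemma pos_succ {l : ℕ} (h : l + 1 < ht β)
    (hl : (π.pos ⟨l, Nat.lt_of_succ_lt h⟩).1 = (π.pos ⟨l + 1, h⟩).1) :
    ((π.pos ⟨l + 1, h⟩).2 : ℕ) = (π.pos ⟨l, Nat.lt_of_succ_lt h⟩).2 + 1 := by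
  have h1 := π.pos_spec ⟨l, Nat.lt_of_succ_lt h⟩
  have h2 := π.pos_spec ⟨l + 1, h⟩
  have h3 := congrArg
    (fun k : Fin π.size => ∑ i : Fin k, π.len (Fin.castLE k.2.le i)) hl
  simp only at h1 h2 h3
  omega

/-- The scalar `i_k + (l - a_k) + z_k` by which `x_l` acts on `ℂ⟦z_1, z_2, …⟧`. -/
noncomputable def xScalar (l : Fin (ht β)) : PS π.size :=
  MvPowerSeries.C (((π.root (π.pos l).1).i + ((π.pos l).2 : ℕ) : ℤ) : ℂ) +
    MvPowerSeries.X (π.pos l).1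

/-- The action of the parabolic algebra `H_{n_1} ⊗ H_{n_2} ⊗ ⋯` on `ℂ⟦z_1, z_2, …⟧`: `x_l` acts as
the scalar `i_k + (l - a_k) + z_k` and the symmetric groups act trivially. -/
noncomputable def char : ParHecke (ht β) π.simpleRefl →ₐ[ℂ] PS π.size :=
  ParHecke.lift (x' := π.xScalar) (s' := fun _ _ _ => 1)
    { x_comm := fun _ _ => mul_comm _ _
      s_sq := fun _ _ _ => mul_one 1
      braid := fun _ _ _ _ _ => rfl
      s_comm := fun _ _ _ _ _ _ _ => rfl
      x_succ_s := fun l h hJ => by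
        obtain ⟨h', hl⟩ := hJ
        rw [mul_one, one_mul]
        unfold xScalar
        rw [π.pos_succ h hl, ← hl]
        push_cast
        simp only [map_add, map_one]
        ring
      x_s := fun _ _ _ _ _ _ => by rw [mul_one, one_mul] }

end KP

/-- The standard module `Δ_H(π)`, for a Kostant partition `π` without repeated roots: the module
over `H_n` (with its commuting action of `ℂ⟦z_1, z_2, …⟧`) induced from the parabolic algebra. -/
abbrev StdH : Type := Ind (ParHecke.toHecke (ht β) π.simpleRefl) π.char

/-- The proper standard module `Δ_H(π) / 𝔪 Δ_H(π)`. -/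
abbrev PStdH : Type := Special (PS π.size) (StdH π)

/-- The proper costandard module, the dual of the proper standard module. -/
abbrev PCStdH : Type := CDual (ht β) (PStdH π)

end Kostant

section Weights

variable {m : ℕ}

/-- The orbit `Π_λ = 𝔖_m λ`. -/
def weylOrbit (lam : Fin m → ℤ) : Set (Fin m → ℤ) := {mu | ∃ w : Equiv.Perm (Fin m), mu = lam ∘ w}

/-- `β = ∑_i α(-i + 1, λ_i)`. -/
noncomputable def betaOf (lam : Fin m → ℤ) : ℤ →₀ ℕ := ∑ i : Fin m, alpha (-(i : ℤ)) (lam i)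

lemma alpha_add {i j k : ℤ} (hij : i ≤ j) (hjk : j ≤ k) : alpha i j + alpha j k = alpha i k := by
  unfold alpha
  rw [← Finset.Ico_union_Ico_eq_Ico hij hjk,
    Finset.sum_union (Finset.Ico_disjoint_Ico_consecutive _ _ _)]

lemma betaOf_perm {lam mu : Fin m → ℤ} (hlam : ∀ i, 0 < lam i) (hmu : mu ∈ weylOrbit lam) :
    betaOf mu = betaOf lam := by
  obtain ⟨w, rfl⟩ := hmu
  have h : ∀ nu : Fin m → ℤ, (∀ i, 0 < nu i) →
      betaOf nu = (∑ i : Fin m, alpha (-(i : ℤ)) 0) + ∑ i, alpha 0 (nu i) := by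
    intro nu hnu
    rw [← Finset.sum_add_distrib]
    exact Finset.sum_congr rfl fun i _ => (alpha_add (by omega) (hnu i).le).symm
  rw [h lam hlam, h (lam ∘ w) fun i => hlam (w i)]
  congr 1
  exact Equiv.sum_comp w fun i => alpha 0 (lam i)

lemma weylOrbit_pos {lam mu : Fin m → ℤ} (hlam : ∀ i, 0 < lam i) (hmu : mu ∈ weylOrbit lam)
    (i : Fin m) : 0 < mu i := by
  obtain ⟨w, rfl⟩ := hmu
  exact hlam (w i)

/-- The Kostant partition `π_μ = {α(0, μ_1), α(-1, μ_2), …, α(-m + 1, μ_m)}` of `β`. -/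
noncomputable def piMu (lam mu : Fin m → ℤ) (hlam : ∀ i, 0 < lam i) (hmu : mu ∈ weylOrbit lam) :
    KP (betaOf lam) :=
  ⟨Finset.univ.val.map fun i : Fin m =>
    ⟨-(i : ℤ), mu i, by have := weylOrbit_pos hlam hmu i; omega⟩, by
    rw [Multiset.map_map, ← betaOf_perm hlam hmu]
    rfl⟩

end Weights
end ArakawaSuzuki

open ArakawaSuzuki

universe u

set_option linter.unusedSectionVars false
set_option linter.unusedVariables false

/-! The functor is computed through singular vectors. Since `DVerma m (rho m)` is induced from the
character of 𝔟 of weight ρ - ρ = 0, a homomorphism from M̃(ρ) ⊗ V^{⊗n} to M is the same as a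
singular vector of weight 0 in the bimodule `HomV m n M` of linear maps V^{⊗n} → M (`ev_mem`,
`ev_injective`, `exists_ev_eq`). The generators of H_n become explicit operators `opS` and `opX` on
all of `HomV m n M`, and these commute with 𝔤.

The main tool is a splitting: if the heights of the weights are bounded above, the zero weight space
is the direct sum of the singular vectors `sing` and of the span `lowered` of the images of negative
root vectors (`sing_inf_lowered`, `sing_sup_lowered`). The reason is that 0 is dominant. The Casimir
operator, shifted to kill singular vectors of weight 0, is triangular with respect to height, and on
a weight κ its leading scalar has constant term ∑ κ_p² + `height κ`. This is nonzero if the height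
is positive, so the operator is bijective on all weight spaces above 0. Hence Φ(M) is also the
quotient of the zero weight space by `lowered`, and the action of H_n may be computed modulo
`lowered` (`phiProj`).

Duality follows because both descriptions are available. There is a pairing of `HomV m n (RDual m
M)` with `HomV m n M` for which e_{pq} is adjoint to e_{qp} and the generators of H_n are
self-adjoint. Singular vectors on one side are exactly the functionals that vanish on lowered
elements on the other, so Φ(M^∨) is the full dual of Φ(M) (`phiPairing_injective`,
`phiPairing_surjective`).

For a module generated by a highest weight vector v of weight μ - ρ, let `el b x` be the map that
sends the word b to x and all other words to 0. Modulo `lowered`, lowering operators applied to x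
can be traded for changes of letters in b, so the maps `el b v` with b of weight μ - ρ span Φ over R
(`IsHW.wtSpace_zero_le`). They are independent over R, or over R/𝔪 for the Verma module, by a trace
argument that needs the Verma module to be free over U(𝔫⁻) (`mem_of_sum_el_mem_lowered`,
`DVerma.exists_wordCoef`). On the sorted word a the elements x_i act by the scalars that define the
standard module (`opX_el_sub_mem`), and the s_i permute the words. This gives a map from the induced
module to Φ. The induced module is spanned by elements indexed by the same words (`span_wordElt`),
and the map carries them to the independent generators, so its kernel can be read off
(`SortedChar.comparison_spec`). -/

namespace ArakawaSuzuki

/-! ### Heights of weights -/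

section Height

variable {m : ℕ}

/-- The pairing of a weight with twice the half-sum of the positive roots. -/
def height (κ : Fin m → ℤ) : ℤ := ∑ p, ∑ q, if p < q then κ p - κ q else 0

lemma height_add (κ ν : Fin m → ℤ) : height (κ + ν) = height κ + height ν := by
  unfold height
  simp only [← Finset.sum_add_distrib]
  refine Finset.sum_congr rfl fun p _ => Finset.sum_congr rfl fun q _ => ?_
  split_ifs
  · simp only [Pi.add_apply]; ring
  · simp

lemma height_zero : height (0 : Fin m → ℤ) = 0 := by simp [height]

lemma height_sub (κ ν : Fin m → ℤ) : height (κ - ν) = height κ - height ν := by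
  have := height_add (κ - ν) ν
  rw [sub_add_cancel] at this
  omega

/-- The positive root `ε_p - ε_q`. -/
abbrev root (p q : Fin m) : Fin m → ℤ := Pi.single p 1 - Pi.single q 1

lemma height_root {p q : Fin m} (h : p < q) : 0 < height (root p q) := by
  -- Letters are numbered from 0, so p is the smaller index in m - 1 - p pairs and the larger one in
  -- p pairs. The root ε_p - ε_q then has height 2(q - p).
  have h1 : ∀ p : Fin m, height (Pi.single p 1) = (m : ℤ) - 1 - 2 * p := by
    intro p
    unfold height
    have : ∀ x y : Fin m, (if x < y then (Pi.single p 1 : Fin m → ℤ) x - (Pi.single p 1 : Fin m → ℤ) y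
        else 0) = (if x = p then (if p < y then 1 else 0) else 0)
          - (if y = p then (if x < p then 1 else 0) else 0) := by
      intro x y
      simp only [Pi.single_apply]
      split_ifs <;> first | rfl | (exfalso; omega)
    simp only [this, Finset.sum_sub_distrib]
    rw [Finset.sum_eq_single p (fun x _ hx => by simp [hx]) (by simp)]
    simp only [if_true, Finset.sum_ite_eq', Finset.mem_univ]
    rw [Finset.sum_boole, Finset.sum_boole]
    have e1 : (Finset.univ.filter fun y : Fin m => p < y) = Finset.Ioi p := by ext; simp
    have e2 : (Finset.univ.filter fun y : Fin m => y < p) = Finset.Iio p := by ext; simp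
    rw [e1, e2, Fin.card_Ioi, Fin.card_Iio]
    omega
  rw [height_sub, h1, h1]
  have : (p : ℕ) < q := h
  omega

end Height

/-! ### The Casimir operator and the splitting of the zero weight space -/

section Weight

variable {m : ℕ} {N : Type*} [AddCommGroup N] [Module ℂ N] [Module (PS m) N]
  [LieRingModule (gl m) N] [IsBimodule m N]

lemma mem_wtSpace {κ : Fin m → ℤ} {v : N} : v ∈ wtSpace m N κ ↔
    ∀ i, ⁅eu i i, v⁆ = (MvPowerSeries.C (κ i : ℂ) + MvPowerSeries.X i : PS m) • v := by
  refine forall_congr' fun i => ?_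
  rw [add_smul, sub_eq_iff_eq_add', MvPowerSeries.c_eq_algebraMap, algebraMap_smul]

lemma eu_mem_wtSpace {κ ν : Fin m → ℤ} {p q : Fin m} (h : ν = κ + root p q) {v : N}
    (hv : v ∈ wtSpace m N κ) : ⁅eu p q, v⁆ ∈ wtSpace m N ν :=
  h ▸ eu_wtSpace m N p q hv

variable (m N) in
/-- The quadratic Casimir operator. -/
noncomputable def cas : N →ₗ[PS m] N := ∑ p, ∑ q, lieOp N (eu p q) ∘ₗ lieOp N (eu q p)

lemma lieOp_apply (X : gl m) (v : N) : lieOp N X v = ⁅X, v⁆ := rfl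

lemma cas_apply (v : N) : cas m N v = ∑ p, ∑ q, ⁅(eu p q : gl m), ⁅(eu q p : gl m), v⁆⁆ := by
  simp [cas, lieOp_apply]

lemma eu_bracket (i j k l : Fin m) : ⁅(eu i j : gl m), eu k l⁆ =
    (if j = k then eu i l else 0) - (if l = i then eu k j else 0) := by
  rw [LieRing.of_associative_ring_bracket, eu_mul, eu_mul]

/-- The Casimir tensor ∑ e_{pq} ⊗ e_{qp} is invariant: commuting e_{kl} past both factors produces
four Kronecker-delta sums that cancel in pairs. -/
lemma cas_lie (k l : Fin m) (v : N) : cas m N ⁅(eu k l : gl m), v⁆ = ⁅(eu k l : gl m), cas m N v⁆ := by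
  have h0 : ∀ f : Fin m → Fin m → N, ⁅(eu k l : gl m), ∑ p, ∑ q, f p q⁆ =
      ∑ p, ∑ q, ⁅(eu k l : gl m), f p q⁆ := fun f => by
    simp only [← lieOp_apply, map_sum]
  rw [← sub_eq_zero, cas_apply, cas_apply, h0]
  simp only [← Finset.sum_sub_distrib]
  have : ∀ i j, ⁅(eu i j : gl m), ⁅(eu j i : gl m), ⁅(eu k l : gl m), v⁆⁆⁆
      - ⁅(eu k l : gl m), ⁅(eu i j : gl m), ⁅(eu j i : gl m), v⁆⁆⁆ =
      ((if j = k then ⁅(eu i l : gl m), ⁅(eu j i : gl m), v⁆⁆ else 0)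
        - (if l = i then ⁅(eu k j : gl m), ⁅(eu j i : gl m), v⁆⁆ else 0))
      + ((if i = k then ⁅(eu i j : gl m), ⁅(eu j l : gl m), v⁆⁆ else 0)
        - (if l = j then ⁅(eu i j : gl m), ⁅(eu k i : gl m), v⁆⁆ else 0)) := by
    intro i j
    have e1 : ⁅(eu j i : gl m), ⁅(eu k l : gl m), v⁆⁆ =
        ⁅⁅(eu j i : gl m), (eu k l : gl m)⁆, v⁆ + ⁅(eu k l : gl m), ⁅(eu j i : gl m), v⁆⁆ :=
      leibniz_lie _ _ _
    have e2 : ⁅(eu i j : gl m), ⁅(eu k l : gl m), ⁅(eu j i : gl m), v⁆⁆⁆ =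
        ⁅⁅(eu i j : gl m), (eu k l : gl m)⁆, ⁅(eu j i : gl m), v⁆⁆ +
          ⁅(eu k l : gl m), ⁅(eu i j : gl m), ⁅(eu j i : gl m), v⁆⁆⁆ := leibniz_lie _ _ _
    have e3 : ∀ (c : Prop) [Decidable c] (X : gl m) (w : N),
        ⁅(if c then X else 0), w⁆ = if c then ⁅X, w⁆ else 0 := by
      intro c _ X w
      split_ifs
      · rfl
      · exact zero_lie w
    have e4 : ∀ (c : Prop) [Decidable c] (X : gl m) (w : N),
        ⁅X, if c then w else 0⁆ = if c then ⁅X, w⁆ else 0 := by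
      intro c _ X w
      split_ifs
      · rfl
      · exact lie_zero X
    rw [e1, lie_add, e2, eu_bracket, eu_bracket, sub_lie, sub_lie, lie_sub, e3, e3, e3, e3, e4, e4]
    abel
  simp only [this, Finset.sum_add_distrib, Finset.sum_sub_distrib]
  have h1 : ∀ (a : Fin m) (f : Fin m → Fin m → N), (∑ x, ∑ y, if a = x then f x y else 0) = ∑ y, f a y := by
    intro a f; rw [Finset.sum_comm]; simp
  have h2 : ∀ (a : Fin m) (f : Fin m → Fin m → N), (∑ x, ∑ y, if x = a then f x y else 0) = ∑ y, f a y := by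
    intro a f; rw [Finset.sum_comm]; simp
  rw [h1, h2]
  simp only [Finset.sum_ite_eq, Finset.sum_ite_eq', Finset.mem_univ, if_true]
  abel

/-- The Casimir element acts by this scalar on a singular vector of weight `0`. -/
noncomputable def casZero (m : ℕ) : PS m := ∑ p, MvPowerSeries.X p ^ 2 +
  ∑ p, ∑ q, if p < q then (MvPowerSeries.X p - MvPowerSeries.X q) else 0

variable (m N) in
/-- The Casimir operator, shifted to annihilate singular vectors of weight `0`. -/
noncomputable def casD : N →ₗ[PS m] N := cas m N - casZero m • LinearMap.id

lemma casD_lie (k l : Fin m) (v : N) : casD m N ⁅(eu k l : gl m), v⁆ = ⁅(eu k l : gl m), casD m N v⁆ := by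
  simp only [casD, LinearMap.sub_apply, LinearMap.smul_apply, LinearMap.id_apply, cas_lie, lie_sub,
    IsBimodule.lie_ps]

/-- The scalar part of the shifted Casimir operator on a weight space. -/
noncomputable def casScalar (κ : Fin m → ℤ) : PS m :=
  ∑ p, (MvPowerSeries.C (κ p : ℂ) ^ 2 + 2 * (MvPowerSeries.C (κ p : ℂ) * MvPowerSeries.X p)) +
    MvPowerSeries.C (height κ : ℂ)

/-- `2 ∑_{p < q} e_{qp} u_{pq}`. -/
noncomputable def lowerSum (u : Fin m → Fin m → N) : N :=
  ∑ p, ∑ q, if p < q then (2 : ℂ) • ⁅(eu q p : gl m), u p q⁆ else 0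

/-- For p < q the relation e_{pq} e_{qp} = e_{qp} e_{pq} + e_{pp} - e_{qq} turns the Casimir into
diagonal terms plus twice the products that raise first. Subtracting `casZero` removes the terms in
the variables z alone, so the scalar left over vanishes at κ = 0. -/
lemma casD_apply {κ : Fin m → ℤ} {v : N} (hv : v ∈ wtSpace m N κ) :
    casD m N v = casScalar κ • v + lowerSum fun p q => ⁅(eu p q : gl m), v⁆ := by
  have hd := mem_wtSpace.1 hv
  have key : ∀ p q : Fin m, ⁅(eu p q : gl m), ⁅(eu q p : gl m), v⁆⁆ =
      (if p = q then (MvPowerSeries.C (κ p : ℂ) + MvPowerSeries.X p : PS m) ^ 2 • v else 0) +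
      ((if p < q then ((MvPowerSeries.C (κ p : ℂ) + MvPowerSeries.X p : PS m) -
        (MvPowerSeries.C (κ q : ℂ) + MvPowerSeries.X q : PS m)) • v else 0) +
      ((if p < q then ⁅(eu q p : gl m), ⁅(eu p q : gl m), v⁆⁆ else 0) +
       (if q < p then ⁅(eu p q : gl m), ⁅(eu q p : gl m), v⁆⁆ else 0))) := by
    intro p q
    rcases lt_trichotomy p q with h | rfl | h
    · rw [if_neg h.ne, if_pos h, if_pos h, if_neg h.not_gt]
      rw [leibniz_lie (eu p q) (eu q p) v, eu_bracket, if_pos rfl, if_pos rfl, sub_lie, hd, hd, sub_smul]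
      abel
    · simp only [lt_irrefl, if_true, if_false, add_zero]
      rw [hd, IsBimodule.lie_ps, hd, smul_smul, sq]
    · rw [if_neg h.ne', if_neg h.not_gt, if_neg h.not_gt, if_pos h]
      abel
  have hsum : cas m N v = (∑ p, (MvPowerSeries.C (κ p : ℂ) + MvPowerSeries.X p : PS m) ^ 2) • v +
      ((∑ p, ∑ q, if p < q then ((MvPowerSeries.C (κ p : ℂ) + MvPowerSeries.X p : PS m) -
        (MvPowerSeries.C (κ q : ℂ) + MvPowerSeries.X q : PS m)) else 0) • v +
      lowerSum fun p q => ⁅(eu p q : gl m), v⁆) := by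
    rw [cas_apply]
    rw [Finset.sum_congr rfl fun p _ => Finset.sum_congr rfl fun q _ => key p q]
    simp only [Finset.sum_add_distrib]
    congr 1
    · rw [Finset.sum_smul]
      refine Finset.sum_congr rfl fun p _ => ?_
      rw [Finset.sum_ite_eq, if_pos (Finset.mem_univ _)]
    congr 1
    · simp only [Finset.sum_smul, ite_smul, zero_smul]
    · rw [Finset.sum_comm (f := fun p q => if q < p then _ else (0 : N))]
      unfold lowerSum
      simp only [← Finset.sum_add_distrib]
      refine Finset.sum_congr rfl fun p _ => Finset.sum_congr rfl fun q _ => ?_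
      split_ifs
      · rw [two_smul]
      · simp
  unfold casD
  rw [LinearMap.sub_apply, hsum, ← add_assoc, ← add_smul, LinearMap.smul_apply, LinearMap.id_apply,
    add_sub_right_comm, ← sub_smul]
  congr 2
  unfold casZero casScalar height
  push_cast
  simp only [map_sum]
  have h3 : ∀ p q : Fin m, (MvPowerSeries.C (if p < q then ((κ p : ℂ) - κ q) else 0) : PS m) =
      (if p < q then ((MvPowerSeries.C (κ p : ℂ) + MvPowerSeries.X p : PS m) -
        (MvPowerSeries.C (κ q : ℂ) + MvPowerSeries.X q : PS m)) else 0)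
        - (if p < q then (MvPowerSeries.X p - MvPowerSeries.X q) else 0) := by
    intro p q
    split_ifs
    · rw [map_sub]; ring
    · simp
  simp only [h3, Finset.sum_sub_distrib]
  have h4 : ∀ p : Fin m, (MvPowerSeries.C (κ p : ℂ) + MvPowerSeries.X p : PS m) ^ 2 =
      (MvPowerSeries.C (κ p : ℂ) ^ 2 + 2 * (MvPowerSeries.C (κ p : ℂ) * MvPowerSeries.X p)) +
        MvPowerSeries.X p ^ 2 := fun p => by ring
  simp only [h4, Finset.sum_add_distrib]
  ring

lemma casScalar_zero : casScalar (0 : Fin m → ℤ) = 0 := by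
  simp [casScalar, height_zero]

/-- The constant term is the positive integer ∑ κ_p² + `height κ`. This is the only place where
positivity of the height enters, and it expresses the dominance of the weight 0. -/
lemma isUnit_casScalar {κ : Fin m → ℤ} (h : 0 < height κ) : IsUnit (casScalar κ) := by
  rw [MvPowerSeries.isUnit_iff_constantCoeff]
  unfold casScalar
  simp only [map_add, map_sum, map_pow, map_mul, MvPowerSeries.constantCoeff_C,
    MvPowerSeries.constantCoeff_X, mul_zero, add_zero]
  rw [isUnit_iff_ne_zero]
  have : (0 : ℤ) < ∑ p, κ p ^ 2 + height κ := by
    have := Finset.sum_nonneg fun p (_ : p ∈ Finset.univ) => sq_nonneg (κ p)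
    omega
  exact_mod_cast this.ne'

lemma lowerSum_congr {u u' : Fin m → Fin m → N} (h : ∀ p q, p < q → u p q = u' p q) :
    lowerSum u = lowerSum u' := by
  unfold lowerSum
  refine Finset.sum_congr rfl fun p _ => Finset.sum_congr rfl fun q _ => ?_
  split_ifs with hpq
  · rw [h p q hpq]
  · rfl

lemma casD_lowerSum (u : Fin m → Fin m → N) :
    casD m N (lowerSum u) = lowerSum fun p q => casD m N (u p q) := by
  unfold lowerSum
  simp only [map_sum]
  refine Finset.sum_congr rfl fun p _ => Finset.sum_congr rfl fun q _ => ?_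
  split_ifs with hpq
  · rw [← casD_lie, ← algebraMap_smul (PS m), map_smul, algebraMap_smul]
  · rw [map_zero]

lemma lowerSum_mem {κ : Fin m → ℤ} {u : Fin m → Fin m → N}
    (h : ∀ p q, p < q → u p q ∈ wtSpace m N (κ + root p q)) : lowerSum u ∈ wtSpace m N κ := by
  unfold lowerSum
  refine Submodule.sum_mem _ fun p _ => Submodule.sum_mem _ fun q _ => ?_
  split_ifs with hpq
  · rw [← algebraMap_smul (PS m)]
    exact Submodule.smul_mem _ _ (eu_mem_wtSpace (by unfold root; abel) (h p q hpq))
  · exact Submodule.zero_mem _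

variable (m N) in
/-- The heights of the weights of `N` are bounded above. -/
def HeightBdd : Prop := ∃ H : ℤ, ∀ κ : Fin m → ℤ, H < height κ → wtSpace m N κ = ⊥

/-- Downward induction on the height: raising operators lead to weights where the claim is known, or
finally to zero spaces. There the operator is a unit plus terms that factor through higher weights,
so it can be inverted like a triangular matrix. -/
lemma casD_bijective (hN : HeightBdd m N) {κ : Fin m → ℤ} (hκ : 0 < height κ) :
    (∀ v ∈ wtSpace m N κ, casD m N v = 0 → v = 0) ∧
    ∀ v ∈ wtSpace m N κ, ∃ u ∈ wtSpace m N κ, casD m N u = v := by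
  obtain ⟨H, hH⟩ := hN
  -- The number k bounds the distance from the height of κ to the bound H; a positive root increases
  -- the height, so it decreases.
  obtain ⟨k, hk⟩ : ∃ k : ℕ, H - height κ < k := ⟨(H - height κ + 1).toNat, by omega⟩
  induction k generalizing κ with
  | zero =>
    rw [hH κ (by push_cast at hk; omega)]
    refine ⟨fun v hv _ => (Submodule.mem_bot _).1 hv, fun v hv => ⟨0, Submodule.zero_mem _, ?_⟩⟩
    rw [(Submodule.mem_bot _).1 hv, map_zero]
  | succ k ih =>
    have ih' : ∀ p q : Fin m, p < q → _ := fun p q hpq =>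
      ih (κ := κ + root p q) (by rw [height_add]; have := height_root hpq; omega)
        (by rw [height_add]; have := height_root hpq; push_cast at hk ⊢; omega)
    obtain ⟨c, hc⟩ := isUnit_casScalar hκ
    constructor
    · intro v hv h0
      have h1 : ∀ p q, p < q → ⁅(eu p q : gl m), v⁆ = 0 := fun p q hpq =>
        (ih' p q hpq).1 _ (eu_mem_wtSpace rfl hv) (by rw [casD_lie, h0, lie_zero])
      have h2 := casD_apply hv
      rw [h0, lowerSum_congr (u' := fun _ _ => 0) h1, ← hc] at h2
      have h3 : lowerSum (fun (_ _ : Fin m) => (0 : N)) = 0 := by simp [lowerSum]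
      rw [h3, add_zero] at h2
      have := congrArg (fun x => (↑c⁻¹ : PS m) • x) h2
      simpa [smul_smul] using this.symm
    · intro v hv
      have h1 : ∀ p q : Fin m, ∃ u : N, p < q →
          u ∈ wtSpace m N (κ + root p q) ∧ casD m N u = ⁅(eu p q : gl m), v⁆ := by
        intro p q
        by_cases hpq : p < q
        · obtain ⟨u, hu, hu'⟩ := (ih' p q hpq).2 _ (eu_mem_wtSpace rfl hv)
          exact ⟨u, fun _ => ⟨hu, hu'⟩⟩
        · exact ⟨0, fun h => absurd h hpq⟩
      choose u hu using h1
      -- With u_{pq} a preimage of e_{pq} v, applying the operator to `v - lowerSum u` cancels the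
      -- lowering terms and leaves c v.
      refine ⟨(↑c⁻¹ : PS m) • (v - lowerSum u), Submodule.smul_mem _ _ (Submodule.sub_mem _ hv
        (lowerSum_mem fun p q h => (hu p q h).1)), ?_⟩
      rw [map_smul, map_sub, casD_lowerSum, lowerSum_congr fun p q h => (hu p q h).2, casD_apply hv,
        add_sub_cancel_right, ← hc, smul_smul, Units.inv_mul, one_smul]

variable (m N) in
/-- The singular vectors of weight `0`. -/
noncomputable def sing : Submodule (PS m) N :=
  wtSpace m N 0 ⊓ ⨅ p : Fin m, ⨅ q : Fin m, ⨅ _ : p < q, LinearMap.ker (lieOp N (eu p q))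

lemma mem_sing {v : N} : v ∈ sing m N ↔
    v ∈ wtSpace m N 0 ∧ ∀ p q, p < q → ⁅(eu p q : gl m), v⁆ = 0 := by
  simp [sing, Submodule.mem_iInf, lieOp_apply]

variable (m N) in
/-- The sum of the images of the negative root vectors in the weight space of weight `0`. -/
noncomputable def lowered : Submodule (PS m) N :=
  ⨆ p : Fin m, ⨆ q : Fin m, ⨆ _ : p < q, (wtSpace m N (root p q)).map (lieOp N (eu q p))

lemma lie_mem_lowered {p q : Fin m} (h : p < q) {v : N} (hv : v ∈ wtSpace m N (root p q)) :
    ⁅(eu q p : gl m), v⁆ ∈ lowered m N :=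
  Submodule.mem_iSup_of_mem p (Submodule.mem_iSup_of_mem q (Submodule.mem_iSup_of_mem h ⟨v, hv, rfl⟩))

lemma lowered_le_iff {S : Submodule (PS m) N} : lowered m N ≤ S ↔
    ∀ p q : Fin m, p < q → ∀ v ∈ wtSpace m N (root p q), ⁅(eu q p : gl m), v⁆ ∈ S := by
  simp only [lowered, iSup_le_iff, Submodule.map_le_iff_le_comap]
  rfl

lemma lowered_le : lowered m N ≤ wtSpace m N 0 :=
  lowered_le_iff.2 fun _ _ _ _ hv => eu_mem_wtSpace (by simp [root]) hv

lemma lowerSum_mem_lowered {u : Fin m → Fin m → N}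
    (h : ∀ p q, p < q → u p q ∈ wtSpace m N (root p q)) : lowerSum u ∈ lowered m N := by
  unfold lowerSum
  refine Submodule.sum_mem _ fun p _ => Submodule.sum_mem _ fun q _ => ?_
  split_ifs with hpq
  · rw [← algebraMap_smul (PS m)]
    exact Submodule.smul_mem _ _ (lie_mem_lowered hpq (h p q hpq))
  · exact Submodule.zero_mem _

/-- A normal form with one vector for each positive root, shaped like the lowering part of the
Casimir operator so that the two can be compared directly. -/
lemma exists_of_mem_lowered {x : N} (hx : x ∈ lowered m N) : ∃ u : Fin m → Fin m → N,
    (∀ p q, p < q → u p q ∈ wtSpace m N (root p q)) ∧ x = lowerSum u := by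
  let S : Submodule (PS m) N :=
    { carrier := {x | ∃ u : Fin m → Fin m → N,
        (∀ p q, p < q → u p q ∈ wtSpace m N (root p q)) ∧ x = lowerSum u}
      zero_mem' := ⟨0, fun _ _ _ => Submodule.zero_mem _, by simp [lowerSum]⟩
      add_mem' := by
        rintro _ _ ⟨u, hu, rfl⟩ ⟨u', hu', rfl⟩
        refine ⟨u + u', fun p q h => Submodule.add_mem _ (hu p q h) (hu' p q h), ?_⟩
        simp only [lowerSum, ← Finset.sum_add_distrib]
        refine Finset.sum_congr rfl fun p _ => Finset.sum_congr rfl fun q _ => ?_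
        split_ifs <;> simp
      smul_mem' := by
        rintro r _ ⟨u, hu, rfl⟩
        refine ⟨r • u, fun p q h => Submodule.smul_mem _ r (hu p q h), ?_⟩
        simp only [lowerSum, Finset.smul_sum]
        refine Finset.sum_congr rfl fun p _ => Finset.sum_congr rfl fun q _ => ?_
        split_ifs
        · simp only [Pi.smul_apply, IsBimodule.lie_ps, smul_comm r]
        · simp }
  refine (lowered_le_iff (S := S)).2 (fun p q hpq v hv => ?_) hx
  -- The factor 1/2 compensates the factor 2 in `lowerSum`.
  refine ⟨fun p' q' => if p' = p ∧ q' = q then (2⁻¹ : ℂ) • v else 0, fun p' q' _ => ?_, ?_⟩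
  · dsimp only
    by_cases h : p' = p ∧ q' = q
    · rw [if_pos h, h.1, h.2, ← algebraMap_smul (PS m)]
      exact Submodule.smul_mem _ _ hv
    · rw [if_neg h]; exact Submodule.zero_mem _
  · unfold lowerSum
    rw [Finset.sum_eq_single p, Finset.sum_eq_single q]
    · simp [hpq]
    · intro q' _ hq'; simp [hq']
    · simp
    · intro p' _ hp'; simp [hp']
    · simp

/-- Write x as a lowering sum of vectors u_{pq} and replace each by its preimage under the Casimir
operator D; this gives x = D y. Since e_{pq} x = 0, bijectivity above 0 forces e_{pq} y = 0. A
vector y of weight 0 killed by all raising operators is killed by D, hence x = 0. -/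
lemma sing_inf_lowered (hN : HeightBdd m N) : sing m N ⊓ lowered m N = ⊥ := by
  refine (Submodule.eq_bot_iff _).2 ?_
  rintro x ⟨hs, hl⟩
  obtain ⟨u, hu, rfl⟩ := exists_of_mem_lowered hl
  have h1 : ∀ p q : Fin m, ∃ u' : N, p < q →
      u' ∈ wtSpace m N (root p q) ∧ casD m N u' = u p q := by
    intro p q
    by_cases hpq : p < q
    · obtain ⟨u, hu, hu'⟩ := (casD_bijective hN (height_root hpq)).2 _ (hu p q hpq)
      exact ⟨u, fun _ => ⟨hu, hu'⟩⟩
    · exact ⟨0, fun h => absurd h hpq⟩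
  choose u' hu' using h1
  have hy := lowered_le (lowerSum_mem_lowered fun p q h => (hu' p q h).1)
  have hx : lowerSum u = casD m N (lowerSum u') := by
    rw [casD_lowerSum, lowerSum_congr fun p q h => (hu' p q h).2]
  have h0 : ∀ p q : Fin m, p < q → ⁅(eu p q : gl m), lowerSum u'⁆ = 0 := fun p q hpq =>
    (casD_bijective hN (height_root hpq)).1 _ (eu_mem_wtSpace (by simp [root]) hy)
      (by rw [casD_lie, ← hx, (mem_sing.1 hs).2 p q hpq])
  rw [hx, casD_apply hy, casScalar_zero, zero_smul, zero_add, lowerSum_congr (u' := fun _ _ => 0) h0]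
  simp [lowerSum]

/-- Choose u_{pq} with D u_{pq} = e_{pq} v. Then D kills v minus the lowering sum of the u_{pq},
hence also its images under raising operators, which lie in weights where D is injective. So the
difference is singular. -/
lemma sing_sup_lowered (hN : HeightBdd m N) : sing m N ⊔ lowered m N = wtSpace m N 0 := by
  refine le_antisymm (sup_le inf_le_left lowered_le) fun v hv => ?_
  have h1 : ∀ p q : Fin m, ∃ u' : N, p < q →
      u' ∈ wtSpace m N (root p q) ∧ casD m N u' = ⁅(eu p q : gl m), v⁆ := by
    intro p q
    by_cases hpq : p < q
    · obtain ⟨u, hu, hu'⟩ := (casD_bijective hN (height_root hpq)).2 _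
        (eu_mem_wtSpace (κ := 0) (zero_add _).symm hv)
      exact ⟨u, fun _ => ⟨hu, hu'⟩⟩
    · exact ⟨0, fun h => absurd h hpq⟩
  choose u hu using h1
  have hl := lowerSum_mem_lowered fun p q h => (hu p q h).1
  refine Submodule.mem_sup.2 ⟨v - lowerSum u, mem_sing.2 ⟨Submodule.sub_mem _ hv (lowered_le hl),
    fun p q hpq => ?_⟩, _, hl, sub_add_cancel _ _⟩
  refine (casD_bijective hN (height_root hpq)).1 _ (eu_mem_wtSpace (κ := 0) (zero_add _).symm
    (Submodule.sub_mem _ hv (lowered_le hl))) ?_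
  rw [casD_lie, map_sub, casD_lowerSum, lowerSum_congr fun p q h => (hu p q h).2, casD_apply hv,
    casScalar_zero, zero_smul, zero_add, sub_self, lie_zero]

end Weight

end ArakawaSuzuki

namespace ArakawaSuzuki

/-! ### Independence of the generalized weight spaces -/

section Independence

variable {m : ℕ} {N : Type*} [AddCommGroup N] [Module ℂ N] [Module (PS m) N]
  [LieRingModule (gl m) N] [IsBimodule m N]

/-- The operator `v ↦ e_{ii} v - v z_i`. -/
noncomputable def diagOp (N : Type*) [AddCommGroup N] [Module ℂ N] [Module (PS m) N]
    [LieRingModule (gl m) N] [IsBimodule m N] (i : Fin m) : Module.End ℂ N :=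
  LieModule.toEnd ℂ (gl m) N (eu i i) - Module.toModuleEnd ℂ (S := PS m) N (MvPowerSeries.X i)

lemma diagOp_apply (i : Fin m) (v : N) :
    diagOp N i v = ⁅(eu i i : gl m), v⁆ - (MvPowerSeries.X i : PS m) • v := rfl

lemma diagOp_comm (i j : Fin m) : Commute (diagOp N i) (diagOp N j) := by
  refine LinearMap.ext fun v => ?_
  simp only [Module.End.mul_apply, diagOp_apply, lie_sub, smul_sub, IsBimodule.lie_ps]
  have h : ⁅(eu i i : gl m), ⁅(eu j j : gl m), v⁆⁆ = ⁅(eu j j : gl m), ⁅(eu i i : gl m), v⁆⁆ := by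
    rw [leibniz_lie, eu_bracket]
    by_cases hij : i = j
    · subst hij; rw [sub_self, zero_lie, zero_add]
    · rw [if_neg hij, if_neg (Ne.symm hij), sub_zero, zero_lie, zero_add]
  rw [h, smul_comm (MvPowerSeries.X i : PS m) (MvPowerSeries.X j : PS m)]
  abel

/-- The weight spaces are simultaneous eigenspaces of the commuting operators e_{ii} - z_i. These
operators are viewed over ℂ to apply linear algebra, and the result is carried back through the
embedding of lattices of submodules. -/
lemma wtSpace_iSupIndep : iSupIndep fun κ : Fin m → ℤ => wtSpace m N κ := by
  have h := Module.End.independent_iInf_maxGenEigenspace_of_forall_mapsTo (fun i : Fin m => diagOp N i)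
    (fun i j φ => Module.End.mapsTo_maxGenEigenspace_of_comm (diagOp_comm (m := m) j i) φ)
  have h2 : iSupIndep fun κ : Fin m → ℤ =>
      (⨅ i, (diagOp N i).maxGenEigenspace (κ i : ℂ) : Submodule ℂ N) :=
    h.comp (f := fun κ : Fin m → ℤ => fun i => (κ i : ℂ)) (fun κ ν hκ => funext fun i => by
      exact Int.cast_injective (congrFun hκ i))
  have h3 : iSupIndep fun κ : Fin m → ℤ => (wtSpace m N κ).restrictScalars ℂ := by
    refine h2.mono fun κ v hv => ?_
    refine (Submodule.mem_iInf _).2 fun i => ?_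
    refine (Module.End.mem_maxGenEigenspace _ _ _).2 ⟨1, ?_⟩
    have := hv i
    rw [pow_one, LinearMap.sub_apply, diagOp_apply, ← this]
    simp
  intro κ
  rw [Submodule.disjoint_def]
  intro x hx hx'
  refine Submodule.disjoint_def.1 (h3 κ) x hx ?_
  have h4 : x ∈ (⨆ ν, ⨆ _ : ν ≠ κ, wtSpace m N ν).restrictScalars ℂ := hx'
  have h5 := map_iSup (Submodule.restrictScalarsLatticeHom ℂ (PS m) N)
    (fun ν => ⨆ _ : ν ≠ κ, wtSpace m N ν)
  have h6 := fun ν => map_iSup (Submodule.restrictScalarsLatticeHom ℂ (PS m) N)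
    (fun _ : ν ≠ κ => wtSpace m N ν)
  simp only [h6] at h5
  exact h5.le h4

/-- Independence leaves no room: subspaces of the weight spaces that together span the module must
be the full weight spaces. -/
lemma wtSpace_eq_of_le {T : (Fin m → ℤ) → Submodule (PS m) N} (h : ∀ κ, T κ ≤ wtSpace m N κ)
    (ht : ⨆ κ, T κ = ⊤) (κ : Fin m → ℤ) : T κ = wtSpace m N κ := by
  refine le_antisymm (h κ) fun x hx => ?_
  have hx' : x ∈ T κ ⊔ ⨆ ν, ⨆ _ : ν ≠ κ, wtSpace m N ν := by
    have : (⊤ : Submodule (PS m) N) ≤ T κ ⊔ ⨆ ν, ⨆ _ : ν ≠ κ, wtSpace m N ν := by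
      rw [← ht]
      refine iSup_le fun ν => ?_
      by_cases hν : ν = κ
      · rw [hν]; exact le_sup_left
      · exact (h ν).trans (le_trans (le_iSup₂ (f := fun ν (_ : ν ≠ κ) => wtSpace m N ν) ν hν)
          le_sup_right)
    exact this Submodule.mem_top
  obtain ⟨t, ht', u, hu, rfl⟩ := Submodule.mem_sup.1 hx'
  have hu' : u ∈ wtSpace m N κ := by
    have := Submodule.sub_mem _ hx (h κ ht')
    rwa [add_sub_cancel_left] at this
  rw [Submodule.disjoint_def.1 (wtSpace_iSupIndep κ) u hu' hu, add_zero]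
  exact ht'

end Independence

/-! ### Bounded heights and highest weight modules -/

section Stable

variable {m : ℕ} {N : Type*} [AddCommGroup N] [Module ℂ N] [Module (PS m) N]
  [LieRingModule (gl m) N] [IsBimodule m N]

lemma lie_mem_of_eu {W : Submodule (PS m) N} {v : N}
    (h : ∀ p q, ⁅(eu p q : gl m), v⁆ ∈ W) (X : gl m) : ⁅X, v⁆ ∈ W := by
  rw [eu_sum m X]
  simp only [sum_lie, smul_lie]
  refine Submodule.sum_mem _ fun p _ => Submodule.sum_mem _ fun q _ => ?_
  rw [← algebraMap_smul (PS m)]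
  exact Submodule.smul_mem _ _ (h p q)

variable (m N) in
/-- The sum of the weight spaces whose weight has height at most `H`. -/
noncomputable def below (H : ℤ) : Submodule (PS m) N :=
  ⨆ κ : Fin m → ℤ, ⨆ _ : height κ ≤ H, wtSpace m N κ

lemma le_below {κ : Fin m → ℤ} {H : ℤ} (h : height κ ≤ H) : wtSpace m N κ ≤ below m N H :=
  le_iSup₂_of_le κ h le_rfl

lemma below_mono {H K : ℤ} (h : H ≤ K) : below m N H ≤ below m N K :=
  iSup₂_le fun _ hκ => le_below (hκ.trans h)

lemma heightBdd_of_below {H : ℤ} (h : below m N H = ⊤) : HeightBdd m N := by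
  refine ⟨H, fun κ hκ => (Submodule.eq_bot_iff _).2 fun x hx => ?_⟩
  refine Submodule.disjoint_def.1 (wtSpace_iSupIndep κ) x hx ?_
  have h1 : below m N H ≤ ⨆ ν, ⨆ _ : ν ≠ κ, wtSpace m N ν :=
    iSup₂_le fun ν hν => le_iSup₂_of_le ν (by rintro rfl; omega) le_rfl
  exact h1 (h ▸ Submodule.mem_top)

lemma lie_below {H : ℤ} {p q : Fin m} (hpq : q ≤ p) : below m N H ≤
    (below m N H).comap (lieOp N (eu p q)) := by
  refine iSup₂_le fun κ hκ v hv => ?_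
  refine le_below (κ := κ + root p q) ?_ (eu_mem_wtSpace rfl hv)
  rw [height_add]
  rcases hpq.lt_or_eq with h | rfl
  · have h1 := height_root h
    have h2 : height (root p q) = - height (root q p) := by
      rw [height_sub, height_sub]; ring
    omega
  · have h2 : height (root q q) = 0 := by rw [height_sub]; ring
    omega

/-- A submodule together with its image under the Lie algebra. -/
noncomputable def lieSpan₁ (B : Submodule (PS m) N) : Submodule (PS m) N :=
  B ⊔ ⨆ p : Fin m, ⨆ q : Fin m, B.map (lieOp N (eu p q))

lemma lie_mem_lieSpan₁ {B : Submodule (PS m) N} (X : gl m) {v : N} (hv : v ∈ B) :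
    ⁅X, v⁆ ∈ lieSpan₁ B :=
  lie_mem_of_eu (fun p q => Submodule.mem_sup_right (Submodule.mem_iSup_of_mem p
    (Submodule.mem_iSup_of_mem q (Submodule.mem_map_of_mem (f := lieOp N (eu p q)) hv)))) X

lemma lieSpan₁_le_iff {B S : Submodule (PS m) N} :
    lieSpan₁ B ≤ S ↔ B ≤ S ∧ ∀ p q : Fin m, ∀ v ∈ B, ⁅(eu p q : gl m), v⁆ ∈ S := by
  simp only [lieSpan₁, sup_le_iff, iSup_le_iff, Submodule.map_le_iff_le_comap]
  rfl

/-- By the Leibniz rule X(Y v) = [X,Y] v + Y(X v), and both terms are images of vectors of B under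
𝔤. -/
lemma lieSpan₁_stable {B : Submodule (PS m) N} {X : gl m} (h : ∀ v ∈ B, ⁅X, v⁆ ∈ B) :
    lieSpan₁ B ≤ (lieSpan₁ B).comap (lieOp N X) := by
  refine lieSpan₁_le_iff.2 ⟨fun v hv => ?_, fun p q v hv => ?_⟩
  · exact Submodule.mem_sup_left (h v hv)
  change ⁅X, ⁅(eu p q : gl m), v⁆⁆ ∈ lieSpan₁ B
  rw [leibniz_lie]
  exact Submodule.add_mem _ (lie_mem_lieSpan₁ _ hv) (lie_mem_lieSpan₁ _ (h v hv))

/-- A set that generates `N` as a bimodule. -/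
def Generates (s : Set N) : Prop := ∀ W : Submodule (PS m) N,
  (∀ (X : gl m), ∀ v ∈ W, ⁅X, v⁆ ∈ W) → (∀ v ∈ s, v ∈ W) → W = ⊤

/-- Take the largest submodule inside `below m N H` that is stable under raising operators. Adding
its image under 𝔤 keeps both properties, because diagonal and lowering operators do not increase the
height. By maximality it is 𝔤-stable, and it contains the generators. -/
lemma below_eq_top {s : Set N} (hs : Generates (m := m) s) {H : ℤ}
    (h : ∀ v ∈ s, ∃ W : Submodule (PS m) N, v ∈ W ∧ W ≤ below m N H ∧
      ∀ p q : Fin m, p < q → ∀ w ∈ W, ⁅(eu p q : gl m), w⁆ ∈ W) : below m N H = ⊤ := by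
  let 𝒮 : Set (Submodule (PS m) N) := {W | W ≤ below m N H ∧
      ∀ p q : Fin m, p < q → ∀ w ∈ W, ⁅(eu p q : gl m), w⁆ ∈ W}
  have hB : sSup 𝒮 ∈ 𝒮 := by
    refine ⟨sSup_le fun W hW => hW.1, fun p q hpq => ?_⟩
    have : sSup 𝒮 ≤ (sSup 𝒮).comap (lieOp N (eu p q)) :=
      sSup_le fun W hW w hw => le_sSup hW (hW.2 p q hpq w hw)
    exact fun w hw => this hw
  have hB' : lieSpan₁ (sSup 𝒮) ∈ 𝒮 := by
    refine ⟨lieSpan₁_le_iff.2 ⟨hB.1, fun p q v hv => ?_⟩, fun p q hpq w hw =>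
      lieSpan₁_stable (hB.2 p q hpq) hw⟩
    rcases lt_or_ge p q with hpq | hpq
    · exact hB.1 (hB.2 p q hpq v hv)
    · exact lie_below hpq (hB.1 hv)
  have : sSup 𝒮 = ⊤ := hs _ (fun X v hv => le_sSup hB' (lie_mem_lieSpan₁ X hv)) fun v hv => by
    obtain ⟨W, hvW, h1, h2⟩ := h v hv
    exact le_sSup (show W ∈ 𝒮 from ⟨h1, h2⟩) hvW
  exact top_le_iff.1 (this ▸ hB.1)

lemma upper_mem {W : Submodule ℂ N} (h : ∀ p q : Fin m, p < q → ∀ w ∈ W, ⁅(eu p q : gl m), w⁆ ∈ W)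
    {X : gl m} (hX : ∀ i j, j ≤ i → X i j = 0) {w : N} (hw : w ∈ W) : ⁅X, w⁆ ∈ W := by
  rw [eu_sum m X]
  simp only [sum_lie, smul_lie]
  refine Submodule.sum_mem _ fun p _ => Submodule.sum_mem _ fun q _ => ?_
  rcases lt_or_ge p q with hpq | hpq
  · exact Submodule.smul_mem _ _ (h p q hpq w hw)
  · rw [hX p q hpq, zero_smul]; exact Submodule.zero_mem _

lemma eu_strict {p q : Fin m} (hpq : p < q) (i j : Fin m) (h : j ≤ i) : (eu p q : gl m) i j = 0 := by
  unfold eu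
  refine Matrix.single_apply_of_ne _ _ _ _ _ ?_
  rintro ⟨rfl, rfl⟩
  exact absurd hpq h.not_gt

/-- Each generator lies in a finite-dimensional subspace stable under raising operators. Such a
subspace has bounded height, and it is an R-submodule because R acts through ℂ. Finitely many
generators then give a common bound. -/
lemma IsBGG.heightBdd (hN : IsBGG m N) : HeightBdd m N := by
  obtain ⟨s, hs⟩ := hN.fg
  have htop : ⨆ κ : Fin m → ℤ, wtSpace m N κ = ⊤ := hN.weights.submodule_iSup_eq_top
  have h1 : ∀ x : N, ∃ H, x ∈ below m N H := by
    intro x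
    have hx : x ∈ ⨆ κ : Fin m → ℤ, wtSpace m N κ := htop ▸ Submodule.mem_top
    induction hx using Submodule.iSup_induction' with
    | mem κ x hx => exact ⟨height κ, le_below le_rfl hx⟩
    | zero => exact ⟨0, Submodule.zero_mem _⟩
    | add x y _ _ hx hy =>
      obtain ⟨H, hx⟩ := hx
      obtain ⟨K, hy⟩ := hy
      exact ⟨max H K, Submodule.add_mem _ (below_mono (le_max_left _ _) hx)
        (below_mono (le_max_right _ _) hy)⟩
  have h2 : ∀ t : Finset N, ∃ H, ∀ x ∈ t, x ∈ below m N H := by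
    intro t
    choose H hH using h1
    obtain ⟨M, hM⟩ := Finset.exists_le (t.image H)
    exact ⟨M, fun x hx => below_mono (hM _ (Finset.mem_image_of_mem _ hx)) (hH x)⟩
  have h3 : ∀ v : N, ∃ H : ℤ, ∃ W : Submodule (PS m) N, v ∈ W ∧ W ≤ below m N H ∧
      ∀ p q : Fin m, p < q → ∀ w ∈ W, ⁅(eu p q : gl m), w⁆ ∈ W := by
    intro v
    obtain ⟨W, hv, hfd, hW⟩ := hN.locFin v
    obtain ⟨t, ht⟩ := (Submodule.fg_iff_finiteDimensional W).2 hfd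
    obtain ⟨H, hH⟩ := h2 t
    have hle : W ≤ (below m N H).restrictScalars ℂ := by
      rw [← ht]
      exact Submodule.span_le.2 hH
    refine ⟨H, { W with smul_mem' := fun r w hw => ?_ }, hv, fun w hw => hle hw,
      fun p q hpq w hw => hW _ (eu_strict hpq) w hw⟩
    rw [hN.trivial]
    exact W.smul_mem _ hw
  choose H W hW using h3
  obtain ⟨M, hM⟩ := Finset.exists_le (s.image H)
  exact heightBdd_of_below (below_eq_top (s := (s : Set N)) hs fun v hv => ⟨W v, (hW v).1, (hW v).2.1.trans
    (below_mono (hM _ (Finset.mem_image_of_mem _ hv))), (hW v).2.2⟩)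

/-- `N` is generated by the highest weight vector `v` of weight `wt`. -/
structure IsHW (m : ℕ) {N : Type*} [AddCommGroup N] [Module ℂ N] [Module (PS m) N]
    [LieRingModule (gl m) N] [IsBimodule m N] (wt : Fin m → ℤ) (v : N) : Prop where
  mem : v ∈ wtSpace m N wt
  upper : ∀ p q : Fin m, p < q → ⁅(eu p q : gl m), v⁆ = 0
  gen : Generates (m := m) ({v} : Set N)

variable {wt : Fin m → ℤ} {v : N}

lemma IsHW.heightBdd (h : IsHW m wt v) : HeightBdd m N := by
  refine heightBdd_of_below (H := height wt) (below_eq_top h.gen ?_)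
  intro w hw
  rw [Set.mem_singleton_iff.1 hw]
  refine ⟨Submodule.span _ {v}, Submodule.mem_span_singleton_self _, ?_, ?_⟩
  · rw [Submodule.span_singleton_le_iff_mem]
    exact le_below le_rfl h.mem
  · intro p q hpq w hw
    obtain ⟨r, rfl⟩ := Submodule.mem_span_singleton.1 hw
    rw [IsBimodule.lie_ps, h.upper p q hpq, smul_zero]
    exact Submodule.zero_mem _

/-- A highest weight module is generated by its highest weight vector under the lower triangular
matrices. -/
lemma IsHW.eq_top (h : IsHW m wt v) {W : Submodule (PS m) N} (hv : v ∈ W)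
    (hW : ∀ p q : Fin m, q < p → ∀ w ∈ W, ⁅(eu p q : gl m), w⁆ ∈ W) : W = ⊤ := by
  let B : Submodule (PS m) N := sInf {W | v ∈ W ∧
    ∀ p q : Fin m, q < p → ∀ w ∈ W, ⁅(eu p q : gl m), w⁆ ∈ W}
  have hvB : v ∈ B := Submodule.mem_sInf.2 fun W hW => hW.1
  have hB : ∀ p q : Fin m, q < p → ∀ w ∈ B, ⁅(eu p q : gl m), w⁆ ∈ B := fun p q hpq w hw =>
    Submodule.mem_sInf.2 fun W hW => hW.2 p q hpq w (Submodule.mem_sInf.1 hw W hW)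
  -- B is the least submodule that contains v and is stable under lowering operators, and U consists
  -- of the vectors of B that all of 𝔤 maps into B. Since U has the two defining properties of B,
  -- minimality gives B ≤ U, so B is 𝔤-stable.
  let U : Submodule (PS m) N := B ⊓ ⨅ p : Fin m, ⨅ q : Fin m, B.comap (lieOp N (eu p q))
  have hU : ∀ {w}, w ∈ U ↔ w ∈ B ∧ ∀ p q : Fin m, ⁅(eu p q : gl m), w⁆ ∈ B := by
    intro w
    simp only [U, Submodule.mem_inf, Submodule.mem_iInf, Submodule.mem_comap, lieOp_apply]
  have hBU : B ≤ U := by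
    refine sInf_le ⟨hU.2 ⟨hvB, fun p q => ?_⟩, fun p q hpq w hw => hU.2 ⟨(hU.1 hw).2 p q,
      fun k l => ?_⟩⟩
    · rcases lt_trichotomy p q with hpq | rfl | hpq
      · rw [h.upper p q hpq]; exact Submodule.zero_mem _
      · rw [mem_wtSpace.1 h.mem]; exact Submodule.smul_mem _ _ hvB
      · exact hB p q hpq v hvB
    · rw [leibniz_lie]
      exact Submodule.add_mem _ (lie_mem_of_eu (hU.1 hw).2 _) (hB p q hpq _ ((hU.1 hw).2 k l))
  have : B = ⊤ := h.gen B (fun X w hw => lie_mem_of_eu (hU.1 (hBU hw)).2 X) fun w hw => by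
    rw [Set.mem_singleton_iff.1 hw]; exact hvB
  exact top_le_iff.1 (this ▸ sInf_le ⟨hv, hW⟩)

/-- Local finiteness spreads from v: the vectors contained in a finite-dimensional submodule stable
under raising operators form a 𝔤-stable submodule, as `lieSpan₁` preserves both conditions. For v
itself the span over R is at most a line, because R acts through ℂ. -/
lemma IsHW.isBGG (h : IsHW m wt v) (ht : ∀ (r : PS m) (w : N), r • w = MvPowerSeries.constantCoeff r • w) :
    IsBGG m N where
  fg := ⟨{v}, fun W hW hv => h.gen W hW (by simpa using hv)⟩
  locFin := by
    let W : Submodule (PS m) N :=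
      { carrier := {w | ∃ W : Submodule (PS m) N, w ∈ W ∧ FiniteDimensional ℂ (W.restrictScalars ℂ) ∧
          ∀ p q : Fin m, p < q → ∀ u ∈ W, ⁅(eu p q : gl m), u⁆ ∈ W}
        zero_mem' := ⟨⊥, Submodule.zero_mem _, by
          rw [Submodule.restrictScalars_bot]; infer_instance, by
          rintro p q - u hu
          rw [(Submodule.mem_bot _).1 hu, lie_zero]; exact Submodule.zero_mem _⟩
        add_mem' := by
          rintro a b ⟨W₁, h₁, h₂, h₃⟩ ⟨W₂, h₁', h₂', h₃'⟩
          refine ⟨W₁ ⊔ W₂, Submodule.add_mem_sup h₁ h₁', ?_, fun p q hpq => ?_⟩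
          · have : (W₁ ⊔ W₂).restrictScalars ℂ = W₁.restrictScalars ℂ ⊔ W₂.restrictScalars ℂ :=
              map_sup (Submodule.restrictScalarsLatticeHom ℂ (PS m) N) W₁ W₂
            rw [this]
            infer_instance
          · have : W₁ ⊔ W₂ ≤ (W₁ ⊔ W₂).comap (lieOp N (eu p q)) :=
              sup_le (fun u hu => Submodule.mem_sup_left (h₃ p q hpq u hu))
                (fun u hu => Submodule.mem_sup_right (h₃' p q hpq u hu))
            exact fun u hu => this hu
        smul_mem' := by
          rintro r a ⟨W, h₁, h₂, h₃⟩
          exact ⟨W, W.smul_mem r h₁, h₂, h₃⟩ }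
    have hW : W = ⊤ := by
      refine h.gen W (fun X w hw => ?_) ?_
      · obtain ⟨B, h₁, h₂, h₃⟩ := hw
        refine ⟨lieSpan₁ B, lie_mem_lieSpan₁ X h₁, ?_, fun p q hpq u hu =>
          lieSpan₁_stable (h₃ p q hpq) hu⟩
        have : (lieSpan₁ B).restrictScalars ℂ = B.restrictScalars ℂ ⊔ ⨆ p : Fin m, ⨆ q : Fin m,
            (B.restrictScalars ℂ).map (LieModule.toEnd ℂ (gl m) N (eu p q)) := by
          refine (map_sup (Submodule.restrictScalarsLatticeHom ℂ (PS m) N) _ _).trans ?_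
          rw [map_iSup]
          simp only [map_iSup]
          rfl
        rw [this]
        infer_instance
      · intro w hw
        rw [Set.mem_singleton_iff.1 hw]
        refine ⟨Submodule.span _ {v}, Submodule.mem_span_singleton_self _, ?_, fun p q hpq w hw => ?_⟩
        · have : (Submodule.span (PS m) {v}).restrictScalars ℂ ≤ Submodule.span ℂ {v} := by
            intro w hw
            obtain ⟨r, rfl⟩ := Submodule.mem_span_singleton.1 hw
            rw [ht]
            exact Submodule.smul_mem _ _ (Submodule.mem_span_singleton_self _)
          exact Submodule.finiteDimensional_of_le this
        · obtain ⟨r, rfl⟩ := Submodule.mem_span_singleton.1 hw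
          rw [IsBimodule.lie_ps, h.upper p q hpq, smul_zero]
          exact Submodule.zero_mem _
    intro w
    obtain ⟨B, h₁, h₂, h₃⟩ : w ∈ W := hW ▸ Submodule.mem_top
    exact ⟨B.restrictScalars ℂ, h₁, h₂, fun X hX u hu => upper_mem (W := B.restrictScalars ℂ) h₃ hX hu⟩
  weights := by
    refine (DirectSum.isInternal_submodule_iff_iSupIndep_and_iSup_eq_top _).2
      ⟨wtSpace_iSupIndep, h.gen _ (fun X w hw => lie_mem_of_eu (fun p q => ?_) X) ?_⟩
    · have : ⨆ κ : Fin m → ℤ, wtSpace m N κ ≤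
          (⨆ κ : Fin m → ℤ, wtSpace m N κ).comap (lieOp N (eu p q)) :=
        iSup_le fun κ u hu => Submodule.mem_iSup_of_mem _ (eu_wtSpace m N p q hu)
      exact this hw
    · intro w hw
      rw [Set.mem_singleton_iff.1 hw]
      exact Submodule.mem_iSup_of_mem wt h.mem
  trivial := ht

end Stable

end ArakawaSuzuki

namespace ArakawaSuzuki

/-! ### Universal properties of induced modules and enveloping algebras -/

section IndLift

variable {A B S : Type*} [Ring A] [Algebra ℂ A] [Ring B] [Algebra ℂ B] [CommRing S] [Algebra ℂ S]
  {φ : A →ₐ[ℂ] B} {χ : A →ₐ[ℂ] S} {N : Type*} [AddCommGroup N]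

/-- The map f is only additive, while the relations generate a submodule over B ⊗ S. The submodule K
of elements all of whose multiples are killed by f contains the relations, because the balancing
condition is assumed for all b and r. -/
lemma indRel_le_ker (f : B ⊗[ℂ] S →+ N)
    (h : ∀ b a r, f ((b * φ a) ⊗ₜ r) = f (b ⊗ₜ (χ a * r))) {t : B ⊗[ℂ] S} (ht : t ∈ indRel φ χ) :
    f t = 0 := by
  let K : Submodule (B ⊗[ℂ] S) (B ⊗[ℂ] S) :=
    { carrier := {t | ∀ s : B ⊗[ℂ] S, f (s * t) = 0}
      zero_mem' := fun s => by rw [mul_zero, map_zero]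
      add_mem' := fun {a b} ha hb s => by rw [mul_add, map_add, ha, hb, add_zero]
      smul_mem' := fun c a ha s => by rw [smul_eq_mul, ← mul_assoc, ha] }
  have hK : indRel φ χ ≤ K := by
    refine Submodule.span_le.2 ?_
    rintro _ ⟨b, a, r, rfl⟩ s
    induction s using TensorProduct.induction_on with
    | zero => rw [zero_mul, map_zero]
    | add x y hx hy => rw [add_mul, map_add, hx, hy, add_zero]
    | tmul x y =>
      rw [mul_sub, Algebra.TensorProduct.tmul_mul_tmul, Algebra.TensorProduct.tmul_mul_tmul,
        map_sub, ← mul_assoc, h, mul_left_comm y, sub_self]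
  have := hK ht 1
  rwa [one_mul] at this

/-- The additive map out of an induced module given by a balanced map. -/
def Ind.lift (f : B ⊗[ℂ] S →+ N)
    (h : ∀ b a r, f ((b * φ a) ⊗ₜ r) = f (b ⊗ₜ (χ a * r))) : Ind φ χ →+ N :=
  QuotientAddGroup.lift (indRel φ χ).toAddSubgroup f fun _ ht => indRel_le_ker f h ht

lemma Ind.lift_mk (f : B ⊗[ℂ] S →+ N) (h : ∀ b a r, f ((b * φ a) ⊗ₜ r) = f (b ⊗ₜ (χ a * r)))
    (b : B) (r : S) : Ind.lift f h (Ind.mk φ χ b r) = f (b ⊗ₜ r) := rfl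

lemma Ind.induction {P : Ind φ χ → Prop} (h0 : P 0) (hadd : ∀ x y, P x → P y → P (x + y))
    (hmk : ∀ b r, P (Ind.mk φ χ b r)) (x : Ind φ χ) : P x := by
  obtain ⟨t, rfl⟩ := Submodule.Quotient.mk_surjective (indRel φ χ) x
  induction t using TensorProduct.induction_on with
  | zero => exact h0
  | add x y hx hy => exact hadd _ _ hx hy
  | tmul b r => exact hmk b r

lemma Ind.smul_mk (b' b : B) (r : S) : b' • Ind.mk φ χ b r = Ind.mk φ χ (b' * b) r := by
  rw [Ind.smul_left_def]
  refine congrArg (Submodule.Quotient.mk (p := indRel φ χ)) ?_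
  dsimp only
  rw [smul_eq_mul, Algebra.TensorProduct.tmul_mul_tmul, one_mul]

lemma Ind.smul_mk' (r' : S) (b : B) (r : S) : r' • Ind.mk φ χ b r = Ind.mk φ χ b (r' * r) := by
  rw [Ind.smul_right_def]
  refine congrArg (Submodule.Quotient.mk (p := indRel φ χ)) ?_
  dsimp only
  rw [smul_eq_mul, Algebra.TensorProduct.tmul_mul_tmul, one_mul]

lemma Ind.mk_mul (b : B) (a : A) (r : S) : Ind.mk φ χ (b * φ a) r = Ind.mk φ χ b (χ a * r) :=
  (Submodule.Quotient.eq _).2 (Submodule.subset_span ⟨b, a, r, rfl⟩)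

end IndLift

section Enveloping

variable {L : Type*} [LieRing L] [LieAlgebra ℂ L]

/-- The elements that satisfy P form a subalgebra that contains the Lie algebra. The universal
property gives a homomorphism to this subalgebra, and its composite with the inclusion is the
identity. -/
lemma uea_induction {P : UniversalEnvelopingAlgebra ℂ L → Prop}
    (halg : ∀ c : ℂ, P (algebraMap ℂ _ c)) (hι : ∀ x, P (UniversalEnvelopingAlgebra.ι ℂ x))
    (hadd : ∀ a b, P a → P b → P (a + b)) (hmul : ∀ a b, P a → P b → P (a * b))
    (u : UniversalEnvelopingAlgebra ℂ L) : P u := by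
  let S : Subalgebra ℂ (UniversalEnvelopingAlgebra ℂ L) :=
    { carrier := {u | P u}
      mul_mem' := fun {a b} => hmul a b
      add_mem' := fun {a b} => hadd a b
      algebraMap_mem' := halg }
  let f : L →ₗ⁅ℂ⁆ S :=
    { toFun := fun x => ⟨UniversalEnvelopingAlgebra.ι ℂ x, hι x⟩
      map_add' := fun x y => Subtype.ext (map_add _ x y)
      map_smul' := fun c x => Subtype.ext (map_smul _ c x)
      map_lie' := fun {x y} => Subtype.ext (LieHom.map_lie _ x y) }
  have h : S.val.comp (UniversalEnvelopingAlgebra.lift ℂ f) = AlgHom.id ℂ _ := by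
    refine UniversalEnvelopingAlgebra.hom_ext (R := ℂ) (L := L) ?_
    ext x
    simp [f]
  have h1 := AlgHom.congr_fun h u
  change ((UniversalEnvelopingAlgebra.lift ℂ f u : S) : UniversalEnvelopingAlgebra ℂ L) = u at h1
  rw [← h1]
  exact (UniversalEnvelopingAlgebra.lift ℂ f u).2

end Enveloping

/-! ### Deformed Verma modules and their universal property -/

section VermaUniversal

variable {m : ℕ} (lam : Fin m → ℤ)

/-- The highest weight vector of the deformed Verma module. -/
noncomputable def DVerma.gen : DVerma m lam := Ind.mk _ _ 1 1

lemma borel_eu {p q : Fin m} (h : p ≤ q) : eu p q ∈ borel m := by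
  intro i j hij
  unfold eu
  refine Matrix.single_apply_of_ne _ _ _ _ _ ?_
  rintro ⟨rfl, rfl⟩
  exact absurd h hij.not_ge

lemma borelChar_eu (mu : Fin m → ℤ) {p q : Fin m} (h : p ≤ q) :
    borelChar m mu ⟨eu p q, borel_eu h⟩ =
      if p = q then MvPowerSeries.C (mu p : ℂ) + MvPowerSeries.X p else 0 := by
  change (∑ i, (eu p q : gl m) i i • (MvPowerSeries.C (mu i : ℂ) + MvPowerSeries.X i : PS m)) = _
  split_ifs with hpq
  · subst hpq
    rw [Finset.sum_eq_single p]
    · simp [eu]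
    · intro i _ hi
      simp [eu, hi.symm]
    · simp
  · refine Finset.sum_eq_zero fun i _ => ?_
    rw [eu, Matrix.single_apply_of_ne, zero_smul]
    rintro ⟨rfl, rfl⟩
    exact hpq rfl

lemma borelIncl_ι (X : borel m) : borelIncl m (UniversalEnvelopingAlgebra.ι ℂ X) =
    UniversalEnvelopingAlgebra.ι ℂ (X : gl m) := by
  simp [borelIncl]

lemma DVerma.lie_gen (X : borel m) : ⁅(X : gl m), DVerma.gen lam⁆ =
    borelChar m (lam - rho m) X • DVerma.gen lam := by
  rw [DVerma.lie_def, ← borelIncl_ι]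
  refine (Ind.smul_mk _ _ _).trans ?_
  refine Eq.trans ?_ (Ind.smul_mk' _ _ _).symm
  rw [mul_one, ← one_mul (borelIncl m _)]
  refine (Ind.mk_mul _ _ _).trans ?_
  rw [UniversalEnvelopingAlgebra.lift_ι_apply]

lemma DVerma.isHW : IsHW m (lam - rho m) (DVerma.gen lam) where
  mem := mem_wtSpace.2 fun i => by
    have := DVerma.lie_gen lam ⟨eu i i, borel_eu le_rfl⟩
    rwa [borelChar_eu _ le_rfl, if_pos rfl] at this
  upper p q h := by
    have := DVerma.lie_gen lam ⟨eu p q, borel_eu h.le⟩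
    rwa [borelChar_eu _ h.le, if_neg h.ne, zero_smul] at this
  gen := by
    intro W hW hv
    refine Submodule.eq_top_iff'.2 fun x => ?_
    have key : ∀ u : UniversalEnvelopingAlgebra ℂ (gl m), ∀ w ∈ W, u • w ∈ W := by
      intro u
      induction u using uea_induction with
      | halg c =>
        intro w hw
        rw [algebraMap_smul, ← algebraMap_smul (PS m)]
        exact W.smul_mem _ hw
      | hι x => exact fun w hw => hW x w hw
      | hadd a b ha hb => exact fun w hw => by rw [add_smul]; exact W.add_mem (ha w hw) (hb w hw)
      | hmul a b ha hb => exact fun w hw => by rw [mul_smul]; exact ha _ (hb w hw)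
    induction x using Ind.induction with
    | h0 => exact W.zero_mem
    | hadd x y hx hy => exact W.add_mem hx hy
    | hmk u r =>
      have h1 : u • r • DVerma.gen lam ∈ W := key u _ (W.smul_mem r (hv _ rfl))
      have h2 : u • r • DVerma.gen lam = Ind.mk _ _ u r := by
        refine (congrArg (u • ·) (Ind.smul_mk' r _ _)).trans ((Ind.smul_mk _ _ _).trans ?_)
        rw [mul_one, mul_one]
      exact h2 ▸ h1

variable {N : Type*} [AddCommGroup N] [Module ℂ N] [Module (PS m) N]
  [LieRingModule (gl m) N] [IsBimodule m N]

/-- The action of the enveloping algebra on a bimodule. -/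
noncomputable def ueaAct (N : Type*) [AddCommGroup N] [Module ℂ N] [Module (PS m) N]
    [LieRingModule (gl m) N] [IsBimodule m N] :
    UniversalEnvelopingAlgebra ℂ (gl m) →ₐ[ℂ] Module.End ℂ N :=
  UniversalEnvelopingAlgebra.lift ℂ (LieModule.toEnd ℂ (gl m) N)

lemma ueaAct_ι (X : gl m) (v : N) : ueaAct N (UniversalEnvelopingAlgebra.ι ℂ X) v = ⁅X, v⁆ := by
  unfold ueaAct
  rw [UniversalEnvelopingAlgebra.lift_ι_apply]
  rfl

lemma ueaAct_smul (u : UniversalEnvelopingAlgebra ℂ (gl m)) (r : PS m) (v : N) :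
    ueaAct N u (r • v) = r • ueaAct N u v := by
  induction u using uea_induction generalizing v with
  | halg c => rw [AlgHom.commutes, Module.algebraMap_end_apply, Module.algebraMap_end_apply, smul_comm]
  | hι x => rw [ueaAct_ι, ueaAct_ι, IsBimodule.lie_ps]
  | hadd a b ha hb => rw [map_add, LinearMap.add_apply, LinearMap.add_apply, ha, hb, smul_add]
  | hmul a b ha hb => rw [map_mul, Module.End.mul_apply, Module.End.mul_apply, hb, ha]

lemma borelChar_act {mu : Fin m → ℤ} {φ : N} (h1 : φ ∈ wtSpace m N mu)
    (h2 : ∀ p q : Fin m, p < q → ⁅(eu p q : gl m), φ⁆ = 0) (X : borel m) :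
    ⁅(X : gl m), φ⁆ = borelChar m mu X • φ := by
  have hX : ∀ i j, j < i → (X : gl m) i j = 0 := X.2
  have : borelChar m mu X =
    ∑ i, (X : gl m) i i • (MvPowerSeries.C (mu i : ℂ) + MvPowerSeries.X i : PS m) := rfl
  rw [eu_sum m (X : gl m), this]
  simp only [sum_lie, smul_lie, Finset.sum_smul]
  refine Finset.sum_congr rfl fun p _ => ?_
  rw [Finset.sum_eq_single p]
  · rw [mem_wtSpace.1 h1, smul_assoc]
  · intro q _ hq
    rcases lt_or_gt_of_ne hq with h | h
    · rw [hX p q h, zero_smul]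
    · rw [h2 p q h, smul_zero]
  · simp

/-- The class of `u ⊗ r`. -/
noncomputable def DVerma.mk (u : UniversalEnvelopingAlgebra ℂ (gl m)) (r : PS m) : DVerma m lam :=
  Ind.mk _ _ u r

variable {lam} in
lemma DVerma.induction {P : DVerma m lam → Prop} (h0 : P 0)
    (hadd : ∀ x y, P x → P y → P (x + y)) (hmk : ∀ u r, P (DVerma.mk lam u r)) (x : DVerma m lam) :
    P x :=
  Ind.induction h0 hadd hmk x

lemma DVerma.smul_mk (r : PS m) (u : UniversalEnvelopingAlgebra ℂ (gl m)) (s : PS m) :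
    r • DVerma.mk lam u s = DVerma.mk lam u (r * s) := Ind.smul_mk' r u s

lemma DVerma.lie_mk (X : gl m) (u : UniversalEnvelopingAlgebra ℂ (gl m)) (s : PS m) :
    ⁅X, DVerma.mk lam u s⁆ = DVerma.mk lam (UniversalEnvelopingAlgebra.ι ℂ X * u) s :=
  Ind.smul_mk _ u s

variable {lam} in
/-- The additive map underlying the homomorphism given by a singular vector. -/
noncomputable def DVerma.liftAdd {φ : N} (h1 : φ ∈ wtSpace m N (lam - rho m))
    (h2 : ∀ p q : Fin m, p < q → ⁅(eu p q : gl m), φ⁆ = 0) : DVerma m lam →+ N :=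
  -- The algebra U(𝔟) acts on the singular vector through its character. This is the balancing
  -- condition needed to define a map on the induced module.
  have hχ : ∀ a, ueaAct N (borelIncl m a) φ =
      UniversalEnvelopingAlgebra.lift ℂ (borelChar m (lam - rho m)) a • φ := fun a => by
    induction a using uea_induction with
    | halg c =>
      rw [AlgHom.commutes, AlgHom.commutes, AlgHom.commutes, Module.algebraMap_end_apply,
        algebraMap_smul]
    | hι x => rw [borelIncl_ι, ueaAct_ι, UniversalEnvelopingAlgebra.lift_ι_apply, borelChar_act h1 h2]
    | hadd a b ha hb => rw [map_add, map_add, map_add, LinearMap.add_apply, ha, hb, add_smul]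
    | hmul a b ha hb =>
      rw [map_mul, map_mul, map_mul, Module.End.mul_apply, hb, ueaAct_smul, ha, smul_smul, mul_comm]
  Ind.lift (TensorProduct.lift
    (LinearMap.mk₂ ℂ (fun u r => ueaAct N u (r • φ))
      (fun u u' r => by rw [map_add, LinearMap.add_apply])
      (fun c u r => by rw [map_smul (ueaAct N), LinearMap.smul_apply])
      (fun u r r' => by rw [add_smul, map_add])
      (fun c u r => by rw [smul_assoc, LinearMap.map_smul]))).toAddMonoidHom fun u a r => by
    change ueaAct N (u * borelIncl m a) (r • φ) = ueaAct N u ((_ * r) • φ)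
    rw [map_mul, Module.End.mul_apply, ueaAct_smul, hχ, smul_smul, mul_comm]

variable {lam} in
lemma DVerma.liftAdd_mk {φ : N} (h1 : φ ∈ wtSpace m N (lam - rho m))
    (h2 : ∀ p q : Fin m, p < q → ⁅(eu p q : gl m), φ⁆ = 0) (u : UniversalEnvelopingAlgebra ℂ (gl m))
    (r : PS m) : DVerma.liftAdd h1 h2 (DVerma.mk lam u r) = r • ueaAct N u φ :=
  ueaAct_smul u r φ

variable {lam} in
/-- The homomorphism from a deformed Verma module given by a singular vector. -/
noncomputable def DVerma.lift {φ : N} (h1 : φ ∈ wtSpace m N (lam - rho m))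
    (h2 : ∀ p q : Fin m, p < q → ⁅(eu p q : gl m), φ⁆ = 0) : BHom m (DVerma m lam) N :=
  ⟨{ toFun := DVerma.liftAdd h1 h2
     map_add' := map_add _
     map_smul' := fun r x => by
      rw [RingHom.id_apply]
      induction x using DVerma.induction with
      | h0 => rw [smul_zero, map_zero, smul_zero]
      | hadd x y hx hy => rw [smul_add, map_add, hx, hy, map_add, smul_add]
      | hmk u s => rw [DVerma.smul_mk, DVerma.liftAdd_mk, DVerma.liftAdd_mk, mul_smul] },
    fun X x => by
      change DVerma.liftAdd h1 h2 _ = ⁅X, DVerma.liftAdd h1 h2 x⁆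
      induction x using DVerma.induction with
      | h0 => rw [lie_zero, map_zero, lie_zero]
      | hadd x y hx hy => rw [lie_add, map_add, hx, hy, map_add, lie_add]
      | hmk u s =>
        rw [DVerma.lie_mk, DVerma.liftAdd_mk, DVerma.liftAdd_mk, map_mul, Module.End.mul_apply,
          ueaAct_ι, ← IsBimodule.lie_ps]⟩

variable {lam} in
lemma DVerma.lift_gen {φ : N} (h1 : φ ∈ wtSpace m N (lam - rho m))
    (h2 : ∀ p q : Fin m, p < q → ⁅(eu p q : gl m), φ⁆ = 0) :
    (DVerma.lift h1 h2).1 (DVerma.gen lam) = φ := by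
  change ueaAct N 1 ((1 : PS m) • φ) = φ
  rw [one_smul, map_one, Module.End.one_apply]

end VermaUniversal

end ArakawaSuzuki

namespace ArakawaSuzuki

/-! ### Derivation rules for commutators -/

section Commutator

variable {A ι : Type*} [Semiring A] [Fintype ι] [DecidableEq ι]

lemma sum_mul_of_commute {f : ι → A} {x y : A} (k : ι) (h : ∀ l, l ≠ k → f l * x = x * f l)
    (hk : f k * x = y + x * f k) : (∑ l, f l) * x = y + x * ∑ l, f l := by
  rw [Fintype.sum_eq_add_sum_compl k, add_mul, mul_add, hk, add_assoc, Finset.sum_mul,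
    Finset.mul_sum]
  congr 2
  exact Finset.sum_congr rfl fun l hl => h l (by simpa using hl)

lemma mul_sum_mul {t : A} {a b a' b' : ι → ι → A} (ha : ∀ p q, t * a p q = a' p q + a p q * t)
    (hb : ∀ p q, t * b p q = b' p q + b p q * t) :
    t * (∑ p, ∑ q, a p q * b p q) =
      (∑ p, ∑ q, (a' p q * b p q + a p q * b' p q)) + (∑ p, ∑ q, a p q * b p q) * t := by
  simp only [Finset.mul_sum, Finset.sum_mul, ← Finset.sum_add_distrib]
  refine Finset.sum_congr rfl fun p _ => Finset.sum_congr rfl fun q _ => ?_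
  rw [← mul_assoc, ha, add_mul, mul_assoc (a p q), hb, mul_add, ← mul_assoc (a p q) (b p q), add_assoc]

end Commutator

/-! ### The basis of the tensor power indexed by words -/

section Words

variable {m n : ℕ}

variable (m n) in
/-- The standard basis of the tensor power, indexed by words. -/
noncomputable def wordBasis : Module.Basis (Fin n → Fin m) ℂ (VPow m n) :=
  Basis.piTensorProduct fun _ => Pi.basisFun ℂ (Fin m)

/-- The standard basis vector given by a word. -/
noncomputable def wordVec (b : Fin n → Fin m) : VPow m n := wordBasis m n b

lemma wordVec_eq (b : Fin n → Fin m) :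
    wordVec b = PiTensorProduct.tprod ℂ fun k => (Pi.single (b k) 1 : Fin m → ℂ) := by
  unfold wordVec wordBasis
  rw [Basis.piTensorProduct_apply]
  simp

/-- The weight of a word: the numbers of occurrences of the letters. -/
def wordWt (b : Fin n → Fin m) (i : Fin m) : ℤ := (Finset.univ.filter fun k => b k = i).card

lemma slotV_wordVec (k : Fin n) (p q : Fin m) (b : Fin n → Fin m) :
    slotV m n k (eu p q) (wordVec b) =
      if b k = q then wordVec (Function.update b k p) else 0 := by
  rw [slotV_apply, wordVec_eq, PiTensorProduct.map_tprod]
  have h1 : Matrix.toLin' (eu p q : gl m) (Pi.single (b k) 1) =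
      if b k = q then Pi.single p 1 else 0 := by
    rw [Matrix.toLin'_apply]
    ext i
    rw [Matrix.mulVec_single_one]
    unfold eu
    split_ifs with h
    · subst h
      simp [Matrix.single_apply, Pi.single_apply, eq_comm]
    · simp [Ne.symm h]
  split_ifs with h
  · rw [wordVec_eq]
    congr 1
    funext j
    rcases eq_or_ne j k with rfl | hj
    · rw [Function.update_self, h1, if_pos h, Function.update_self]
    · rw [Function.update_of_ne hj, Function.update_of_ne hj, LinearMap.id_apply]
  · refine MultilinearMap.map_coord_zero _ k ?_
    rw [Function.update_self, h1, if_neg h]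

lemma wordWt_update (b : Fin n → Fin m) (k : Fin n) (p : Fin m) :
    wordWt (Function.update b k p) = wordWt b + (Pi.single p 1 - Pi.single (b k) 1) := by
  funext i
  have h : ∀ c : Fin n → Fin m, wordWt c i = ∑ j, if c j = i then 1 else 0 := by
    intro c; simp [wordWt]
  rw [Pi.add_apply, h, h, Fintype.sum_eq_add_sum_compl k, Fintype.sum_eq_add_sum_compl k (fun j => if b j = i then (1 : ℤ) else 0)]
  have h2 : ∑ j ∈ {k}ᶜ, (if Function.update b k p j = i then (1 : ℤ) else 0) =
      ∑ j ∈ {k}ᶜ, if b j = i then (1 : ℤ) else 0 := by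
    refine Finset.sum_congr rfl fun j hj => ?_
    rw [Function.update_of_ne (by simpa using hj)]
  rw [h2, Function.update_self]
  simp only [Pi.sub_apply, Pi.single_apply, eq_comm (a := i)]
  ring

lemma tot_wordVec (i : Fin m) (b : Fin n → Fin m) :
    (∑ k, slotV m n k (eu i i)) (wordVec b) = (wordWt b i : ℂ) • wordVec b := by
  rw [LinearMap.sum_apply]
  have : ∀ k, slotV m n k (eu i i) (wordVec b) = if b k = i then wordVec b else 0 := by
    intro k
    rw [slotV_wordVec]
    split_ifs with h
    · rw [← h, Function.update_eq_self]
    · rfl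
  simp only [this]
  rw [← Finset.sum_filter, Finset.sum_const, wordWt, ← Nat.cast_smul_eq_nsmul ℂ]
  push_cast
  rfl

/-- The transpose of `slotV_wordVec`: on coordinate functionals e_{pq} acts as e_{qp} does on words.
-/
lemma coord_slotV (b : Fin n → Fin m) (k : Fin n) (p q : Fin m) (w : VPow m n) :
    (wordBasis m n).coord b (slotV m n k (eu p q) w) =
      if b k = p then (wordBasis m n).coord (Function.update b k q) w else 0 := by
  have h : (wordBasis m n).coord b ∘ₗ slotV m n k (eu p q) =
      if b k = p then (wordBasis m n).coord (Function.update b k q) else 0 := by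
    refine (wordBasis m n).ext fun c => ?_
    have key : (c k = q ∧ Function.update c k p = b) ↔ (b k = p ∧ c = Function.update b k q) := by
      constructor
      · rintro ⟨rfl, rfl⟩
        simp
      · rintro ⟨rfl, rfl⟩
        simp
    rw [LinearMap.comp_apply]
    change (wordBasis m n).coord b (slotV m n k (eu p q) (wordVec c)) = _
    rw [slotV_wordVec]
    have e : ∀ c d : Fin n → Fin m, (wordBasis m n).coord c (wordVec d) = if d = c then 1 else 0 := by
      intro c d
      unfold wordVec
      rw [Module.Basis.coord_apply, Module.Basis.repr_self, Finsupp.single_apply]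
    by_cases h : c k = q <;> by_cases h' : b k = p
    · rw [if_pos h, if_pos h', e]
      refine Eq.trans ?_ (e _ _).symm
      exact if_congr ⟨fun h1 => (key.1 ⟨h, h1⟩).2, fun h1 => (key.2 ⟨h', h1⟩).2⟩ rfl rfl
    · rw [if_pos h, if_neg h', e, if_neg fun h1 => h' (key.1 ⟨h, h1⟩).1, LinearMap.zero_apply]
    · rw [if_neg h, if_pos h', map_zero]
      exact ((e _ _).trans (if_neg fun h1 => h (key.2 ⟨h', h1⟩).1)).symm
    · rw [if_neg h, if_neg h', map_zero, LinearMap.zero_apply]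
  have h1 := LinearMap.congr_fun h w
  rw [LinearMap.comp_apply] at h1
  rw [h1]
  split_ifs <;> rfl

end Words

/-! ### The bimodule of linear maps from the tensor power, and the Hecke operators on it -/

section HomV

variable {m n : ℕ} {M : Type*} [AddCommGroup M] [Module ℂ M] [Module (PS m) M]
  [LieRingModule (gl m) M] [IsBimodule m M]

variable (m n M) in
/-- Linear maps from the tensor power to `M`. -/
abbrev HomV : Type _ := VPow m n →ₗ[ℂ] M

/-- Composition with the action of `X` on the target. -/
noncomputable def lmul (X : gl m) : HomV m n M →ₗ[PS m] HomV m n M where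
  toFun φ := LieModule.toEnd ℂ (gl m) M X ∘ₗ φ
  map_add' φ ψ := LinearMap.comp_add _ _ _
  map_smul' r φ := LinearMap.ext fun w => IsBimodule.lie_ps X r (φ w)

/-- Composition with an endomorphism of the source. -/
noncomputable def rmul (A : Module.End ℂ (VPow m n)) : HomV m n M →ₗ[PS m] HomV m n M where
  toFun φ := φ ∘ₗ A
  map_add' φ ψ := LinearMap.add_comp _ _ _
  map_smul' r φ := rfl

lemma lmul_apply (X : gl m) (φ : HomV m n M) (w : VPow m n) : lmul X φ w = ⁅X, φ w⁆ := rfl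

lemma rmul_apply (A : Module.End ℂ (VPow m n)) (φ : HomV m n M) (w : VPow m n) :
    rmul A φ w = φ (A w) := rfl

lemma homV_lie_apply (X : gl m) (φ : HomV m n M) (w : VPow m n) :
    ⁅X, φ⁆ w = ⁅X, φ w⁆ - φ ((∑ k, slotV m n k X) w) := rfl

lemma homV_lie (X : gl m) (φ : HomV m n M) :
    ⁅X, φ⁆ = lmul X φ - rmul (∑ k, slotV m n k X) φ := rfl

instance : IsBimodule m (HomV m n M) where
  scalar := inferInstance
  lieMod := inferInstance
  lie_ps X r φ := LinearMap.ext fun w => by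
    rw [homV_lie_apply, LinearMap.smul_apply, LinearMap.smul_apply, LinearMap.smul_apply,
      homV_lie_apply, IsBimodule.lie_ps, smul_sub]

lemma homV_ext {φ ψ : HomV m n M} (h : ∀ b, φ (wordVec b) = ψ (wordVec b)) : φ = ψ :=
  (wordBasis m n).ext h

/-- The elementary linear map that sends one word to `x` and all other words to `0`. -/
noncomputable def el (b : Fin n → Fin m) : M →ₗ[PS m] HomV m n M where
  toFun x := ((wordBasis m n).coord b).smulRight x
  map_add' x y := LinearMap.ext fun w => smul_add _ _ _
  map_smul' r x := LinearMap.ext fun w => smul_comm _ _ _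

lemma el_wordVec (b c : Fin n → Fin m) (x : M) : el b x (wordVec c) = if c = b then x else 0 := by
  change (wordBasis m n).coord b (wordBasis m n c) • x = _
  rw [Module.Basis.coord_apply, Module.Basis.repr_self, Finsupp.single_apply]
  split_ifs <;> simp

lemma homV_eq_sum (φ : HomV m n M) : φ = ∑ b, el b (φ (wordVec b)) := by
  refine homV_ext fun c => ?_
  rw [LinearMap.sum_apply]
  simp only [el_wordVec, Finset.sum_ite_eq, Finset.mem_univ, if_true]

lemma rmul_slotV_el (b : Fin n → Fin m) (k : Fin n) (p q : Fin m) (x : M) :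
    rmul (slotV m n k (eu p q)) (el b x) = if b k = p then el (Function.update b k q) x else 0 := by
  refine LinearMap.ext fun w => ?_
  change (wordBasis m n).coord b (slotV m n k (eu p q) w) • x = _
  rw [coord_slotV]
  split_ifs
  · rfl
  · exact zero_smul _ _

lemma lmul_el (X : gl m) (b : Fin n → Fin m) (x : M) : lmul X (el b x) = el b ⁅X, x⁆ := by
  refine homV_ext fun c => ?_
  rw [lmul_apply, el_wordVec, el_wordVec]
  split_ifs
  · rfl
  · exact lie_zero X

/-- The element e_{ii} acts on φ by acting on values and subtracting its action on arguments, and on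
a word the latter is the number of occurrences of i. So a map of weight κ shifts the weight of every
word by κ. -/
lemma homV_mem_wtSpace {κ : Fin m → ℤ} {φ : HomV m n M} :
    φ ∈ wtSpace m (HomV m n M) κ ↔ ∀ b, φ (wordVec b) ∈ wtSpace m M (κ + wordWt b) := by
  have h : ∀ (i : Fin m) (b : Fin n → Fin m),
      (⁅(eu i i : gl m), φ⁆ (wordVec b) =
        ((MvPowerSeries.C (κ i : ℂ) + MvPowerSeries.X i : PS m) • φ) (wordVec b)) ↔
      (⁅(eu i i : gl m), φ (wordVec b)⁆ = (MvPowerSeries.C (((κ + wordWt b) i : ℤ) : ℂ) +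
        MvPowerSeries.X i : PS m) • φ (wordVec b)) := by
    intro i b
    rw [homV_lie_apply, tot_wordVec, map_smul, sub_eq_iff_eq_add, LinearMap.smul_apply,
      ← algebraMap_smul (PS m) (wordWt b i : ℂ), ← add_smul, Pi.add_apply, Int.cast_add, map_add,
      MvPowerSeries.c_eq_algebraMap, add_right_comm]
  constructor
  · intro hφ b
    refine mem_wtSpace.2 fun i => (h i b).1 ?_
    rw [mem_wtSpace.1 hφ i]
  · intro hφ
    exact mem_wtSpace.2 fun i => homV_ext fun b => (h i b).2 (mem_wtSpace.1 (hφ b) i)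

lemma el_mem_wtSpace {κ : Fin m → ℤ} {b : Fin n → Fin m} {x : M}
    (hx : x ∈ wtSpace m M (κ + wordWt b)) : el b x ∈ wtSpace m (HomV m n M) κ := by
  refine homV_mem_wtSpace.2 fun c => ?_
  rw [el_wordVec]
  split_ifs with h
  · rw [h]; exact hx
  · exact Submodule.zero_mem _

lemma HeightBdd.homV (h : HeightBdd m M) : HeightBdd m (HomV m n M) := by
  obtain ⟨H, hH⟩ := h
  obtain ⟨K, hK⟩ := Finset.exists_le (Finset.univ.image fun b : Fin n → Fin m => - height (wordWt b))
  refine ⟨H + K, fun κ hκ => (Submodule.eq_bot_iff _).2 fun φ hφ => homV_ext fun b => ?_⟩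
  have h1 := homV_mem_wtSpace.1 hφ b
  have h2 := hK _ (Finset.mem_image_of_mem _ (Finset.mem_univ b))
  rw [hH _ (by rw [height_add]; omega)] at h1
  exact (Submodule.mem_bot _).1 h1

/-- The Casimir element of the factors `k` and `i`. -/
noncomputable def omV (k i : Fin n) : Module.End ℂ (VPow m n) :=
  ∑ p, ∑ q, slotV m n k (eu p q) * slotV m n i (eu q p)

/-- Stated for an arbitrary bilinear map so that one cancellation serves both for the operators on
V^{⊗n} and for those that mix M with a tensor factor. -/
lemma casimir_invariant {A : Type*} [AddCommGroup A] [Module ℂ A] (B : gl m →ₗ[ℂ] gl m →ₗ[ℂ] A)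
    (k l : Fin m) : ∑ p, ∑ q, (B ⁅(eu k l : gl m), eu p q⁆ (eu q p) + B (eu p q) ⁅(eu k l : gl m), eu q p⁆)
      = 0 := by
  have e : ∀ (c : Prop) [Decidable c] (X Y : gl m), B (if c then X else 0) Y = if c then B X Y else 0 := by
    intro c _ X Y
    split_ifs <;> simp
  have e' : ∀ (c : Prop) [Decidable c] (X Y : gl m), B X (if c then Y else 0) = if c then B X Y else 0 := by
    intro c _ X Y
    split_ifs <;> simp
  simp only [eu_bracket, map_sub, LinearMap.sub_apply, e, e', Finset.sum_add_distrib,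
    Finset.sum_sub_distrib]
  have h1 : ∀ (a : Fin m) (f : Fin m → Fin m → A), (∑ x, ∑ y, if a = x then f x y else 0) = ∑ y, f a y := by
    intro a f; rw [Finset.sum_comm]; simp
  have h2 : ∀ (a : Fin m) (f : Fin m → Fin m → A), (∑ x, ∑ y, if x = a then f x y else 0) = ∑ y, f a y := by
    intro a f; rw [Finset.sum_comm]; simp
  rw [h1, h2]
  simp only [Finset.sum_ite_eq, Finset.sum_ite_eq', Finset.mem_univ, if_true]
  abel

lemma tot_slotV (k : Fin n) (Z X : gl m) :
    (∑ l, slotV m n l Z) * slotV m n k X =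
      slotV m n k ⁅Z, X⁆ + slotV m n k X * ∑ l, slotV m n l Z := by
  refine sum_mul_of_commute k (fun l hl => slotV_comm m n hl Z X) ?_
  rw [slotV_mul, slotV_mul, ← map_add, LieRing.of_associative_ring_bracket, sub_add_cancel]

lemma tot_omV (k i : Fin n) (a b : Fin m) :
    (∑ l, slotV m n l (eu a b)) * omV k i = omV k i * ∑ l, slotV m n l (eu a b) := by
  have h := casimir_invariant (m := m) (LinearMap.mk₂ ℂ (fun X Y => slotV m n k X * slotV m n i Y)
    (fun X X' Y => by rw [map_add, add_mul]) (fun c X Y => by rw [map_smul, smul_mul_assoc])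
    (fun X Y Y' => by rw [map_add, mul_add]) (fun c X Y => by rw [map_smul, mul_smul_comm])) a b
  simp only [LinearMap.mk₂_apply] at h
  unfold omV
  rw [mul_sum_mul (fun p q => tot_slotV k (eu a b) (eu p q)) (fun p q => tot_slotV i (eu a b) (eu q p)),
    h, zero_add]

variable (M) in
/-- The action of `x_i` on linear maps from the tensor power to `M`. -/
noncomputable def opX (i : Fin n) : HomV m n M →ₗ[PS m] HomV m n M :=
  -- The first two sums are the Casimir of the factors 0 and i: equivariance turns the action of
  -- e_{pq} on M̃(ρ) into its action on the target minus its action on V^{⊗n}. The sum over k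
  -- therefore includes k = i. The last sum is the contribution of the factors of V^{⊗n} before i.
  ∑ p, ∑ q, lmul (eu p q) ∘ₗ rmul (slotV m n i (eu q p)) - ∑ k, rmul (omV k i)
    + ∑ k ∈ Finset.Iio i, rmul (omV k i)

variable (M) in
/-- The action of `s_i` on linear maps from the tensor power to `M`. -/
noncomputable def opS (i : ℕ) (h : i + 1 < n) : HomV m n M →ₗ[PS m] HomV m n M :=
  rmul (omV ⟨i, Nat.lt_of_succ_lt h⟩ ⟨i + 1, h⟩)

lemma rmul_omV_lie (k i : Fin n) (a b : Fin m) (φ : HomV m n M) :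
    rmul (omV k i) ⁅(eu a b : gl m), φ⁆ = ⁅(eu a b : gl m), rmul (omV k i) φ⁆ := by
  refine LinearMap.ext fun w => ?_
  simp only [rmul_apply, homV_lie_apply]
  rw [← Module.End.mul_apply, ← Module.End.mul_apply, tot_omV]

lemma opS_lie (i : ℕ) (h : i + 1 < n) (a b : Fin m) (φ : HomV m n M) :
    opS M i h ⁅(eu a b : gl m), φ⁆ = ⁅(eu a b : gl m), opS M i h φ⁆ := rmul_omV_lie _ _ _ _ _

/-- This holds for every φ, singular or not, and it makes the operator preserve the zero weight
space and the lowered elements. -/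
lemma opX_lie (i : Fin n) (a b : Fin m) (φ : HomV m n M) :
    opX M i ⁅(eu a b : gl m), φ⁆ = ⁅(eu a b : gl m), opX M i φ⁆ := by
  have key : (∑ p, ∑ q, lmul (eu p q) ∘ₗ rmul (slotV m n i (eu q p)) : HomV m n M →ₗ[PS m] HomV m n M)
        ⁅(eu a b : gl m), φ⁆ =
      ⁅(eu a b : gl m), (∑ p, ∑ q, lmul (eu p q) ∘ₗ rmul (slotV m n i (eu q p)) :
        HomV m n M →ₗ[PS m] HomV m n M) φ⁆ := by
    refine LinearMap.ext fun w => ?_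
    have h := casimir_invariant (m := m) (LinearMap.mk₂ ℂ (fun X Y => ⁅X, φ (slotV m n i Y w)⁆)
      (fun X X' Y => by rw [add_lie]) (fun c X Y => by rw [smul_lie])
      (fun X Y Y' => by rw [map_add, LinearMap.add_apply, map_add, lie_add])
      (fun c X Y => by rw [map_smul, LinearMap.smul_apply, map_smul, lie_smul])) a b
    simp only [LinearMap.mk₂_apply] at h
    rw [← sub_eq_zero, ← neg_eq_zero, ← h, homV_lie_apply, neg_sub]
    simp only [LinearMap.sum_apply (ι := Fin m), LinearMap.comp_apply, lmul_apply, rmul_apply]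
    have e : ∀ f : Fin m → Fin m → M, ⁅(eu a b : gl m), ∑ p, ∑ q, f p q⁆ =
        ∑ p, ∑ q, ⁅(eu a b : gl m), f p q⁆ := fun f => by
      simp only [← lieOp_apply, map_sum]
    rw [e]
    simp only [← Finset.sum_sub_distrib]
    refine Finset.sum_congr rfl fun p _ => Finset.sum_congr rfl fun q _ => ?_
    have h1 := congrArg φ (LinearMap.congr_fun (tot_slotV i (eu a b) (eu q p)) w)
    rw [LinearMap.add_apply, Module.End.mul_apply, Module.End.mul_apply, map_add,
      ← sub_eq_iff_eq_add] at h1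
    rw [homV_lie_apply, ← h1, lie_sub, lie_sub, leibniz_lie (eu a b) (eu p q)]
    abel
  unfold opX
  rw [LinearMap.add_apply, LinearMap.sub_apply, LinearMap.add_apply, LinearMap.sub_apply, lie_add,
    lie_sub, key]
  simp only [LinearMap.sum_apply (ι := Fin n), rmul_omV_lie, lie_sum]

end HomV

/-! ### The functor as a space of singular vectors -/

section Evaluation

variable {m n : ℕ} {M : Type*} [AddCommGroup M] [Module ℂ M] [Module (PS m) M]
  [LieRingModule (gl m) M] [IsBimodule m M]

/-- Restriction of a homomorphism to `V^{⊗n}`. -/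
noncomputable def ev : Phi m n M →ₗ[ℂ] HomV m n M where
  toFun F := (F.1.restrictScalars ℂ) ∘ₗ TensorProduct.mk ℂ _ _ (DVerma.gen (rho m))
  map_add' F G := rfl
  map_smul' c F := rfl

lemma ev_apply (F : Phi m n M) (w : VPow m n) : ev F w = F.1 (DVerma.gen (rho m) ⊗ₜ w) := rfl

lemma phi_lie_tmul (F : Phi m n M) (X : gl m) (v : DVerma m (rho m)) (w : VPow m n) :
    F.1 (⁅X, v⁆ ⊗ₜ w) = ⁅X, F.1 (v ⊗ₜ w)⁆ - F.1 (v ⊗ₜ (∑ k, slotV m n k X) w) := by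
  have h := F.2 X (v ⊗ₜ w)
  rw [TensorProduct.LieModule.lie_tmul_right, map_add] at h
  rw [← h]
  exact (add_sub_cancel_right _ _).symm

lemma ev_lie (F : Phi m n M) (X : gl m) (w : VPow m n) :
    ⁅X, ev F⁆ w = F.1 (⁅X, DVerma.gen (rho m)⁆ ⊗ₜ w) := by
  rw [homV_lie_apply, phi_lie_tmul]
  rfl

lemma gen_rho_isHW : IsHW m 0 (DVerma.gen (rho m)) := by
  have := DVerma.isHW (rho m)
  rwa [sub_self] at this

lemma ev_mem (F : Phi m n M) : ev F ∈ sing m (HomV m n M) := by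
  refine mem_sing.2 ⟨mem_wtSpace.2 fun i => LinearMap.ext fun w => ?_, fun p q hpq =>
    LinearMap.ext fun w => ?_⟩
  · rw [ev_lie, mem_wtSpace.1 gen_rho_isHW.mem, ← TensorProduct.smul_tmul', map_smul]
    rfl
  · rw [ev_lie, gen_rho_isHW.upper p q hpq, TensorProduct.zero_tmul, map_zero]
    rfl

/-- Equivariance determines F(Xv ⊗ w) from the values of F on v ⊗ V^{⊗n}, so the vectors v on which
two homomorphisms agree form a subbimodule; it contains the generator. -/
lemma ev_injective : Function.Injective (ev : Phi m n M →ₗ[ℂ] HomV m n M) := by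
  intro F G h
  let W : Submodule (PS m) (DVerma m (rho m)) :=
    { carrier := {v | ∀ w, F.1 (v ⊗ₜ w) = G.1 (v ⊗ₜ w)}
      zero_mem' := fun w => by rw [TensorProduct.zero_tmul, map_zero, map_zero]
      add_mem' := fun {a b} ha hb w => by
        rw [TensorProduct.add_tmul, map_add, map_add, ha, hb]
      smul_mem' := fun r a ha w => by
        rw [← TensorProduct.smul_tmul', map_smul, map_smul, ha] }
  have hW : W = ⊤ := gen_rho_isHW.gen W (fun X v hv w => by
    rw [phi_lie_tmul, phi_lie_tmul, hv, hv]) (by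
    intro v hv w
    rw [Set.mem_singleton_iff.1 hv]
    exact LinearMap.congr_fun h w)
  refine Subtype.ext (LinearMap.ext fun t => ?_)
  induction t using TensorProduct.induction_on with
  | zero => rw [map_zero, map_zero]
  | add a b ha hb => rw [map_add, map_add, ha, hb]
  | tmul v w =>
    have : v ∈ W := hW ▸ Submodule.mem_top
    exact this w

/-- A singular vector of weight 0 = ρ - ρ extends to a homomorphism from M̃(ρ) to the maps V^{⊗n} →
M, which is then uncurried. -/
lemma exists_ev_eq {φ : HomV m n M} (hφ : φ ∈ sing m (HomV m n M)) : ∃ F : Phi m n M, ev F = φ := by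
  obtain ⟨h1, h2⟩ := mem_sing.1 hφ
  have h1' : φ ∈ wtSpace m (HomV m n M) (rho m - rho m) := by rwa [sub_self]
  let G := DVerma.lift h1' h2
  let F : Tens m n (DVerma m (rho m)) →ₗ[PS m] M := TensorProduct.AlgebraTensorModule.lift G.1
  have hF : ∀ v w, F (v ⊗ₜ w) = G.1 v w := fun v w => rfl
  refine ⟨⟨F, fun X t => ?_⟩, ?_⟩
  · induction t using TensorProduct.induction_on with
    | zero => rw [lie_zero, map_zero, lie_zero]
    | add a b ha hb => rw [lie_add, map_add, ha, hb, map_add, lie_add]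
    | tmul v w =>
      rw [TensorProduct.LieModule.lie_tmul_right, map_add, hF, hF, hF, G.2, homV_lie_apply]
      exact sub_add_cancel _ _
  · refine LinearMap.ext fun w => ?_
    change G.1 (DVerma.gen (rho m)) w = φ w
    rw [DVerma.lift_gen]

lemma actHom_x (i : Fin n) (M : Type*) [AddCommGroup M] [Module ℂ M] [Module (PS m) M]
    [LieRingModule (gl m) M] [IsBimodule m M] :
    (actHom m n M (ParHecke.x n _ i)).unop.1 = OmLt (slotE m n M) i.succ := by
  unfold actHom
  rw [ParHecke.lift_x]
  rfl

lemma actHom_s (i : ℕ) (h : i + 1 < n) (M : Type*) [AddCommGroup M] [Module ℂ M] [Module (PS m) M]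
    [LieRingModule (gl m) M] [IsBimodule m M] :
    (actHom m n M (ParHecke.s n Set.univ i h (Set.mem_univ i))).unop.1 = Om (slotE m n M)
      (Fin.succ ⟨i, Nat.lt_of_succ_lt h⟩) (Fin.succ ⟨i + 1, h⟩) := by
  unfold actHom
  rw [ParHecke.lift_s]
  rfl

lemma om_succ_tmul (k i : Fin n) (v : M) (w : VPow m n) :
    Om (slotE m n M) k.succ i.succ (v ⊗ₜ w) = v ⊗ₜ omV k i w := by
  unfold Om omV slotE
  simp only [LinearMap.sum_apply, Module.End.mul_apply, slot_succ_tmul, TensorProduct.tmul_sum]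

lemma ev_s_smul (i : ℕ) (h : i + 1 < n) (F : Phi m n M) :
    ev (ParHecke.s n Set.univ i h (Set.mem_univ i) • F) = opS M i h (ev F) := by
  refine LinearMap.ext fun w => ?_
  rw [ev_apply, Phi.smul_apply, actHom_s, om_succ_tmul]
  rfl

lemma ev_x_smul (i : Fin n) (F : Phi m n M) :
    ev (ParHecke.x n Set.univ i • F) = opX M i (ev F) := by
  refine LinearMap.ext fun w => ?_
  rw [ev_apply, Phi.smul_apply, actHom_x]
  -- The factor 0 is M̃(ρ) and is separated from the factors of V^{⊗n}; for it, `phi_lie_tmul` moves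
  -- e_{pq} away from the generator.
  have h1 : (Finset.Iio i.succ : Finset (Fin (n + 1))) = insert 0 ((Finset.Iio i).map (Fin.succEmb n)) := by
    ext a
    induction a using Fin.cases with
    | zero => simp
    | succ k => simp
  unfold OmLt
  rw [h1, Finset.sum_insert (by simp), Finset.sum_map, LinearMap.add_apply, map_add]
  unfold opX
  rw [LinearMap.add_apply, LinearMap.add_apply]
  congr 1
  · unfold Om slotE
    simp only [LinearMap.sum_apply, Module.End.mul_apply, slot_succ_tmul, slot_zero_tmul, map_sum,
      phi_lie_tmul, LinearMap.sub_apply, LinearMap.comp_apply, lmul_apply, rmul_apply,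
      Finset.sum_sub_distrib, TensorProduct.tmul_sum]
    congr 1
    rw [Finset.sum_congr rfl fun p _ => Finset.sum_comm, Finset.sum_comm]
    refine Finset.sum_congr rfl fun k _ => ?_
    unfold omV
    simp only [LinearMap.sum_apply, map_sum]
    rfl
  · simp only [LinearMap.sum_apply, map_sum]
    refine Finset.sum_congr rfl fun k _ => ?_
    change F.1 (Om (slotE m n (DVerma m (rho m))) k.succ i.succ (DVerma.gen (rho m) ⊗ₜ w)) = _
    rw [om_succ_tmul]
    rfl

end Evaluation

/-! ### Linearity over the Hecke algebra from its generators -/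

section HeckeLinear

variable {n : ℕ}

lemma parHecke_induction {J : Set ℕ} {P : ParHecke n J → Prop}
    (halg : ∀ c : ℂ, P (algebraMap ℂ _ c)) (hx : ∀ i, P (ParHecke.x n J i))
    (hs : ∀ i h hJ, P (ParHecke.s n J i h hJ))
    (hadd : ∀ a b, P a → P b → P (a + b)) (hmul : ∀ a b, P a → P b → P (a * b))
    (u : ParHecke n J) : P u := by
  obtain ⟨a, rfl⟩ : ∃ a, ParHecke.mk n J a = u := RingQuot.mkAlgHom_surjective ℂ (HeckeRel n J) u
  induction a using FreeAlgebra.induction with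
  | grade0 c => rw [AlgHom.commutes]; exact halg c
  | grade1 g =>
    cases g with
    | x i => exact hx i
    | s i h hJ => exact hs i h hJ
  | mul a b ha hb => rw [map_mul]; exact hmul _ _ ha hb
  | add a b ha hb => rw [map_add]; exact hadd _ _ ha hb

/-- A linear map that commutes with the generators is a homomorphism of modules over the Hecke
algebra. -/
lemma hecke_map_smul {A B : Type*} [AddCommGroup A] [Module ℂ A] [Module (Hecke n) A]
    [IsScalarTower ℂ (Hecke n) A] [AddCommGroup B] [Module ℂ B] [Module (Hecke n) B]
    [IsScalarTower ℂ (Hecke n) B] (f : A →ₗ[ℂ] B)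
    (hx : ∀ i v, f (ParHecke.x n Set.univ i • v) = ParHecke.x n Set.univ i • f v)
    (hs : ∀ i h v, f (ParHecke.s n Set.univ i h (Set.mem_univ i) • v) = ParHecke.s n Set.univ i h (Set.mem_univ i) • f v)
    (u : Hecke n) (v : A) : f (u • v) = u • f v := by
  induction u using parHecke_induction generalizing v with
  | halg c => rw [algebraMap_smul, algebraMap_smul, map_smul]
  | hx i => exact hx i v
  | hs i h _ => exact hs i h v
  | hadd a b ha hb => rw [add_smul, map_add, ha, hb, add_smul]
  | hmul a b ha hb => rw [mul_smul, ha, hb, mul_smul]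

end HeckeLinear

end ArakawaSuzuki

namespace ArakawaSuzuki

/-! ### The contravariant pairing -/

section Pairing

variable {m n : ℕ} {M : Type*} [AddCommGroup M] [Module ℂ M] [Module (PS m) M]
  [LieRingModule (gl m) M] [IsBimodule m M]

/-- The functional underlying an element of the restricted dual. -/
noncomputable def RDual.app : RDual m M →ₗ[ℂ] Module.Dual ℂ M := (rdual m M).subtype

lemma RDual.app_injective : Function.Injective (RDual.app : RDual m M →ₗ[ℂ] Module.Dual ℂ M) :=
  Subtype.val_injective

lemma RDual.app_lie (X : gl m) (f : RDual m M) (v : M) :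
    RDual.app ⁅X, f⁆ v = RDual.app f ⁅X.transpose, v⁆ := rfl

lemma RDual.app_smul (r : PS m) (f : RDual m M) (v : M) :
    RDual.app (r • f) v = RDual.app f (r • v) := rfl

lemma eu_transpose (p q : Fin m) : (eu p q : gl m).transpose = eu q p := by
  unfold eu
  exact Matrix.transpose_single _ _ _

/-- The pairing of linear maps to the restricted dual with linear maps to `M`. -/
noncomputable def pairing : HomV m n (RDual m M) →ₗ[ℂ] HomV m n M →ₗ[ℂ] ℂ :=
  LinearMap.mk₂ ℂ (fun g φ => ∑ b, RDual.app (g (wordVec b)) (φ (wordVec b)))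
    (fun g g' φ => by simp only [LinearMap.add_apply, map_add, Finset.sum_add_distrib])
    (fun c g φ => by simp only [LinearMap.smul_apply, map_smul, Finset.smul_sum])
    (fun g φ φ' => by simp only [LinearMap.add_apply, map_add, Finset.sum_add_distrib])
    (fun c g φ => by simp only [LinearMap.smul_apply, map_smul, Finset.smul_sum])

lemma pairing_apply (g : HomV m n (RDual m M)) (φ : HomV m n M) :
    pairing g φ = ∑ b, RDual.app (g (wordVec b)) (φ (wordVec b)) := rfl

lemma pairing_el (g : HomV m n (RDual m M)) (b : Fin n → Fin m) (v : M) :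
    pairing g (el b v) = RDual.app (g (wordVec b)) v := by
  rw [pairing_apply, Finset.sum_eq_single b]
  · rw [el_wordVec, if_pos rfl]
  · intro c _ hc
    rw [el_wordVec, if_neg hc, map_zero]
  · simp

lemma pairing_lmul (p q : Fin m) (g : HomV m n (RDual m M)) (φ : HomV m n M) :
    pairing (lmul (eu p q) g) φ = pairing g (lmul (eu q p) φ) := by
  simp only [pairing_apply, lmul_apply, RDual.app_lie, eu_transpose]

/-- In the basis of words the operators e_{pq} and e_{qp} on one tensor factor are transposes of
each other. -/
lemma pairing_rmul (k : Fin n) (p q : Fin m) (g : HomV m n (RDual m M)) (φ : HomV m n M) :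
    pairing (rmul (slotV m n k (eu p q)) g) φ = pairing g (rmul (slotV m n k (eu q p)) φ) := by
  have h1 : ∀ b : Fin n → Fin m, RDual.app (rmul (slotV m n k (eu p q)) g (wordVec b)) (φ (wordVec b)) =
      ∑ c : Fin n → Fin m, if b k = q ∧ c = Function.update b k p then
        RDual.app (g (wordVec c)) (φ (wordVec b)) else 0 := by
    intro b
    rw [rmul_apply, slotV_wordVec]
    by_cases h : b k = q
    · simp [h]
    · simp [h]
  have h2 : ∀ c : Fin n → Fin m, RDual.app (g (wordVec c)) (rmul (slotV m n k (eu q p)) φ (wordVec c)) =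
      ∑ b : Fin n → Fin m, if c k = p ∧ b = Function.update c k q then
        RDual.app (g (wordVec c)) (φ (wordVec b)) else 0 := by
    intro b
    rw [rmul_apply, slotV_wordVec]
    by_cases h : b k = p
    · simp [h]
    · simp [h]
  rw [pairing_apply, pairing_apply, Finset.sum_congr rfl fun b _ => h1 b,
    Finset.sum_congr rfl fun c _ => h2 c, Finset.sum_comm]
  refine Finset.sum_congr rfl fun c _ => Finset.sum_congr rfl fun b _ => if_congr ?_ rfl rfl
  constructor
  · rintro ⟨rfl, rfl⟩; simp
  · rintro ⟨rfl, rfl⟩; simp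

/-- Raising operators on one side are adjoint to lowering operators on the other. This makes
singular vectors orthogonal to lowered elements. -/
lemma pairing_lie (p q : Fin m) (g : HomV m n (RDual m M)) (φ : HomV m n M) :
    pairing ⁅(eu p q : gl m), g⁆ φ = pairing g ⁅(eu q p : gl m), φ⁆ := by
  have e : ∀ (N : Type _) [AddCommGroup N] [Module ℂ N] [Module (PS m) N]
      [LieRingModule (gl m) N] [IsBimodule m N] (X : gl m) (ψ : HomV m n N),
      rmul (∑ k, slotV m n k X) ψ = ∑ k, rmul (slotV m n k X) ψ := by
    intro N _ _ _ _ _ X ψ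
    refine LinearMap.ext fun w => ?_
    rw [rmul_apply, LinearMap.sum_apply, LinearMap.sum_apply, map_sum]
    rfl
  rw [homV_lie, homV_lie, map_sub, map_sub, LinearMap.sub_apply, pairing_lmul, e, e, map_sum, map_sum,
    LinearMap.sum_apply]
  simp only [pairing_rmul]

lemma omV_symm (k i : Fin n) : omV k i = (omV i k : Module.End ℂ (VPow m n)) := by
  rcases eq_or_ne k i with rfl | h
  · rfl
  · unfold omV
    rw [Finset.sum_comm]
    exact Finset.sum_congr rfl fun p _ => Finset.sum_congr rfl fun q _ => slotV_comm m n h _ _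

lemma rmul_omV (k i : Fin n) (φ : HomV m n M) : rmul (omV k i) φ =
    ∑ p, ∑ q, rmul (slotV m n i (eu q p)) (rmul (slotV m n k (eu p q)) φ) := by
  refine LinearMap.ext fun w => ?_
  simp only [rmul_apply, omV, LinearMap.sum_apply, Module.End.mul_apply, map_sum]

lemma pairing_omV (k i : Fin n) (g : HomV m n (RDual m M)) (φ : HomV m n M) :
    pairing (rmul (omV k i) g) φ = pairing g (rmul (omV k i) φ) := by
  rw [omV_symm k i, rmul_omV, omV_symm, rmul_omV]
  simp only [map_sum, LinearMap.sum_apply, pairing_rmul]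

lemma pairing_opS (i : ℕ) (h : i + 1 < n) (g : HomV m n (RDual m M)) (φ : HomV m n M) :
    pairing (opS _ i h g) φ = pairing g (opS _ i h φ) := pairing_omV _ _ _ _

/-- Taking adjoints exchanges p and q in each Casimir sum, which leaves the sum unchanged. -/
lemma pairing_opX (i : Fin n) (g : HomV m n (RDual m M)) (φ : HomV m n M) :
    pairing (opX _ i g) φ = pairing g (opX _ i φ) := by
  unfold opX
  simp only [LinearMap.add_apply, LinearMap.sub_apply, map_add, map_sub, LinearMap.sum_apply, map_sum,
    pairing_omV, LinearMap.comp_apply, pairing_lmul, pairing_rmul]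
  congr 2
  rw [Finset.sum_comm]
  rfl

end Pairing

/-! ### Weight spaces of the restricted dual -/

section DualWeights

variable {m : ℕ} {M : Type*} [AddCommGroup M] [Module ℂ M] [Module (PS m) M]
  [LieRingModule (gl m) M] [IsBimodule m M]

/-- The operator e_{ii} - z_i is its own adjoint and has eigenvalue κ_i on f and ν_i on v. -/
lemma RDual.app_eq_zero {κ ν : Fin m → ℤ} (hκ : ν ≠ κ) {f : RDual m M}
    (hf : f ∈ wtSpace m (RDual m M) κ) {v : M} (hv : v ∈ wtSpace m M ν) : RDual.app f v = 0 := by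
  obtain ⟨i, hi⟩ := Function.ne_iff.1 hκ
  have h1 := congrArg (fun x => RDual.app x v) (hf i)
  have h2 := hv i
  simp only [map_sub, LinearMap.sub_apply, RDual.app_lie, map_smul, LinearMap.smul_apply, eu_transpose,
    RDual.app_smul, ← h2] at h1
  have h3 : ((ν i : ℂ) - κ i) * RDual.app f v = 0 := by
    simp only [smul_eq_mul] at h1
    linear_combination h1
  refine (mul_eq_zero.1 h3).resolve_left fun h => hi ?_
  exact_mod_cast sub_eq_zero.1 h

lemma functional_ext (htop : ⨆ κ : Fin m → ℤ, wtSpace m M κ = ⊤) {f g : Module.Dual ℂ M}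
    (h : ∀ κ, ∀ v ∈ wtSpace m M κ, f v = g v) : f = g := by
  refine LinearMap.ext fun x => ?_
  have hx : x ∈ ⨆ κ : Fin m → ℤ, wtSpace m M κ := htop ▸ Submodule.mem_top
  induction hx using Submodule.iSup_induction' with
  | mem κ x hx => exact h κ x hx
  | zero => rw [map_zero, map_zero]
  | add x y _ _ hx hy => rw [map_add, map_add, hx, hy]

lemma RDual.eq_zero (htop : ⨆ κ : Fin m → ℤ, wtSpace m M κ = ⊤) {κ : Fin m → ℤ} {f : RDual m M}
    (hf : f ∈ wtSpace m (RDual m M) κ) (h : ∀ v ∈ wtSpace m M κ, RDual.app f v = 0) : f = 0 := by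
  refine RDual.app_injective (functional_ext htop fun ν v hv => ?_)
  rw [map_zero, LinearMap.zero_apply]
  rcases eq_or_ne ν κ with rfl | hν
  · exact h v hv
  · exact RDual.app_eq_zero hν hf hv

lemma exists_weight_projection (h : DirectSum.IsInternal fun κ : Fin m → ℤ => wtSpace m M κ)
    (κ : Fin m → ℤ) : ∃ f : M →ₗ[PS m] M, (∀ v ∈ wtSpace m M κ, f v = v) ∧
      ∀ ν ≠ κ, ∀ v ∈ wtSpace m M ν, f v = 0 := by
  let e := LinearEquiv.ofBijective (DirectSum.coeLinearMap fun κ : Fin m → ℤ => wtSpace m M κ) h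
  have he : ∀ ν, ∀ v (hv : v ∈ wtSpace m M ν), e.symm v = DirectSum.lof (PS m) _ _ ν ⟨v, hv⟩ := by
    intro ν v hv
    rw [LinearEquiv.symm_apply_eq]
    exact (DirectSum.coeLinearMap_lof _ ν ⟨v, hv⟩).symm
  refine ⟨(wtSpace m M κ).subtype ∘ₗ DirectSum.component (PS m) _ _ κ ∘ₗ e.symm.toLinearMap,
    fun v hv => ?_, fun ν hν v hv => ?_⟩
  · change ((DirectSum.component (PS m) _ _ κ (e.symm v) : wtSpace m M κ) : M) = v
    rw [he κ v hv, DirectSum.component.lof_self]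
  · change ((DirectSum.component (PS m) _ _ κ (e.symm v) : wtSpace m M κ) : M) = 0
    rw [he ν v hv, DirectSum.component.of, dif_neg hν]
    rfl

/-- The functional is restricted to one weight space and extended by 0 to the others. The full dual
of the weight space is reached, without any finiteness of dimension. -/
lemma exists_rdual (h : DirectSum.IsInternal fun κ : Fin m → ℤ => wtSpace m M κ)
    (κ : Fin m → ℤ) (l : Module.Dual ℂ M) : ∃ f : RDual m M, f ∈ wtSpace m (RDual m M) κ ∧
      ∀ v ∈ wtSpace m M κ, RDual.app f v = l v := by
  obtain ⟨pr, h1, h2⟩ := exists_weight_projection h κ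
  have h0 : ∀ ν ≠ κ, ∀ v ∈ wtSpace m M ν, (l ∘ₗ pr.restrictScalars ℂ) v = 0 := by
    intro ν hν v hv
    change l (pr v) = 0
    rw [h2 ν hν v hv, map_zero]
  have h1' : ∀ v ∈ wtSpace m M κ, (l ∘ₗ pr.restrictScalars ℂ) v = l v := by
    intro v hv
    change l (pr v) = l v
    rw [h1 v hv]
  have hmem : (l ∘ₗ pr.restrictScalars ℂ) ∈ rdual m M := by
    refine (Set.finite_singleton κ).subset ?_
    rintro ν ⟨v, hv, hne⟩
    by_contra hν
    exact hne (h0 ν hν v hv)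
  let f : RDual m M := (⟨_, hmem⟩ : rdual m M)
  have hf : ∀ v, RDual.app f v = (l ∘ₗ pr.restrictScalars ℂ) v := fun v => rfl
  refine ⟨f, mem_wtSpace.2 fun i => RDual.app_injective (functional_ext
    h.submodule_iSup_eq_top fun ν v hv => ?_), fun v hv => (hf v).trans (h1' v hv)⟩
  rw [RDual.app_lie, RDual.app_smul, eu_transpose, hf, hf, mem_wtSpace.1 hv i]
  rcases eq_or_ne ν κ with rfl | hν
  · rfl
  · rw [h0 ν hν _ (Submodule.smul_mem _ _ hv), h0 ν hν _ (Submodule.smul_mem _ _ hv)]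

end DualWeights

/-! ### Compatibility of the functor with duality -/

section DualTheorem

variable {m n : ℕ} {M : Type*} [AddCommGroup M] [Module ℂ M] [Module (PS m) M]
  [LieRingModule (gl m) M] [IsBimodule m M]

section CDual

variable {N : Type*} [AddCommGroup N] [Module ℂ N] [Module (Hecke n) N] [IsScalarTower ℂ (Hecke n) N]

/-- The functional underlying an element of the dual. -/
noncomputable def CDual.app : CDual n N →ₗ[ℂ] Module.Dual ℂ N := LinearMap.id

lemma CDual.ext {f g : CDual n N} (h : ∀ v, CDual.app f v = CDual.app g v) : f = g :=
  LinearMap.ext (f := CDual.app f) (g := CDual.app g) h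

lemma CDual.app_smul (h : Hecke n) (f : CDual n N) (v : N) :
    CDual.app (h • f) v = CDual.app f ((ParHecke.psi n h).unop • v) := rfl

instance : IsScalarTower ℂ (Hecke n) (CDual n N) :=
  ⟨fun c h f => CDual.ext fun v => by
    rw [CDual.app_smul, map_smul (ParHecke.psi n), MulOpposite.unop_smul, smul_assoc, map_smul (CDual.app f), map_smul CDual.app,
      LinearMap.smul_apply, CDual.app_smul]⟩

end CDual

/-- The pairing between `Φ(M^∨)` and `Φ(M)`. -/
noncomputable def phiPairing : Phi m n (RDual m M) →ₗ[ℂ] CDual n (Phi m n M) :=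
  (ev.dualMap : Module.Dual ℂ (HomV m n M) →ₗ[ℂ] Module.Dual ℂ (Phi m n M)) ∘ₗ pairing ∘ₗ ev

lemma phiPairing_app (G : Phi m n (RDual m M)) (F : Phi m n M) :
    CDual.app (phiPairing G) F = pairing (ev G) (ev F) := rfl

/-- The anti-involution ψ fixes the generators, and these act by self-adjoint operators. -/
lemma phiPairing_smul (h : Hecke n) (G : Phi m n (RDual m M)) :
    phiPairing (h • G) = h • (phiPairing G : CDual n (Phi m n M)) := by
  refine hecke_map_smul phiPairing (fun i G => CDual.ext fun F => ?_)
    (fun i hi G => CDual.ext fun F => ?_) h G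
  · rw [phiPairing_app, CDual.app_smul, ParHecke.psi, ParHecke.lift_x, phiPairing_app, ev_x_smul,
      MulOpposite.unop_op, ev_x_smul, pairing_opX]
  · rw [phiPairing_app, CDual.app_smul, ParHecke.psi, ParHecke.lift_s, phiPairing_app, ev_s_smul,
      MulOpposite.unop_op, ev_s_smul, pairing_opS]

/-- The vector `ev G` is orthogonal to singular vectors by assumption and to lowered elements by
contravariance, so it is orthogonal to the whole zero weight space. Elementary maps detect each of
its values. -/
lemma phiPairing_injective (hM : IsBGG m M) :
    Function.Injective (phiPairing : Phi m n (RDual m M) →ₗ[ℂ] CDual n (Phi m n M)) := by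
  refine (injective_iff_map_eq_zero _).2 fun G hG => ?_
  obtain ⟨h1, h2⟩ := mem_sing.1 (ev_mem G)
  have hs : ∀ φ ∈ sing m (HomV m n M), pairing (ev G) φ = 0 := by
    intro φ hφ
    obtain ⟨F, rfl⟩ := exists_ev_eq hφ
    exact LinearMap.congr_fun (congrArg CDual.app hG) F
  have hl : ∀ φ ∈ lowered m (HomV m n M), pairing (ev G) φ = 0 := by
    intro φ hφ
    obtain ⟨u, -, rfl⟩ := exists_of_mem_lowered hφ
    unfold lowerSum
    simp only [map_sum]
    refine Finset.sum_eq_zero fun p _ => Finset.sum_eq_zero fun q _ => ?_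
    split_ifs with hpq
    · rw [map_smul, ← pairing_lie, h2 p q hpq, map_zero, LinearMap.zero_apply, smul_zero]
    · rw [map_zero]
  have h0 : ∀ φ ∈ wtSpace m (HomV m n M) 0, pairing (ev G) φ = 0 := by
    intro φ hφ
    rw [← sing_sup_lowered (IsBGG.heightBdd hM).homV] at hφ
    obtain ⟨s, hs', l, hl', rfl⟩ := Submodule.mem_sup.1 hφ
    rw [map_add, hs s hs', hl l hl', add_zero]
  refine ev_injective ?_
  rw [map_zero]
  refine homV_ext fun b => ?_
  rw [LinearMap.zero_apply]
  refine RDual.eq_zero hM.weights.submodule_iSup_eq_top (homV_mem_wtSpace.1 h1 b) fun v hv => ?_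
  rw [← pairing_el]
  exact h0 _ (el_mem_wtSpace hv)

/-- A functional on Φ(M) is extended to one that vanishes on lowered elements. On the zero weight
space the extension is represented by some g with values in the restricted dual, and vanishing on
lowered elements is what makes g singular. -/
lemma phiPairing_surjective (hM : IsBGG m M) :
    Function.Surjective (phiPairing : Phi m n (RDual m M) →ₗ[ℂ] CDual n (Phi m n M)) := by
  intro l
  let Lw := (lowered m (HomV m n M)).restrictScalars ℂ
  -- Singular vectors meet lowered elements only in 0, so Φ(M) embeds in the quotient by lowered
  -- elements and has a linear retraction k from it.
  obtain ⟨k, hk⟩ := LinearMap.exists_leftInverse_of_injective (Lw.mkQ ∘ₗ ev) (by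
    refine LinearMap.ker_eq_bot'.2 fun F hF => ev_injective ?_
    have h1 : ev F ∈ lowered m (HomV m n M) := (Submodule.Quotient.mk_eq_zero Lw).1 hF
    have h2 : ev F ∈ sing m (HomV m n M) ⊓ lowered m (HomV m n M) := ⟨ev_mem F, h1⟩
    rw [sing_inf_lowered (IsBGG.heightBdd hM).homV] at h2
    rw [(Submodule.mem_bot _).1 h2, map_zero])
  let ℓ : Module.Dual ℂ (HomV m n M) := CDual.app l ∘ₗ k ∘ₗ Lw.mkQ
  have hℓ1 : ∀ F : Phi m n M, ℓ (ev F) = CDual.app l F := fun F =>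
    congrArg (CDual.app l) (LinearMap.congr_fun hk F)
  have hℓ2 : ∀ φ ∈ lowered m (HomV m n M), ℓ φ = 0 := by
    intro φ hφ
    change CDual.app l (k (Lw.mkQ φ)) = 0
    have : Lw.mkQ φ = 0 := (Submodule.Quotient.mk_eq_zero Lw).2 hφ
    rw [this, map_zero, map_zero]
  -- In a map of weight 0 the value at the word b has weight `wordWt b`, so only this component of
  -- the functional matters.
  choose f hf1 hf2 using fun b : Fin n → Fin m =>
    exists_rdual hM.weights (wordWt b) (ℓ ∘ₗ (el b : M →ₗ[PS m] HomV m n M).restrictScalars ℂ)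
  let g : HomV m n (RDual m M) := (wordBasis m n).constr ℂ f
  have hg : ∀ b, g (wordVec b) = f b := fun b => Module.Basis.constr_basis _ _ _ _
  have hpair : ∀ φ ∈ wtSpace m (HomV m n M) 0, pairing g φ = ℓ φ := by
    intro φ hφ
    conv_rhs => rw [homV_eq_sum φ, map_sum]
    rw [pairing_apply]
    refine Finset.sum_congr rfl fun b _ => ?_
    have := homV_mem_wtSpace.1 hφ b
    rw [zero_add] at this
    rw [hg, hf2 b _ this]
    rfl
  have hg0 : g ∈ wtSpace m (HomV m n (RDual m M)) 0 := homV_mem_wtSpace.2 fun b => by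
    rw [zero_add, hg]
    exact hf1 b
  have hgs : g ∈ sing m (HomV m n (RDual m M)) := by
    refine mem_sing.2 ⟨hg0, fun p q hpq => homV_ext fun b => ?_⟩
    have h1 : ⁅(eu p q : gl m), g⁆ ∈ wtSpace m (HomV m n (RDual m M)) (root p q) :=
      eu_mem_wtSpace (zero_add _).symm hg0
    rw [LinearMap.zero_apply]
    refine RDual.eq_zero hM.weights.submodule_iSup_eq_top (homV_mem_wtSpace.1 h1 b) fun v hv => ?_
    have h2 := lie_mem_lowered hpq (el_mem_wtSpace (n := n) (b := b) hv)
    rw [← pairing_el, pairing_lie, hpair _ (lowered_le h2), hℓ2 _ h2]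
  obtain ⟨G, hG⟩ := exists_ev_eq hgs
  refine ⟨G, CDual.ext fun F => ?_⟩
  rw [phiPairing_app, hG, hpair _ (mem_sing.1 (ev_mem F)).1, hℓ1]

/-- The Arakawa–Suzuki functor intertwines the dualities. -/
lemma phi_rdual_equiv (n : ℕ) (hM : IsBGG m M) :
    Nonempty (Phi m n (RDual m M) ≃ₗ[Hecke n] CDual n (Phi m n M)) :=
  ⟨LinearEquiv.ofBijective
    { toFun := phiPairing
      map_add' := map_add _
      map_smul' := phiPairing_smul } ⟨phiPairing_injective hM, phiPairing_surjective hM⟩⟩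

end DualTheorem

end ArakawaSuzuki

namespace ArakawaSuzuki

/-! ### Strictly lower triangular matrices -/

section Lower

variable (m : ℕ)

/-- The strictly lower triangular matrices. -/
def nminus : LieSubalgebra ℂ (gl m) where
  carrier := {X | ∀ i j, i ≤ j → X i j = 0}
  add_mem' {X Y} hX hY i j h := by rw [Matrix.add_apply, hX i j h, hY i j h, add_zero]
  zero_mem' i j h := rfl
  smul_mem' c X hX i j h := by rw [Matrix.smul_apply, hX i j h, smul_zero]
  lie_mem' {X Y} hX hY i j h := by
    have key : ∀ X Y : gl m, (∀ i j, i ≤ j → X i j = 0) → (∀ i j, i ≤ j → Y i j = 0) →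
        (X * Y) i j = 0 := by
      intro X Y hX hY
      rw [Matrix.mul_apply]
      refine Finset.sum_eq_zero fun k _ => ?_
      rcases le_or_gt i k with hk | hk
      · rw [hX i k hk, zero_mul]
      · rw [hY k j (hk.le.trans h), mul_zero]
    rw [LieRing.of_associative_ring_bracket, Matrix.sub_apply, key X Y hX hY, key Y X hY hX,
      sub_zero]

/-- The strictly lower triangular part of a matrix. -/
def lowPart : gl m →ₗ[ℂ] nminus m where
  toFun X := ⟨Matrix.of fun i j => if i ≤ j then 0 else X i j, fun i j h => if_pos h⟩
  map_add' X Y := Subtype.ext <| Matrix.ext fun i j => by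
    change (if i ≤ j then 0 else X i j + Y i j) =
      (if i ≤ j then 0 else X i j) + (if i ≤ j then 0 else Y i j)
    split_ifs <;> simp
  map_smul' c X := Subtype.ext <| Matrix.ext fun i j => by
    change (if i ≤ j then 0 else c * X i j) = c * (if i ≤ j then 0 else X i j)
    split_ifs <;> simp

variable {m}

lemma lowPart_apply (X : gl m) (i j : Fin m) :
    (lowPart m X : gl m) i j = if i ≤ j then 0 else X i j := rfl

lemma lowPart_coe (f : nminus m) : lowPart m f = f :=
  Subtype.ext <| Matrix.ext fun i j => by
    rw [lowPart_apply]
    split_ifs with h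
    · exact (f.2 i j h).symm
    · rfl

lemma lowPart_borel {X : gl m} (hX : X ∈ borel m) : lowPart m X = 0 :=
  Subtype.ext <| Matrix.ext fun i j => by
    rw [lowPart_apply]
    split_ifs with h
    · rfl
    · exact hX i j (not_le.1 h)

lemma sub_lowPart_mem (X : gl m) : X - (lowPart m X : gl m) ∈ borel m := by
  intro i j h
  rw [Matrix.sub_apply, lowPart_apply, if_neg h.not_ge, sub_self]

lemma eu_mem_nminus {p q : Fin m} (h : q < p) : eu p q ∈ nminus m := by
  intro i j hij
  unfold eu
  refine Matrix.single_apply_of_ne _ _ _ _ _ ?_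
  rintro ⟨rfl, rfl⟩
  exact absurd h hij.not_gt

end Lower

/-! ### A model of the deformed Verma module that is free over U(𝔫⁻) -/

section Free

variable (m : ℕ) (mu : Fin m → ℤ)

/-- The underlying space of the Verma module, a free module over the enveloping algebra of the
strictly lower triangular matrices. -/
abbrev FreeLow : Type := PS m ⊗[ℂ] UniversalEnvelopingAlgebra ℂ (nminus m)

variable {m}

/-- The action of strictly lower triangular matrices. -/
noncomputable def lowOp : nminus m →ₗ[ℂ] FreeLow m →ₗ[PS m] FreeLow m where
  toFun f := TensorProduct.AlgebraTensorModule.map LinearMap.id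
    (LinearMap.mulLeft ℂ (UniversalEnvelopingAlgebra.ι ℂ f))
  map_add' f g := by
    ext u
    simp [add_mul, TensorProduct.tmul_add]
  map_smul' c f := by
    ext u
    simp

lemma lowOp_tmul (f : nminus m) (r : PS m) (u : UniversalEnvelopingAlgebra ℂ (nminus m)) :
    lowOp f (r ⊗ₜ u) = r ⊗ₜ (UniversalEnvelopingAlgebra.ι ℂ f * u) := rfl

lemma lowOp_lie (f g : nminus m) (y : FreeLow m) :
    lowOp ⁅f, g⁆ y = lowOp f (lowOp g y) - lowOp g (lowOp f y) := by
  induction y using TensorProduct.induction_on with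
  | zero => simp only [map_zero, sub_zero]
  | add a b ha hb => simp only [map_add, ha, hb]; abel
  | tmul r u =>
    simp only [lowOp_tmul]
    rw [LieHom.map_lie, LieRing.of_associative_ring_bracket, sub_mul, TensorProduct.tmul_sub, mul_assoc,
      mul_assoc]

lemma uea_induction_left {L : Type*} [LieRing L] [LieAlgebra ℂ L]
    {P : UniversalEnvelopingAlgebra ℂ L → Prop} (h1 : P 1) (hsmul : ∀ (c : ℂ) u, P u → P (c • u))
    (hadd : ∀ a b, P a → P b → P (a + b)) (hmul : ∀ x u, P u → P (UniversalEnvelopingAlgebra.ι ℂ x * u))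
    (u : UniversalEnvelopingAlgebra ℂ L) : P u := by
  have h : ∀ a u, P u → P (a * u) := by
    intro a
    induction a using uea_induction with
    | halg c => exact fun u hu => by rw [← Algebra.smul_def]; exact hsmul c u hu
    | hι x => exact hmul x
    | hadd a b ha hb => exact fun u hu => by rw [add_mul]; exact hadd _ _ (ha u hu) (hb u hu)
    | hmul a b ha hb => exact fun u hu => by rw [mul_assoc]; exact ha _ (hb u hu)
  have := h u 1 h1
  rwa [mul_one] at this

lemma freeLow_induction {P : FreeLow m → Prop} (hadd : ∀ a b, P a → P b → P (a + b))
    (h1 : ∀ r, P (r ⊗ₜ 1)) (hL : ∀ f y, P y → P (lowOp f y)) (y : FreeLow m) : P y := by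
  induction y using TensorProduct.induction_on with
  | zero => have := h1 0; rwa [TensorProduct.zero_tmul] at this
  | add a b ha hb => exact hadd a b ha hb
  | tmul r u =>
    induction u using uea_induction_left generalizing r with
    | h1 => exact h1 r
    | hsmul c u hu => rw [← TensorProduct.smul_tmul]; exact hu _
    | hadd a b ha hb => rw [TensorProduct.tmul_add]; exact hadd _ _ (ha r) (hb r)
    | hmul x u hu => exact hL x _ (hu r)

/-- The action of a Lie subalgebra of `𝔤𝔩_m` on linear maps from `𝔤𝔩_m` to a module. -/
noncomputable def homAct {Y : Type*} [AddCommGroup Y] [Module ℂ Y] (L : nminus m →ₗ[ℂ] Y →ₗ[ℂ] Y)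
    (hL : ∀ f g y, L ⁅f, g⁆ y = L f (L g y) - L g (L f y)) :
    nminus m →ₗ⁅ℂ⁆ Module.End ℂ (gl m →ₗ[ℂ] Y) where
  toFun f :=
    -- This is the rule X(f y) = f(X y) - [f, X] y, read with y replaced by the map θ that sends X
    -- to X y.
    { toFun := fun θ => L f ∘ₗ θ - θ ∘ₗ LieModule.toEnd ℂ (gl m) (gl m) (f : gl m)
      map_add' := fun θ θ' => by rw [LinearMap.comp_add, LinearMap.add_comp]; abel
      map_smul' := fun c θ => by
        rw [LinearMap.comp_smul, LinearMap.smul_comp, RingHom.id_apply, smul_sub] }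
  map_add' f g := LinearMap.ext fun θ => LinearMap.ext fun X => by
    change L (f + g) (θ X) - θ ⁅(f : gl m) + (g : gl m), X⁆ =
      (L f (θ X) - θ ⁅(f : gl m), X⁆) + (L g (θ X) - θ ⁅(g : gl m), X⁆)
    rw [map_add, LinearMap.add_apply, add_lie, map_add]
    abel
  map_smul' c f := LinearMap.ext fun θ => LinearMap.ext fun X => by
    change L (c • f) (θ X) - θ ⁅c • (f : gl m), X⁆ = c • (L f (θ X) - θ ⁅(f : gl m), X⁆)
    rw [map_smul, LinearMap.smul_apply, smul_lie, map_smul, smul_sub]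
  map_lie' {f g} := LinearMap.ext fun θ => LinearMap.ext fun X => by
    rw [LieRing.of_associative_ring_bracket]
    change L ⁅f, g⁆ (θ X) - θ ⁅⁅(f : gl m), (g : gl m)⁆, X⁆ =
      (L f (L g (θ X) - θ ⁅(g : gl m), X⁆) -
        (L g (θ ⁅(f : gl m), X⁆) - θ ⁅(g : gl m), ⁅(f : gl m), X⁆⁆)) -
      (L g (L f (θ X) - θ ⁅(f : gl m), X⁆) -
        (L f (θ ⁅(g : gl m), X⁆) - θ ⁅(f : gl m), ⁅(g : gl m), X⁆⁆))
    rw [hL, lie_lie (f : gl m) (g : gl m) X]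
    simp only [map_sub]
    abel

/-- The extension of a linear map `θ` from `𝔤𝔩_m` along the action `homAct`. -/
noncomputable def homExt {Y : Type*} [AddCommGroup Y] [Module ℂ Y] (L : nminus m →ₗ[ℂ] Y →ₗ[ℂ] Y)
    (hL : ∀ f g y, L ⁅f, g⁆ y = L f (L g y) - L g (L f y)) (θ : gl m →ₗ[ℂ] Y) :
    UniversalEnvelopingAlgebra ℂ (nminus m) →ₗ[ℂ] gl m →ₗ[ℂ] Y :=
  (LinearMap.applyₗ θ).comp (UniversalEnvelopingAlgebra.lift ℂ (homAct L hL)).toLinearMap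

section

variable {Y : Type*} [AddCommGroup Y] [Module ℂ Y] (L : nminus m →ₗ[ℂ] Y →ₗ[ℂ] Y)
    (hL : ∀ f g y, L ⁅f, g⁆ y = L f (L g y) - L g (L f y)) (θ : gl m →ₗ[ℂ] Y)

lemma homExt_one : homExt L hL θ 1 = θ := by
  change (UniversalEnvelopingAlgebra.lift ℂ (homAct L hL)) 1 θ = θ
  rw [map_one, Module.End.one_apply]

lemma homExt_mul (f : nminus m) (u : UniversalEnvelopingAlgebra ℂ (nminus m)) (X : gl m) :
    homExt L hL θ (UniversalEnvelopingAlgebra.ι ℂ f * u) X =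
      L f (homExt L hL θ u X) - homExt L hL θ u ⁅(f : gl m), X⁆ := by
  change (UniversalEnvelopingAlgebra.lift ℂ (homAct L hL)) (_ * u) θ X = _
  rw [map_mul, Module.End.mul_apply, UniversalEnvelopingAlgebra.lift_ι_apply]
  rfl

end

/-- The action of strictly lower triangular matrices, as complex linear maps. -/
noncomputable def lowOpC : nminus m →ₗ[ℂ] FreeLow m →ₗ[ℂ] FreeLow m where
  toFun f := (lowOp f).restrictScalars ℂ
  map_add' f g := by rw [map_add]; rfl
  map_smul' c f := by rw [map_smul]; rfl

lemma lowOpC_lie (f g : nminus m) (y : FreeLow m) :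
    lowOpC ⁅f, g⁆ y = lowOpC f (lowOpC g y) - lowOpC g (lowOpC f y) :=
  lowOp_lie f g y

/-- The weight `∑ X_{ii} (μ_i + z_i)`. -/
noncomputable def diagChar : gl m →ₗ[ℂ] PS m :=
  ∑ i, (LinearMap.toSpanSingleton ℂ (PS m) (MvPowerSeries.C (mu i : ℂ) + MvPowerSeries.X i)) ∘ₗ
    Matrix.entryLinearMap ℂ ℂ i i

lemma diagChar_apply (X : gl m) :
    diagChar mu X = ∑ i, X i i • (MvPowerSeries.C (mu i : ℂ) + MvPowerSeries.X i : PS m) := by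
  simp [diagChar]

/-- The action of `𝔤𝔩_m` on the highest weight vector. -/
noncomputable def actOne : gl m →ₗ[ℂ] FreeLow m :=
  (TensorProduct.mk ℂ (PS m) _ 1) ∘ₗ
      (UniversalEnvelopingAlgebra.ι ℂ : nminus m →ₗ⁅ℂ⁆ _).toLinearMap ∘ₗ lowPart m +
    (TensorProduct.mk ℂ (PS m) (UniversalEnvelopingAlgebra ℂ (nminus m))).flip 1 ∘ₗ diagChar mu

lemma actOne_apply (X : gl m) : actOne mu X =
    1 ⊗ₜ UniversalEnvelopingAlgebra.ι ℂ (lowPart m X) + diagChar mu X ⊗ₜ 1 := rfl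

/-- The action of `𝔤𝔩_m` on the Verma module. -/
noncomputable def vermaAct : FreeLow m →ₗ[PS m] gl m →ₗ[ℂ] FreeLow m :=
  TensorProduct.AlgebraTensorModule.lift (LinearMap.toSpanSingleton (PS m)
    (UniversalEnvelopingAlgebra ℂ (nminus m) →ₗ[ℂ] gl m →ₗ[ℂ] FreeLow m)
    (homExt lowOpC lowOpC_lie (actOne mu)))

lemma vermaAct_tmul (r : PS m) (u : UniversalEnvelopingAlgebra ℂ (nminus m)) (X : gl m) :
    vermaAct mu (r ⊗ₜ u) X = r • homExt lowOpC lowOpC_lie (actOne mu) u X := rfl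

/-- Together with `vermaAct_one` this recursion determines the action. The universal property of
U(𝔫⁻) makes it well defined, so no basis of the enveloping algebra has to be chosen. -/
lemma vermaAct_lowOp (f : nminus m) (y : FreeLow m) (X : gl m) :
    vermaAct mu (lowOp f y) X = lowOp f (vermaAct mu y X) - vermaAct mu y ⁅(f : gl m), X⁆ := by
  induction y using TensorProduct.induction_on with
  | zero => simp only [map_zero, LinearMap.zero_apply, sub_zero]
  | add a b ha hb => simp only [map_add, LinearMap.add_apply, ha, hb]; abel
  | tmul r u =>
    rw [lowOp_tmul, vermaAct_tmul, vermaAct_tmul, vermaAct_tmul, homExt_mul, smul_sub, map_smul]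
    rfl

lemma vermaAct_one (r : PS m) (X : gl m) : vermaAct mu (r ⊗ₜ 1) X =
    lowOp (lowPart m X) (r ⊗ₜ 1) + diagChar mu X • r ⊗ₜ 1 := by
  rw [vermaAct_tmul, homExt_one, actOne_apply, lowOp_tmul, mul_one, smul_add,
    TensorProduct.smul_tmul', TensorProduct.smul_tmul', TensorProduct.smul_tmul', smul_eq_mul,
    smul_eq_mul, smul_eq_mul, mul_one, mul_comm]

lemma diagChar_nminus (f : nminus m) : diagChar mu f = 0 := by
  rw [diagChar_apply]
  exact Finset.sum_eq_zero fun i _ => by rw [f.2 i i le_rfl, zero_smul]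

lemma diagChar_lie {X Y : gl m} (hX : X ∈ borel m) (hY : Y ∈ borel m) : diagChar mu ⁅X, Y⁆ = 0 := by
  rw [diagChar_apply]
  refine Finset.sum_eq_zero fun i _ => ?_
  rw [LieRing.of_associative_ring_bracket, Matrix.sub_apply, borel_mul_diag m hX hY,
    borel_mul_diag m hY hX, mul_comm, sub_self, zero_smul]

/-- The recursion defines the action of all matrices at once; its agreement on 𝔫⁻ with left
multiplication has to be checked, by induction on y. -/
lemma vermaAct_nminus (f : nminus m) (y : FreeLow m) : vermaAct mu y (f : gl m) = lowOp f y := by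
  induction y using freeLow_induction generalizing f with
  | hadd a b ha hb => rw [map_add, map_add, LinearMap.add_apply, ha, hb]
  | h1 r => rw [vermaAct_one, lowPart_coe, diagChar_nminus, zero_smul, add_zero]
  | hL g y hy =>
    rw [vermaAct_lowOp, hy, ← LieSubalgebra.coe_bracket, hy, lowOp_lie]
    abel

/-- Induction on y. On the vectors r ⊗ 1 both matrices are split into their lower and Borel parts;
the bracket of two Borel parts acts by 0 and that of two lower parts is left multiplication. Passing
from y to f y uses the Jacobi identity and the induction hypothesis for three brackets. -/
lemma vermaAct_lie (y : FreeLow m) (X Z : gl m) : vermaAct mu y ⁅X, Z⁆ =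
    vermaAct mu (vermaAct mu y Z) X - vermaAct mu (vermaAct mu y X) Z := by
  induction y using freeLow_induction generalizing X Z with
  | hadd a b ha hb => simp only [map_add, LinearMap.add_apply, ha, hb]; abel
  | h1 r =>
    -- The lower part of Z has been moved to the outside by the recursion. The diagonal terms are
    -- symmetric in X and Z and cancel in the commutator.
    have e1 : ∀ X Z : gl m, vermaAct mu (vermaAct mu (r ⊗ₜ 1) Z) X =
        lowOp (lowPart m Z) (lowOp (lowPart m X) (r ⊗ₜ 1)) +
        (diagChar mu X • lowOp (lowPart m Z) (r ⊗ₜ 1) + diagChar mu Z • lowOp (lowPart m X) (r ⊗ₜ 1)) -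
        vermaAct mu (r ⊗ₜ 1) ⁅(lowPart m Z : gl m), X⁆ +
        (diagChar mu Z * diagChar mu X) • r ⊗ₜ 1 := by
      intro X Z
      rw [vermaAct_one mu r Z, map_add, map_smul, LinearMap.add_apply, LinearMap.smul_apply,
        vermaAct_lowOp, vermaAct_one mu r X, map_add, map_smul, smul_add, smul_smul]
      abel
    have hb : vermaAct mu (r ⊗ₜ 1) ⁅X - (lowPart m X : gl m), Z - (lowPart m Z : gl m)⁆ = 0 := by
      rw [vermaAct_one, lowPart_borel ((borel m).lie_mem (sub_lowPart_mem X) (sub_lowPart_mem Z)),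
        diagChar_lie mu (sub_lowPart_mem X) (sub_lowPart_mem Z), map_zero, LinearMap.zero_apply,
        zero_smul, add_zero]
    have hn : vermaAct mu (r ⊗ₜ 1) ⁅(lowPart m X : gl m), (lowPart m Z : gl m)⁆ =
        lowOp (lowPart m X) (lowOp (lowPart m Z) (r ⊗ₜ 1)) -
          lowOp (lowPart m Z) (lowOp (lowPart m X) (r ⊗ₜ 1)) := by
      rw [← LieSubalgebra.coe_bracket, vermaAct_nminus, lowOp_lie]
    have h3 : ⁅X - (lowPart m X : gl m), Z - (lowPart m Z : gl m)⁆ = ⁅X, Z⁆ +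
        ⁅(lowPart m Z : gl m), X⁆ - ⁅(lowPart m X : gl m), Z⁆
          + ⁅(lowPart m X : gl m), (lowPart m Z : gl m)⁆ := by
      rw [sub_lie, lie_sub, lie_sub, ← lie_skew X (lowPart m Z : gl m)]
      abel
    rw [h3, map_add, map_sub, map_add, hn] at hb
    rw [e1, e1, mul_comm (diagChar mu X)]
    rw [← sub_eq_zero]
    rw [← hb]
    abel
  | hL f y hy =>
    simp only [vermaAct_lowOp, map_sub, LinearMap.sub_apply]
    rw [leibniz_lie (f : gl m) X Z, map_add, hy X Z, hy ⁅(f : gl m), X⁆ Z, hy X ⁅(f : gl m), Z⁆, map_sub]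
    abel

/-- A copy of `FreeLow m`, on which `𝔤𝔩_m` acts as on the deformed Verma module. -/
@[nolint unusedArguments]
def FreeVerma (_ : Fin m → ℤ) : Type := FreeLow m

noncomputable instance : AddCommGroup (FreeVerma mu) := inferInstanceAs (AddCommGroup (FreeLow m))

noncomputable instance : Module ℂ (FreeVerma mu) := inferInstanceAs (Module ℂ (FreeLow m))

noncomputable instance : Module (PS m) (FreeVerma mu) := inferInstanceAs (Module (PS m) (FreeLow m))

noncomputable instance : LieRingModule (gl m) (FreeVerma mu) where
  bracket X y := vermaAct mu y X
  add_lie X Y y := map_add (vermaAct mu y) X Y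
  lie_add X y z := LinearMap.congr_fun (map_add (vermaAct mu) y z) X
  leibniz_lie X Y y := (sub_eq_iff_eq_add.1 (vermaAct_lie mu y X Y).symm)

lemma FreeVerma.lie_def (X : gl m) (y : FreeVerma mu) : ⁅X, y⁆ = vermaAct mu y X := rfl

instance : IsScalarTower ℂ (PS m) (FreeVerma mu) :=
  inferInstanceAs (IsScalarTower ℂ (PS m) (FreeLow m))

lemma FreeVerma.lie_smul' (X : gl m) (r : PS m) (y : FreeVerma mu) : ⁅X, r • y⁆ = r • ⁅X, y⁆ :=
  LinearMap.congr_fun (map_smul (vermaAct mu) r y) X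

instance : IsBimodule m (FreeVerma mu) where
  scalar := inferInstance
  lieMod :=
    { smul_lie := fun c X y => map_smul (vermaAct mu y) c X
      lie_smul := fun c X y => by
        rw [← algebraMap_smul (PS m) c y, FreeVerma.lie_smul', algebraMap_smul] }
  lie_ps := FreeVerma.lie_smul' mu

/-- The highest weight vector of `FreeVerma mu`. -/
noncomputable def FreeVerma.one : FreeVerma mu := ((1 : PS m) ⊗ₜ[ℂ] 1 : FreeLow m)

lemma FreeVerma.lie_one {X : gl m} (hX : X ∈ borel m) :
    ⁅X, FreeVerma.one mu⁆ = diagChar mu X • FreeVerma.one mu := by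
  refine (vermaAct_one mu 1 X).trans ?_
  rw [lowPart_borel hX, map_zero, LinearMap.zero_apply, zero_add]
  rfl

lemma FreeVerma.one_mem : FreeVerma.one mu ∈ wtSpace m (FreeVerma mu) mu := by
  refine mem_wtSpace.2 fun i => ?_
  rw [FreeVerma.lie_one mu (borel_eu le_rfl), diagChar_apply]
  congr 1
  rw [Finset.sum_eq_single i]
  · rw [eu, Matrix.single_apply_same, one_smul]
  · intro j _ hj
    rw [eu, Matrix.single_apply_of_ne _ _ _ _ _ (by rintro ⟨h, -⟩; exact hj h.symm), zero_smul]
  · simp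

lemma FreeVerma.upper_one {p q : Fin m} (h : p < q) : ⁅(eu p q : gl m), FreeVerma.one mu⁆ = 0 := by
  rw [FreeVerma.lie_one mu (borel_eu h.le), diagChar_apply]
  rw [Finset.sum_eq_zero, zero_smul]
  intro j _
  rw [eu, Matrix.single_apply_of_ne _ _ _ _ _ (by rintro ⟨rfl, rfl⟩; exact lt_irrefl _ h), zero_smul]

end Free

/-! ### Maps from the Verma module to the tensor power -/

section WordCoef

variable {m n : ℕ}

/-- The action of the strictly lower triangular matrices on the tensor power. -/
noncomputable def lowV : nminus m →ₗ⁅ℂ⁆ Module.End ℂ (VPow m n) where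
  toFun f := ∑ k, slotV m n k f
  map_add' f g := by
    rw [← Finset.sum_add_distrib]
    exact Finset.sum_congr rfl fun k _ => map_add (slotV m n k) (f : gl m) g
  map_smul' c f := by
    rw [RingHom.id_apply, Finset.smul_sum]
    exact Finset.sum_congr rfl fun k _ => map_smul (slotV m n k) c (f : gl m)
  map_lie' {f g} := LinearMap.ext fun w => by
    have h := leibniz_lie (f : gl m) (g : gl m) w
    exact eq_sub_of_add_eq h.symm

/-- The coefficients, in the basis of words, of the images of a word under `U(𝔫⁻)`. -/
noncomputable def wordCoef (b c : Fin n → Fin m) : FreeLow m →ₗ[PS m] PS m :=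
  TensorProduct.AlgebraTensorModule.lift (LinearMap.toSpanSingleton (PS m)
    (UniversalEnvelopingAlgebra ℂ (nminus m) →ₗ[ℂ] PS m)
    (Algebra.linearMap ℂ (PS m) ∘ₗ (wordBasis m n).coord c ∘ₗ (LinearMap.applyₗ (wordVec b)) ∘ₗ
      (UniversalEnvelopingAlgebra.lift ℂ (lowV (m := m) (n := n))).toLinearMap))

lemma wordCoef_tmul (b c : Fin n → Fin m) (r : PS m) (u : UniversalEnvelopingAlgebra ℂ (nminus m)) :
    wordCoef b c (r ⊗ₜ u) = r * algebraMap ℂ (PS m) ((wordBasis m n).coord c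
      (UniversalEnvelopingAlgebra.lift ℂ (lowV (m := m) (n := n)) u (wordVec b))) := rfl

lemma wordCoef_one (b c : Fin n → Fin m) (r : PS m) :
    wordCoef b c (r ⊗ₜ 1) = if c = b then r else 0 := by
  rw [wordCoef_tmul, map_one, Module.End.one_apply, wordVec, Module.Basis.coord_apply,
    Module.Basis.repr_self, Finsupp.single_apply]
  by_cases h : b = c
  · rw [if_pos h, if_pos h.symm, map_one, mul_one]
  · rw [if_neg h, if_neg (Ne.symm h), map_zero, mul_zero]

lemma wordCoef_lowOp (b c : Fin n → Fin m) {p q : Fin m} (h : q < p) (y : FreeLow m) :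
    wordCoef b c (lowOp ⟨eu p q, eu_mem_nminus h⟩ y) =
      ∑ k, if c k = p then wordCoef b (Function.update c k q) y else 0 := by
  induction y using TensorProduct.induction_on with
  | zero => simp only [map_zero, ite_self, Finset.sum_const_zero]
  | add y z hy hz =>
    rw [map_add, map_add, hy, hz, ← Finset.sum_add_distrib]
    refine Finset.sum_congr rfl fun k _ => ?_
    rw [map_add]
    split_ifs
    · rfl
    · rw [add_zero]
  | tmul r u =>
    rw [lowOp_tmul, wordCoef_tmul, map_mul, Module.End.mul_apply, UniversalEnvelopingAlgebra.lift_ι_apply]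
    change r * algebraMap ℂ (PS m) ((wordBasis m n).coord c ((∑ k, slotV m n k (eu p q)) _)) = _
    rw [LinearMap.sum_apply, map_sum, map_sum, Finset.mul_sum]
    refine Finset.sum_congr rfl fun k _ => ?_
    rw [coord_slotV, wordCoef_tmul]
    split_ifs
    · rfl
    · rw [map_zero, mul_zero]

/-- The deformed Verma module is free over `U(𝔫⁻)`: every word defines a map of `𝔫⁻`-modules to
the tensor power which maps the highest weight vector to the given word. -/
lemma DVerma.exists_wordCoef (lam : Fin m → ℤ) (b : Fin n → Fin m) :
    ∃ ψ : (Fin n → Fin m) → DVerma m lam →ₗ[PS m] PS m,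
      (∀ c, ψ c (DVerma.gen lam) = if c = b then 1 else 0) ∧
      ∀ (p q : Fin m), q < p → ∀ c x, ψ c ⁅(eu p q : gl m), x⁆ =
        ∑ k, if c k = p then ψ (Function.update c k q) x else 0 := by
  have h1 := FreeVerma.one_mem (lam - rho m)
  have h2 : ∀ p q : Fin m, p < q → ⁅(eu p q : gl m), FreeVerma.one (lam - rho m)⁆ = 0 :=
    fun p q h => FreeVerma.upper_one _ h
  have hL := (DVerma.lift h1 h2).2
  let κ : (Fin n → Fin m) → FreeVerma (lam - rho m) →ₗ[PS m] PS m := fun c => wordCoef b c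
  refine ⟨fun c => κ c ∘ₗ (DVerma.lift h1 h2).1, fun c => ?_, fun p q h c x => ?_⟩
  · exact (congrArg (κ c) (DVerma.lift_gen h1 h2)).trans (wordCoef_one b c 1)
  · refine (congrArg (κ c) (hL (eu p q) x)).trans ?_
    refine Eq.trans (congrArg (κ c) (vermaAct_nminus (lam - rho m) ⟨eu p q, eu_mem_nminus h⟩
      ((DVerma.lift h1 h2).1 x))) ?_
    exact wordCoef_lowOp b c h _

end WordCoef

end ArakawaSuzuki

namespace ArakawaSuzuki

/-! ### The projection to singular vectors and the Hecke action modulo lowered elements -/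

section Projection

variable {m : ℕ} {N : Type*} [AddCommGroup N] [Module ℂ N] [Module (PS m) N]
  [LieRingModule (gl m) N] [IsBimodule m N]

lemma map_mem_wtSpace {T : N →ₗ[PS m] N}
    (hT : ∀ a b φ, T ⁅(eu a b : gl m), φ⁆ = ⁅(eu a b : gl m), T φ⁆) {κ : Fin m → ℤ} {φ : N}
    (hφ : φ ∈ wtSpace m N κ) : T φ ∈ wtSpace m N κ :=
  mem_wtSpace.2 fun i => by rw [← hT, mem_wtSpace.1 hφ i, map_smul]

lemma map_mem_lowered {T : N →ₗ[PS m] N}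
    (hT : ∀ a b φ, T ⁅(eu a b : gl m), φ⁆ = ⁅(eu a b : gl m), T φ⁆) {φ : N}
    (hφ : φ ∈ lowered m N) : T φ ∈ lowered m N := by
  have h : lowered m N ≤ (lowered m N).comap T := lowered_le_iff.2 fun p q hpq v hv => by
    rw [Submodule.mem_comap, hT]
    exact lie_mem_lowered hpq (map_mem_wtSpace hT hv)
  exact h hφ

variable {n : ℕ} {M : Type*} [AddCommGroup M] [Module ℂ M] [Module (PS m) M]
  [LieRingModule (gl m) M] [IsBimodule m M]

lemma exists_sub_ev_mem (hb : HeightBdd m M) {φ : HomV m n M} (hφ : φ ∈ wtSpace m (HomV m n M) 0) :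
    ∃ F : Phi m n M, φ - ev F ∈ lowered m (HomV m n M) := by
  rw [← sing_sup_lowered hb.homV] at hφ
  obtain ⟨y, hy, l, hl, rfl⟩ := Submodule.mem_sup.1 hφ
  obtain ⟨F, rfl⟩ := exists_ev_eq hy
  exact ⟨F, by rwa [add_sub_cancel_left]⟩

lemma eq_of_ev_sub_mem (hb : HeightBdd m M) {F G : Phi m n M}
    (h : ev F - ev G ∈ lowered m (HomV m n M)) : F = G := by
  have h1 : ev F - ev G ∈ sing m (HomV m n M) ⊓ lowered m (HomV m n M) :=
    ⟨Submodule.sub_mem _ (ev_mem F) (ev_mem G), h⟩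
  rw [sing_inf_lowered hb.homV, Submodule.mem_bot, sub_eq_zero] at h1
  exact ev_injective h1

/-- The projection of the zero weight space to the space of singular vectors. -/
noncomputable def phiProj (hb : HeightBdd m M) : wtSpace m (HomV m n M) 0 →ₗ[ℂ] Phi m n M :=
  -- The singular component is chosen separately for each φ; it is unique by `eq_of_ev_sub_mem`, and
  -- uniqueness gives linearity.
  have hex : ∃ f : wtSpace m (HomV m n M) 0 → Phi m n M,
      ∀ φ : wtSpace m (HomV m n M) 0, (φ : HomV m n M) - ev (f φ) ∈ lowered m (HomV m n M) :=
    Classical.skolem.1 fun φ => exists_sub_ev_mem hb φ.2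
  { toFun := hex.choose
    map_add' := fun φ ψ => eq_of_ev_sub_mem hb (by
      have h4 := Submodule.sub_mem _ (Submodule.add_mem _ (hex.choose_spec φ) (hex.choose_spec ψ))
        (hex.choose_spec (φ + ψ))
      rw [map_add]
      convert h4 using 1
      rw [Submodule.coe_add]
      generalize ((φ : HomV m n M)) = y
      abel)
    map_smul' := fun c φ => eq_of_ev_sub_mem hb (by
      have h4 := Submodule.sub_mem _ (Submodule.smul_mem _ (algebraMap ℂ (PS m) c)
        (hex.choose_spec φ)) (hex.choose_spec (c • φ))
      rw [algebraMap_smul] at h4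
      rw [RingHom.id_apply, map_smul]
      convert h4 using 1
      rw [smul_sub]
      exact (sub_sub_sub_cancel_left _ _ _).symm) }

variable (hb : HeightBdd m M)

lemma phiProj_spec (φ : wtSpace m (HomV m n M) 0) :
    (φ : HomV m n M) - ev (phiProj hb φ) ∈ lowered m (HomV m n M) :=
  (Classical.skolem.1 fun φ : wtSpace m (HomV m n M) 0 => exists_sub_ev_mem hb φ.2).choose_spec φ

lemma phiProj_eq {φ : wtSpace m (HomV m n M) 0} {F : Phi m n M}
    (h : (φ : HomV m n M) - ev F ∈ lowered m (HomV m n M)) : phiProj hb φ = F :=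
  eq_of_ev_sub_mem hb (by
    have := Submodule.sub_mem _ h (phiProj_spec hb φ)
    rwa [sub_sub_sub_cancel_left] at this)

lemma phiProj_eq_zero_iff {φ : wtSpace m (HomV m n M) 0} :
    phiProj hb φ = 0 ↔ (φ : HomV m n M) ∈ lowered m (HomV m n M) := by
  refine ⟨fun h => ?_, fun h => phiProj_eq hb (by rwa [map_zero, sub_zero])⟩
  have := phiProj_spec hb φ
  rwa [h, map_zero, sub_zero] at this

/-- A congruence modulo lowered elements suffices, since `opX` preserves these. -/
lemma smul_phiProj_x (i : Fin n) (φ ψ : wtSpace m (HomV m n M) 0)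
    (h : opX M i (φ : HomV m n M) - (ψ : HomV m n M) ∈ lowered m (HomV m n M)) :
    ParHecke.x n Set.univ i • phiProj hb φ = phiProj hb ψ := by
  refine (phiProj_eq hb ?_).symm
  rw [ev_x_smul]
  have h1 := map_mem_lowered (opX_lie i) (phiProj_spec hb φ)
  have h2 := Submodule.sub_mem _ h1 h
  rwa [map_sub, sub_sub_sub_cancel_left] at h2

lemma smul_phiProj_s (i : ℕ) (hi : i + 1 < n) (φ ψ : wtSpace m (HomV m n M) 0)
    (h : opS M i hi (φ : HomV m n M) = (ψ : HomV m n M)) :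
    ParHecke.s n Set.univ i hi (Set.mem_univ i) • phiProj hb φ = phiProj hb ψ := by
  refine (phiProj_eq hb ?_).symm
  rw [ev_s_smul, ← h, ← map_sub]
  exact map_mem_lowered (opS_lie i hi) (phiProj_spec hb φ)

end Projection

/-! ### Hecke operators on elementary maps -/

section Words

variable {m n : ℕ} {M : Type*} [AddCommGroup M] [Module ℂ M] [Module (PS m) M]
  [LieRingModule (gl m) M] [IsBimodule m M]

lemma update_update_swap (b : Fin n → Fin m) {k i : Fin n} (hki : k ≠ i) :
    Function.update (Function.update b k (b i)) i (b k) = b ∘ Equiv.swap k i := by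
  funext l
  rw [Function.comp_apply]
  by_cases h1 : l = i
  · rw [h1, Function.update_self, Equiv.swap_apply_right]
  · rw [Function.update_of_ne h1]
    by_cases h2 : l = k
    · rw [h2, Function.update_self, Equiv.swap_apply_left]
    · rw [Function.update_of_ne h2, Equiv.swap_apply_of_ne_of_ne h2 h1]

lemma rmul_omV_el_eq (b : Fin n → Fin m) (k i : Fin n) (x : M) : rmul (omV k i) (el b x) =
    ∑ q, if Function.update b k q i = q then
      el (Function.update (Function.update b k q) i (b k)) x else 0 := by
  rw [rmul_omV, Finset.sum_eq_single (b k)]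
  · refine Finset.sum_congr rfl fun q _ => ?_
    rw [rmul_slotV_el, if_pos rfl, rmul_slotV_el]
  · intro p _ hp
    refine Finset.sum_eq_zero fun q _ => ?_
    rw [rmul_slotV_el, if_neg (Ne.symm hp), map_zero]
  · simp

lemma rmul_omV_el (b : Fin n → Fin m) {k i : Fin n} (hki : k ≠ i) (x : M) :
    rmul (omV k i) (el b x) = el (b ∘ Equiv.swap k i) x := by
  rw [rmul_omV_el_eq, Finset.sum_eq_single (b i)]
  · rw [Function.update_of_ne hki.symm, if_pos rfl, update_update_swap b hki]
  · intro q _ hq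
    rw [Function.update_of_ne hki.symm, if_neg (Ne.symm hq)]
  · simp

/-- In a single factor ∑ e_{pq} e_{qp} is the scalar m. This is the term k = i of the sum over all k
in `opX`. -/
lemma rmul_omV_el_self (b : Fin n → Fin m) (i : Fin n) (x : M) :
    rmul (omV i i) (el b x) = (m : PS m) • el b x := by
  rw [rmul_omV_el_eq, Finset.sum_congr rfl (g := fun _ => el b x)]
  · rw [Finset.sum_const, Finset.card_univ, Fintype.card_fin, Nat.cast_smul_eq_nsmul]
  · intro q _
    rw [if_pos (Function.update_self _ _ _), Function.update_idem, Function.update_eq_self]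

lemma opS_el (b : Fin n → Fin m) (i : ℕ) (h : i + 1 < n) (x : M) :
    opS M i h (el b x) = el (b ∘ Equiv.swap ⟨i, Nat.lt_of_succ_lt h⟩ ⟨i + 1, h⟩) x :=
  rmul_omV_el b (by simp) x

/-- The rewriting rule for elementary maps: when the first summand is lowered, a lowering operator
on the value may be replaced by changing single letters p of the word to q. -/
lemma el_lie (b : Fin n → Fin m) (p q : Fin m) (x : M) : el b ⁅(eu p q : gl m), x⁆ =
    ⁅(eu p q : gl m), el b x⁆ + ∑ k, if b k = p then el (Function.update b k q) x else 0 := by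
  rw [homV_lie, lmul_el, eq_comm, sub_add_eq_add_sub, sub_eq_iff_eq_add, add_right_inj]
  have : rmul (M := M) (∑ k, slotV m n k (eu p q)) = ∑ k, rmul (slotV m n k (eu p q)) := by
    refine LinearMap.ext fun φ => LinearMap.ext fun w => ?_
    rw [rmul_apply, LinearMap.sum_apply, map_sum, LinearMap.sum_apply, LinearMap.sum_apply]
    rfl
  rw [this, LinearMap.sum_apply]
  exact Finset.sum_congr rfl fun k _ => (rmul_slotV_el b k p q x).symm

lemma lie_el_mem_lowered {κ : Fin m → ℤ} {x : M} (hx : x ∈ wtSpace m M κ) {b : Fin n → Fin m}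
    {p q : Fin m} (hqp : q < p) (h : κ = root q p + wordWt b) :
    ⁅(eu p q : gl m), el b x⁆ ∈ lowered m (HomV m n M) :=
  lie_mem_lowered hqp (el_mem_wtSpace (h ▸ hx))

lemma casimir_el (b : Fin n → Fin m) (i : Fin n) (x : M) :
    (∑ p, ∑ q, lmul (eu p q) ∘ₗ rmul (slotV m n i (eu q p)) : HomV m n M →ₗ[PS m] HomV m n M) (el b x) =
      ∑ p, el (Function.update b i p) ⁅(eu p (b i) : gl m), x⁆ := by
  rw [LinearMap.sum_apply]
  refine Finset.sum_congr rfl fun p _ => ?_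
  rw [LinearMap.sum_apply, Finset.sum_eq_single (b i)]
  · rw [LinearMap.comp_apply, rmul_slotV_el, if_pos rfl, lmul_el]
  · intro q _ hq
    rw [LinearMap.comp_apply, rmul_slotV_el, if_neg (Ne.symm hq), map_zero]
  · simp

/-- The action of `x_i` on the elementary map given by a sorted word and a highest weight vector. -/
lemma opX_el_sub_mem {a : Fin n → Fin m} (ha : Monotone a) {x : M}
    (hx : x ∈ wtSpace m M (wordWt a)) (hx' : ∀ p q : Fin m, p < q → ⁅(eu p q : gl m), x⁆ = 0)
    (i : Fin n) : opX M i (el a x) - el a ((MvPowerSeries.C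
      ((((Finset.univ.filter fun k => k < i ∧ a k = a i).card : ℤ) - (a i : ℕ) : ℤ) : ℂ) +
        MvPowerSeries.X (a i) : PS m) • x) ∈ lowered m (HomV m n M) := by
  -- The maps G p are the values, modulo lowered elements, of the terms of the mixed Casimir sum.
  -- For p < a_i the highest weight vector is killed; for p = a_i it is multiplied by D. For p > a_i
  -- the operator is lowering, and `el_lie` replaces a letter p of the modified word by a_i: at i
  -- this restores a, and at another position k it gives the transposed word of E k.
  let E : Fin n → HomV m n M := fun k => el (a ∘ Equiv.swap k i) x
  let D : PS m := MvPowerSeries.C (wordWt a (a i) : ℂ) + MvPowerSeries.X (a i)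
  let G : Fin m → HomV m n M := fun p => (if p = a i then D • el a x else 0) +
    if a i < p then el a x + ∑ k ∈ Finset.univ.erase i, (if a k = p then E k else 0) else 0
  have hG : ∀ p, el (Function.update a i p) ⁅(eu p (a i) : gl m), x⁆ - G p ∈ lowered m (HomV m n M) := by
    intro p
    rcases lt_trichotomy p (a i) with h | h | h
    · simp only [G]
      rw [hx' _ _ h, map_zero, if_neg h.ne, if_neg h.not_gt, add_zero, sub_zero]
      exact Submodule.zero_mem _
    · simp only [G]
      rw [h, if_pos rfl, if_neg (lt_irrefl _), add_zero, Function.update_eq_self, mem_wtSpace.1 hx,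
        map_smul, sub_self]
      exact Submodule.zero_mem _
    · have h1 : (∑ k, if Function.update a i p k = p then
          el (Function.update (Function.update a i p) k (a i)) x else 0) = G p := by
        simp only [G]
        rw [← Finset.add_sum_erase _ _ (Finset.mem_univ i), Function.update_self, if_pos rfl,
          Function.update_idem, Function.update_eq_self, if_neg h.ne', if_pos h, zero_add]
        congr 1
        refine Finset.sum_congr rfl fun k hk => ?_
        have hk := Finset.ne_of_mem_erase hk
        rw [Function.update_of_ne hk]
        split_ifs with hp
        · rw [← hp, Function.update_comm hk.symm, update_update_swap a hk]
        · rfl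
      rw [el_lie, h1, add_sub_cancel_right]
      refine lie_el_mem_lowered hx h ?_
      rw [wordWt_update, root]
      abel
  have hcard : (wordWt a (a i) : ℤ) = (Finset.univ.filter fun k => k < i ∧ a k = a i).card + 1 +
      ((Finset.univ.erase i).filter fun k => i < k ∧ a k = a i).card := by
    have h1 : (Finset.univ.filter fun k => a k = a i) =
        insert i ((Finset.univ.filter fun k => k < i ∧ a k = a i) ∪
          ((Finset.univ.erase i).filter fun k => i < k ∧ a k = a i)) := by
      ext k
      simp only [Finset.mem_filter, Finset.mem_univ, true_and, Finset.mem_insert, Finset.mem_union,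
        Finset.mem_erase, and_true]
      constructor
      · intro hk
        rcases lt_trichotomy k i with h | h | h
        · exact Or.inr (Or.inl ⟨h, hk⟩)
        · exact Or.inl h
        · exact Or.inr (Or.inr ⟨h.ne', h, hk⟩)
      · rintro (h | h | h)
        · rw [h]
        · exact h.2
        · exact h.2.2
    unfold wordWt
    rw [h1, Finset.card_insert_of_notMem, Finset.card_union_of_disjoint]
    · push_cast; ring
    · rw [Finset.disjoint_left]
      intro k hk hk'
      exact absurd (Finset.mem_filter.1 hk).2.1 (Finset.mem_filter.1 hk').2.1.not_gt
    · simp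
  have hsum : ∑ p, G p = (D + ((m - 1 - (a i : ℕ) : ℕ) : PS m)) • el a x +
      ∑ k ∈ Finset.univ.erase i, if a i < a k then E k else 0 := by
    simp only [G]
    rw [Finset.sum_add_distrib, Finset.sum_ite_eq' Finset.univ (a i), if_pos (Finset.mem_univ _),
      add_smul D, add_assoc]
    congr 1
    rw [← Finset.sum_filter, Finset.sum_add_distrib, Finset.sum_const, Finset.sum_comm]
    congr 1
    · rw [Nat.cast_smul_eq_nsmul]
      congr 1
      rw [← Fin.card_Ioi]
      congr 1
      ext; simp
    · refine Finset.sum_congr rfl fun k _ => ?_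
      rw [Finset.sum_ite_eq]
      simp
  have h1 : (∑ k, rmul (omV k i)) (el a x) = (m : PS m) • el a x + ∑ k ∈ Finset.univ.erase i, E k := by
    rw [LinearMap.sum_apply, ← Finset.add_sum_erase _ _ (Finset.mem_univ i), rmul_omV_el_self]
    congr 1
    exact Finset.sum_congr rfl fun k hk => rmul_omV_el a (Finset.ne_of_mem_erase hk) x
  have h2 : (∑ k ∈ Finset.Iio i, rmul (omV k i)) (el a x) =
      ∑ k ∈ Finset.univ.erase i, if k < i then E k else 0 := by
    rw [LinearMap.sum_apply, ← Finset.sum_filter]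
    refine Finset.sum_congr ?_ fun k hk => rmul_omV_el a (Finset.mem_filter.1 hk).2.ne x
    ext k
    simp only [Finset.mem_Iio, Finset.mem_filter, Finset.mem_erase, Finset.mem_univ, and_true]
    exact ⟨fun h => ⟨h.ne, h⟩, fun h => h.2⟩
  -- Here sortedness of a is used. Positions k < i cancel since a_k ≤ a_i, positions k > i with a
  -- larger letter cancel too, and each later position with the same letter leaves one copy of -`el
  -- a x`.
  have h3 : (∑ k ∈ Finset.univ.erase i, if a i < a k then E k else 0) - (∑ k ∈ Finset.univ.erase i, E k) +
      (∑ k ∈ Finset.univ.erase i, if k < i then E k else 0) =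
      -((((Finset.univ.erase i).filter fun k => i < k ∧ a k = a i).card : PS m) • el a x) := by
    rw [← Finset.sum_sub_distrib, ← Finset.sum_add_distrib, Nat.cast_smul_eq_nsmul, ← Finset.sum_const,
      Finset.sum_filter, ← Finset.sum_neg_distrib]
    refine Finset.sum_congr rfl fun k hk => ?_
    rcases lt_or_gt_of_ne (Finset.ne_of_mem_erase hk) with h | h
    · rw [if_neg (ha h.le).not_gt, if_pos h, if_neg fun h' => h'.1.not_gt h]
      abel
    · rcases (ha h.le).lt_or_eq with h' | h'
      · rw [if_pos h', if_neg h.not_gt, if_neg fun h'' => h'.ne' h''.2]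
        abel
      · have hE : E k = el a x := by
          simp only [E]
          congr 1
          rw [← update_update_swap a h.ne', h', Function.update_eq_self, ← h', Function.update_eq_self]
        rw [if_neg h'.not_lt, if_neg h.not_gt, if_pos ⟨h, h'.symm⟩, hE]
        abel
  have key : opX M i (el a x) - el a ((MvPowerSeries.C
      ((((Finset.univ.filter fun k => k < i ∧ a k = a i).card : ℤ) - (a i : ℕ) : ℤ) : ℂ) +
        MvPowerSeries.X (a i) : PS m) • x) =
      ∑ p, (el (Function.update a i p) ⁅(eu p (a i) : gl m), x⁆ - G p) := by
    -- The truncated difference m - 1 - a_i is a true one because a_i < m; it counts the letters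
    -- larger than a_i.
    have hm : (m : PS m) = ((m - 1 - (a i : ℕ) : ℕ) : PS m) + ((a i : ℕ) : PS m) + 1 := by
      have h : m = (m - 1 - (a i : ℕ)) + (a i : ℕ) + 1 := by have := (a i).2; omega
      exact_mod_cast congrArg (Nat.cast (R := PS m)) h
    have hD : D = MvPowerSeries.C ((((Finset.univ.filter fun k => k < i ∧ a k = a i).card : ℤ) -
        (a i : ℕ) : ℤ) : ℂ) + MvPowerSeries.X (a i) + ((a i : ℕ) : PS m) + 1 +
        (((Finset.univ.erase i).filter fun k => i < k ∧ a k = a i).card : PS m) := by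
      simp only [D]
      rw [hcard]
      push_cast
      simp only [map_add, map_sub, map_one, map_natCast]
      ring
    rw [Finset.sum_sub_distrib, hsum, ← casimir_el, map_smul]
    unfold opX
    rw [LinearMap.add_apply, LinearMap.sub_apply, h1, h2, hD, hm]
    generalize (∑ k ∈ Finset.univ.erase i, if a i < a k then E k else 0) = S₁ at h3 ⊢
    generalize (∑ k ∈ Finset.univ.erase i, if k < i then E k else 0) = S₃ at h3 ⊢
    generalize (∑ k ∈ Finset.univ.erase i, E k) = S₂ at h3 ⊢
    rw [← eq_sub_iff_add_eq'] at h3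
    rw [h3]
    simp only [add_smul, one_smul]
    abel
  rw [key]
  exact Submodule.sum_mem _ fun p _ => hG p

end Words

/-! ### Spanning by highest weight vectors -/

section Span

variable {m n : ℕ} {M : Type*} [AddCommGroup M] [Module ℂ M] [Module (PS m) M]
  [LieRingModule (gl m) M] [IsBimodule m M] {wt : Fin m → ℤ} {v : M}

/-- Modulo lowered elements, the zero weight space is spanned by the elementary maps with values in
the highest weight space. -/
lemma IsHW.wtSpace_zero_le (h : IsHW m wt v) : wtSpace m (HomV m n M) 0 ≤
    lowered m (HomV m n M) ⊔
      Submodule.span (PS m) (Set.range fun b : {b : Fin n → Fin m // wordWt b = wt} => el b.1 v) := by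
  set Q := lowered m (HomV m n M) ⊔
      Submodule.span (PS m) (Set.range fun b : {b : Fin n → Fin m // wordWt b = wt} => el b.1 v)
  -- T κ collects the vectors of weight κ whose elementary maps already lie in Q. The sum of these
  -- spaces contains v and is stable under lowering by `el_lie`, so it is everything, and T κ is the
  -- full weight space.
  let T : (Fin m → ℤ) → Submodule (PS m) M := fun κ =>
    { carrier := {x | x ∈ wtSpace m M κ ∧ ∀ b : Fin n → Fin m, wordWt b = κ → el b x ∈ Q}
      zero_mem' := ⟨Submodule.zero_mem _, fun b _ => by rw [map_zero]; exact Submodule.zero_mem _⟩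
      add_mem' := fun hx hy => ⟨Submodule.add_mem _ hx.1 hy.1, fun b hb => by
        rw [map_add]; exact Submodule.add_mem _ (hx.2 b hb) (hy.2 b hb)⟩
      smul_mem' := fun r x hx => ⟨Submodule.smul_mem _ r hx.1, fun b hb => by
        rw [map_smul]; exact Submodule.smul_mem _ r (hx.2 b hb)⟩ }
  have hT : ∀ κ, T κ ≤ wtSpace m M κ := fun κ x hx => hx.1
  have htop : ⨆ κ, T κ = ⊤ := by
    refine h.eq_top (Submodule.mem_iSup_of_mem wt ⟨h.mem, fun b hb => ?_⟩) fun p q hqp w hw => ?_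
    · exact Submodule.mem_sup_right (Submodule.subset_span ⟨⟨b, hb⟩, rfl⟩)
    · induction hw using Submodule.iSup_induction' with
      | zero => rw [lie_zero]; exact Submodule.zero_mem _
      | add x y _ _ hx hy => rw [lie_add]; exact Submodule.add_mem _ hx hy
      | mem κ x hx =>
        refine Submodule.mem_iSup_of_mem (κ + root p q) ⟨eu_mem_wtSpace rfl hx.1, fun b hb => ?_⟩
        rw [el_lie]
        refine Submodule.add_mem _ (Submodule.mem_sup_left (lie_el_mem_lowered hx.1 hqp ?_))
          (Submodule.sum_mem _ fun k _ => ?_)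
        · rw [hb, root, root]; abel
        · split_ifs with hk
          · refine hx.2 _ ?_
            rw [wordWt_update, hb, hk, root]
            abel
          · exact Submodule.zero_mem _
  intro φ hφ
  rw [homV_eq_sum φ]
  refine Submodule.sum_mem _ fun b _ => ?_
  have h1 := homV_mem_wtSpace.1 hφ b
  rw [zero_add, ← wtSpace_eq_of_le hT htop] at h1
  exact h1.2 b rfl

end Span

/-! ### Linear independence by a trace argument -/

section Trace

variable {m n : ℕ} {M : Type*} [AddCommGroup M] [Module ℂ M] [Module (PS m) M]
  [LieRingModule (gl m) M] [IsBimodule m M]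

lemma sum_update (p q : Fin m) (k : Fin n) {A : Type*} [AddCommMonoid A]
    (f : (Fin n → Fin m) → (Fin n → Fin m) → A) :
    (∑ c, if c k = p then f (Function.update c k q) c else 0) =
      ∑ c, if c k = q then f c (Function.update c k p) else 0 := by
  rw [← Finset.sum_filter, ← Finset.sum_filter]
  refine Finset.sum_bij' (fun c _ => Function.update c k q) (fun c _ => Function.update c k p) ?_ ?_ ?_ ?_ ?_
  · intro c _
    simp
  · intro c _
    simp
  · intro c hc
    rw [Function.update_idem, ← (Finset.mem_filter.1 hc).2, Function.update_eq_self]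
  · intro c hc
    rw [Function.update_idem, ← (Finset.mem_filter.1 hc).2, Function.update_eq_self]
  · intro c hc
    rw [Function.update_idem, ← (Finset.mem_filter.1 hc).2, Function.update_eq_self]

/-- Elementary maps with values in multiples of a vector `v` are linearly independent modulo
lowered elements, if there is an equivariant map that sends `v` to any given word. -/
lemma mem_of_sum_el_mem_lowered {v : M} {I : Ideal (PS m)}
    (hψ : ∀ b : Fin n → Fin m, ∃ ψ : (Fin n → Fin m) → M →ₗ[PS m] PS m ⧸ I,
      (∀ c, ψ c v = if c = b then 1 else 0) ∧
      ∀ (p q : Fin m), q < p → ∀ c x, ψ c ⁅(eu p q : gl m), x⁆ =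
        ∑ k, if c k = p then ψ (Function.update c k q) x else 0)
    {p : (Fin n → Fin m) → Prop} [Fintype {b // p b}] {r : {b // p b} → PS m}
    (h : ∑ b, el b.1 (r b • v) ∈ lowered m (HomV m n M)) (b : {b // p b}) : r b ∈ I := by
  obtain ⟨ψ, h1, h2⟩ := hψ b.1
  -- The family ψ is the coordinates of an 𝔫⁻-equivariant map from M to the tensor power over R/I,
  -- and τ is the trace of its composite with φ. A lowered element gives a sum of commutators, which
  -- have trace 0.
  let τ : HomV m n M →ₗ[PS m] PS m ⧸ I := ∑ c, ψ c ∘ₗ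
    { toFun := fun φ => φ (wordVec c)
      map_add' := fun φ φ' => rfl
      map_smul' := fun r φ => rfl }
  have hτ : ∀ φ, τ φ = ∑ c, ψ c (φ (wordVec c)) := fun φ => by
    simp only [τ, LinearMap.sum_apply]
    rfl
  have hlow : lowered m (HomV m n M) ≤ LinearMap.ker τ := lowered_le_iff.2 fun p q hpq φ _ => by
    change τ ⁅(eu q p : gl m), φ⁆ = 0
    rw [hτ]
    have e : ∀ c, ψ c (⁅(eu q p : gl m), φ⁆ (wordVec c)) =
        (∑ k, if c k = q then ψ (Function.update c k p) (φ (wordVec c)) else 0) -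
        ∑ k, if c k = p then ψ c (φ (wordVec (Function.update c k q))) else 0 := fun c => by
      rw [homV_lie_apply, map_sub, h2 q p hpq, LinearMap.sum_apply, map_sum, map_sum]
      congr 1
      refine Finset.sum_congr rfl fun k _ => ?_
      rw [slotV_wordVec]
      split_ifs
      · rfl
      · rw [map_zero, map_zero]
    simp only [e]
    -- The remaining identity is tr(AB) = tr(BA) for one tensor factor, in the form of the
    -- reindexing `sum_update`.
    rw [Finset.sum_sub_distrib, Finset.sum_comm, Finset.sum_comm (s := Finset.univ (α := Fin n → Fin m)),
      sub_eq_zero]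
    refine Finset.sum_congr rfl fun k _ => ?_
    exact sum_update q p k fun c d => ψ c (φ (wordVec d))
  have hel : ∀ c : {b // p b}, τ (el c.1 (r c • v)) =
      if b = c then Ideal.Quotient.mk I (r c) else 0 := fun c => by
    rw [hτ, Finset.sum_eq_single c.1]
    · rw [el_wordVec, if_pos rfl, map_smul, h1]
      simp only [← Subtype.ext_iff, eq_comm (a := c)]
      split_ifs
      · rw [← Ideal.Quotient.algebraMap_eq, Algebra.algebraMap_eq_smul_one]
      · rw [smul_zero]
    · intro d _ hd
      rw [el_wordVec, if_neg hd, map_zero]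
    · simp
  have h3 := hlow h
  rw [LinearMap.mem_ker, map_sum] at h3
  simp only [hel] at h3
  rw [Finset.sum_ite_eq, if_pos (Finset.mem_univ b)] at h3
  exact Ideal.Quotient.eq_zero_iff_mem.1 h3

end Trace

end ArakawaSuzuki

namespace ArakawaSuzuki

/-! ### Sorting words by adjacent transpositions -/

section WordSwap

variable {m n : ℕ}

/-- The word in which the letters at the positions `i` and `i + 1` are exchanged. -/
def wordSwap (i : ℕ) (hi : i + 1 < n) (b : Fin n → Fin m) : Fin n → Fin m :=
  b ∘ Equiv.swap ⟨i, Nat.lt_of_succ_lt hi⟩ ⟨i + 1, hi⟩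

lemma wordSwap_left (i : ℕ) (hi : i + 1 < n) (b : Fin n → Fin m) :
    wordSwap i hi b ⟨i, Nat.lt_of_succ_lt hi⟩ = b ⟨i + 1, hi⟩ := by
  rw [wordSwap, Function.comp_apply, Equiv.swap_apply_left]

lemma wordSwap_right (i : ℕ) (hi : i + 1 < n) (b : Fin n → Fin m) :
    wordSwap i hi b ⟨i + 1, hi⟩ = b ⟨i, Nat.lt_of_succ_lt hi⟩ := by
  rw [wordSwap, Function.comp_apply, Equiv.swap_apply_right]

lemma wordSwap_of_ne (i : ℕ) (hi : i + 1 < n) (b : Fin n → Fin m) {k : ℕ} (hk : k < n) (h : k ≠ i)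
    (h' : k ≠ i + 1) : wordSwap i hi b ⟨k, hk⟩ = b ⟨k, hk⟩ := by
  rw [wordSwap, Function.comp_apply, Equiv.swap_apply_of_ne_of_ne] <;> simpa

lemma wordSwap_wordSwap (i : ℕ) (hi : i + 1 < n) (b : Fin n → Fin m) :
    wordSwap i hi (wordSwap i hi b) = b := by
  funext k
  simp [wordSwap]

lemma wordSwap_eq_self (i : ℕ) (hi : i + 1 < n) {b : Fin n → Fin m}
    (h : b ⟨i + 1, hi⟩ = b ⟨i, Nat.lt_of_succ_lt hi⟩) : wordSwap i hi b = b := by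
  funext k
  rw [wordSwap, Function.comp_apply, Equiv.swap_apply_def]
  split_ifs with h1 h2
  · rw [h1, h]
  · rw [h2, h]
  · rfl

lemma wordSwap_comm {i j : ℕ} (hi : i + 1 < n) (hj : j + 1 < n) (hij : i + 1 < j ∨ j + 1 < i)
    (b : Fin n → Fin m) : wordSwap i hi (wordSwap j hj b) = wordSwap j hj (wordSwap i hi b) := by
  unfold wordSwap
  rw [Function.comp_assoc, Function.comp_assoc, ← Equiv.Perm.coe_mul, ← Equiv.Perm.coe_mul]
  congr 2
  refine (Equiv.Perm.Disjoint.commute ?_).eq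
  rw [Equiv.Perm.disjoint_iff_disjoint_support, Equiv.Perm.support_swap (by simp),
    Equiv.Perm.support_swap (by simp)]
  rw [Finset.disjoint_left]
  intro k hk hk'
  simp only [Finset.mem_insert, Finset.mem_singleton, Fin.ext_iff] at hk hk'
  omega

lemma wordSwap_braid {i : ℕ} (hi : i + 1 < n) (hi' : i + 1 + 1 < n) (b : Fin n → Fin m) :
    wordSwap i hi (wordSwap (i + 1) hi' (wordSwap i hi b)) =
      wordSwap (i + 1) hi' (wordSwap i hi (wordSwap (i + 1) hi' b)) := by
  unfold wordSwap
  simp only [Function.comp_assoc]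
  rw [← Equiv.Perm.coe_mul, ← Equiv.Perm.coe_mul, ← Equiv.Perm.coe_mul, ← Equiv.Perm.coe_mul]
  congr 2
  rw [← mul_assoc, ← mul_assoc, Equiv.swap_mul_swap_mul_swap (by simp) (by simp; omega),
    Equiv.swap_comm (⟨i, _⟩ : Fin n) ⟨i + 1, _⟩, Equiv.swap_comm (⟨i + 1, _⟩ : Fin n) ⟨i + 1 + 1, _⟩,
    Equiv.swap_mul_swap_mul_swap (by simp) (by simp; omega), Equiv.swap_comm]

/-- Removing a descent decreases the word lexicographically. This makes the recursion of `wordElt`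
terminate and drives the inductions on words. -/
lemma wordSwap_lt {i : ℕ} (hi : i + 1 < n) {b : Fin n → Fin m}
    (h : b ⟨i + 1, hi⟩ < b ⟨i, Nat.lt_of_succ_lt hi⟩) : toLex (wordSwap i hi b) < toLex b :=
  Pi.lex_desc (Fin.mk_le_mk.2 (Nat.le_succ i)) h

lemma monotone_of_no_descent {b : Fin n → Fin m}
    (h : ∀ (i : ℕ) (hi : i + 1 < n), ¬ b ⟨i + 1, hi⟩ < b ⟨i, Nat.lt_of_succ_lt hi⟩) : Monotone b := by
  cases n with
  | zero => exact fun i => i.elim0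
  | succ n => exact Fin.monotone_iff_le_succ.2 fun i => not_lt.1 (h i (by have := i.2; omega))

end WordSwap

/-! ### Elements of a Hecke module indexed by words -/

section WordElt

variable {m n : ℕ} {D : Type*} [AddCommGroup D] [Module (Hecke n) D]

/-- The element `s_i` of the Hecke algebra. -/
noncomputable abbrev hs (i : ℕ) (hi : i + 1 < n) : Hecke n :=
  ParHecke.s n Set.univ i hi (Set.mem_univ i)

lemma hs_hs (i : ℕ) (hi : i + 1 < n) (y : D) : hs i hi • hs i hi • y = y := by
  rw [← mul_smul, (ParHecke.relations n Set.univ).s_sq, one_smul]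

lemma hs_braid (i : ℕ) (hi : i + 1 < n) (hi' : i + 1 + 1 < n) (y : D) :
    hs i hi • hs (i + 1) hi' • hs i hi • y = hs (i + 1) hi' • hs i hi • hs (i + 1) hi' • y := by
  simp only [← mul_smul]
  congr 1
  rw [← mul_assoc, ← mul_assoc, (ParHecke.relations n Set.univ).braid]

lemma hs_comm {i j : ℕ} (hi : i + 1 < n) (hj : j + 1 < n) (hij : i + 1 < j ∨ j + 1 < i) (y : D) :
    hs i hi • hs j hj • y = hs j hj • hs i hi • y := by
  rw [← mul_smul, ← mul_smul, (ParHecke.relations n Set.univ).s_comm i hi _ j hj _ hij]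

open Classical in
/-- The element obtained from `d` by the simple transpositions that sort the word `b`. -/
noncomputable def wordElt (d : D) (b : Fin n → Fin m) : D :=
  if h : ∃ (i : ℕ) (hi : i + 1 < n), b ⟨i + 1, hi⟩ < b ⟨i, Nat.lt_of_succ_lt hi⟩ then
    hs h.choose h.choose_spec.choose • wordElt d (wordSwap h.choose h.choose_spec.choose b)
  else d
termination_by (wellFounded_lt (α := Lex (Fin n → Fin m))).wrap (toLex b)
decreasing_by exact wordSwap_lt _ h.choose_spec.choose_spec

lemma wordElt_of_monotone (d : D) {b : Fin n → Fin m} (hb : Monotone b) : wordElt d b = d := by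
  rw [wordElt, dif_neg]
  rintro ⟨i, hi, h⟩
  exact h.not_ge (hb (Fin.mk_le_mk.2 (Nat.le_succ i)))

lemma exists_wordElt_eq (d : D) {b : Fin n → Fin m} {i : ℕ} (hi : i + 1 < n)
    (h : b ⟨i + 1, hi⟩ < b ⟨i, Nat.lt_of_succ_lt hi⟩) :
    ∃ (j : ℕ) (hj : j + 1 < n), b ⟨j + 1, hj⟩ < b ⟨j, Nat.lt_of_succ_lt hj⟩ ∧
      wordElt d b = hs j hj • wordElt d (wordSwap j hj b) := by
  have h' : ∃ (i : ℕ) (hi : i + 1 < n), b ⟨i + 1, hi⟩ < b ⟨i, Nat.lt_of_succ_lt hi⟩ := ⟨i, hi, h⟩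
  refine ⟨h'.choose, h'.choose_spec.choose, h'.choose_spec.choose_spec, ?_⟩
  rw [wordElt, dif_pos h']

/-- The definition of `wordElt` sorts along an arbitrarily chosen descent, so independence of the
choice must be proved. Two descents are compared after one more step each: distant ones commute, and
adjacent ones are joined by the braid relation. The second claim, invariance under s_i for equal
neighbours, is carried along in the same induction. -/
lemma wordElt_spec {a : Fin n → Fin m} (ha : Monotone a) {d : D}
    (hd : ∀ (i : ℕ) (hi : i + 1 < n), a ⟨i + 1, hi⟩ = a ⟨i, Nat.lt_of_succ_lt hi⟩ → hs i hi • d = d)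
    (b : Fin n → Fin m) (hb : ∃ σ : Equiv.Perm (Fin n), b = a ∘ σ) :
    (∀ (i : ℕ) (hi : i + 1 < n), b ⟨i + 1, hi⟩ < b ⟨i, Nat.lt_of_succ_lt hi⟩ →
      wordElt d b = hs i hi • wordElt d (wordSwap i hi b)) ∧
    ∀ (i : ℕ) (hi : i + 1 < n), b ⟨i + 1, hi⟩ = b ⟨i, Nat.lt_of_succ_lt hi⟩ →
      hs i hi • wordElt d b = wordElt d b := by
  induction hl : toLex b using WellFoundedLT.induction generalizing b with
  | ind l ih =>
  subst hl
  have hW : ∀ (i : ℕ) (hi : i + 1 < n) (c : Fin n → Fin m), (∃ σ : Equiv.Perm (Fin n), c = a ∘ σ) →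
      ∃ σ : Equiv.Perm (Fin n), wordSwap i hi c = a ∘ σ := by
    rintro i hi c ⟨σ, rfl⟩
    exact ⟨σ * Equiv.swap _ _, rfl⟩
  have ih1 : ∀ (c : Fin n → Fin m), toLex c < toLex b → (∃ σ : Equiv.Perm (Fin n), c = a ∘ σ) →
      ∀ (i : ℕ) (hi : i + 1 < n), c ⟨i + 1, hi⟩ < c ⟨i, Nat.lt_of_succ_lt hi⟩ →
      wordElt d c = hs i hi • wordElt d (wordSwap i hi c) := fun c h hc => (ih _ h c hc rfl).1
  have ih2 : ∀ (c : Fin n → Fin m), toLex c < toLex b → (∃ σ : Equiv.Perm (Fin n), c = a ∘ σ) →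
      ∀ (i : ℕ) (hi : i + 1 < n), c ⟨i + 1, hi⟩ = c ⟨i, Nat.lt_of_succ_lt hi⟩ →
      hs i hi • wordElt d c = wordElt d c := fun c h hc => (ih _ h c hc rfl).2
  -- Two adjacent descents mean three strictly decreasing letters; the two ways of sorting them are
  -- the two sides of the braid relation.
  have hadj : ∀ (k : ℕ) (hk : k + 1 < n) (hk' : k + 1 + 1 < n),
      b ⟨k + 1, hk⟩ < b ⟨k, Nat.lt_of_succ_lt hk⟩ → b ⟨k + 1 + 1, hk'⟩ < b ⟨k + 1, hk⟩ →
      hs k hk • wordElt d (wordSwap k hk b) = hs (k + 1) hk' • wordElt d (wordSwap (k + 1) hk' b) := by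
    intro k hk hk' h1 h2
    have e1 := wordSwap_lt hk h1
    have e2 := wordSwap_lt (b := b) hk' h2
    have f1 : wordSwap k hk b ⟨k + 1 + 1, hk'⟩ < wordSwap k hk b ⟨k + 1, hk⟩ := by
      rw [wordSwap_right, wordSwap_of_ne _ _ _ _ (by omega) (by omega)]
      exact h2.trans h1
    have f2 : wordSwap (k + 1) hk' b ⟨k + 1, hk⟩ < wordSwap (k + 1) hk' b ⟨k, Nat.lt_of_succ_lt hk⟩ := by
      rw [wordSwap_left, wordSwap_of_ne _ _ _ _ (by omega) (by omega)]
      exact h2.trans h1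
    have g1 : wordSwap (k + 1) hk' (wordSwap k hk b) ⟨k + 1, hk⟩ <
        wordSwap (k + 1) hk' (wordSwap k hk b) ⟨k, Nat.lt_of_succ_lt hk⟩ := by
      rw [wordSwap_left, wordSwap_of_ne _ _ _ _ (by omega) (by omega),
        wordSwap_of_ne _ _ _ _ (by omega) (by omega), wordSwap_left]
      exact h2
    have g2 : wordSwap k hk (wordSwap (k + 1) hk' b) ⟨k + 1 + 1, hk'⟩ <
        wordSwap k hk (wordSwap (k + 1) hk' b) ⟨k + 1, hk⟩ := by
      rw [wordSwap_right, wordSwap_of_ne _ _ _ _ (by omega) (by omega), wordSwap_right,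
        wordSwap_of_ne _ _ _ _ (by omega) (by omega)]
      exact h1
    rw [ih1 _ e1 (hW _ _ _ hb) (k + 1) hk' f1,
      ih1 _ ((wordSwap_lt hk' f1).trans e1) (hW _ _ _ (hW _ _ _ hb)) k hk g1,
      ih1 _ e2 (hW _ _ _ hb) k hk f2,
      ih1 _ ((wordSwap_lt hk f2).trans e2) (hW _ _ _ (hW _ _ _ hb)) (k + 1) hk' g2,
      hs_braid, wordSwap_braid]
  have far : ∀ {i j : ℕ} (hi : i + 1 < n) (hj : j + 1 < n), i + 1 < j ∨ j + 1 < i →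
      ∀ c : Fin n → Fin m, wordSwap j hj c ⟨i + 1, hi⟩ = c ⟨i + 1, hi⟩ ∧
        wordSwap j hj c ⟨i, Nat.lt_of_succ_lt hi⟩ = c ⟨i, Nat.lt_of_succ_lt hi⟩ :=
    fun hi hj hij c => ⟨wordSwap_of_ne _ _ _ _ (by omega) (by omega),
      wordSwap_of_ne _ _ _ _ (by omega) (by omega)⟩
  refine ⟨fun i hi h => ?_, fun i hi h => ?_⟩
  · obtain ⟨j, hj, hdj, hEj⟩ := exists_wordElt_eq d hi h
    rw [hEj]
    have hcases : i = j ∨ (i + 1 < j ∨ j + 1 < i) ∨ j = i + 1 ∨ i = j + 1 := by omega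
    rcases hcases with rfl | hij | rfl | rfl
    · rfl
    · have e1 := far hi hj hij b
      have e2 := far hj hi hij.symm b
      rw [ih1 _ (wordSwap_lt hj hdj) (hW _ _ _ hb) i hi (by rw [e1.1, e1.2]; exact h),
        ih1 _ (wordSwap_lt hi h) (hW _ _ _ hb) j hj (by rw [e2.1, e2.2]; exact hdj),
        hs_comm hj hi hij.symm, wordSwap_comm hi hj hij]
    · exact (hadj i hi hj h hdj).symm
    · exact hadj j hj hi hdj h
  · by_cases hdesc : ∃ (j : ℕ) (hj : j + 1 < n), b ⟨j + 1, hj⟩ < b ⟨j, Nat.lt_of_succ_lt hj⟩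
    · obtain ⟨j', hj', h'⟩ := hdesc
      obtain ⟨j, hj, hdj, hEj⟩ := exists_wordElt_eq d hj' h'
      rw [hEj]
      have hlt := wordSwap_lt hj hdj
      have hcases : i = j ∨ (i + 1 < j ∨ j + 1 < i) ∨ j = i + 1 ∨ i = j + 1 := by omega
      rcases hcases with rfl | hij | rfl | rfl
      · exact absurd h hdj.ne
      · have e1 := far hi hj hij b
        rw [hs_comm hi hj hij, ih2 _ hlt (hW _ _ _ hb) i hi (by rw [e1.1, e1.2]; exact h)]
      -- Here the pattern is two equal letters followed by a smaller one. After two exchanges the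
      -- equal letters occupy the last two of the three positions, and the braid relation carries
      -- the invariance over from there.
      · have f : wordSwap (i + 1) hj b ⟨i + 1, hi⟩ <
            wordSwap (i + 1) hj b ⟨i, Nat.lt_of_succ_lt hi⟩ := by
          rw [wordSwap_left, wordSwap_of_ne _ _ _ _ (by omega) (by omega), ← h]
          exact hdj
        rw [ih1 _ hlt (hW _ _ _ hb) i hi f, hs_braid,
          ih2 _ ((wordSwap_lt hi f).trans hlt) (hW _ _ _ (hW _ _ _ hb)) (i + 1) hj]
        rw [wordSwap_right, wordSwap_of_ne _ _ _ _ (by omega) (by omega), wordSwap_right,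
          wordSwap_of_ne _ _ _ _ (by omega) (by omega), h]
      · have f : wordSwap j hj b ⟨j + 1 + 1, hi⟩ < wordSwap j hj b ⟨j + 1, hj⟩ := by
          rw [wordSwap_right, wordSwap_of_ne _ _ _ _ (by omega) (by omega), h]
          exact hdj
        rw [ih1 _ hlt (hW _ _ _ hb) (j + 1) hi f, ← hs_braid,
          ih2 _ ((wordSwap_lt hi f).trans hlt) (hW _ _ _ (hW _ _ _ hb)) j hj]
        rw [wordSwap_left, wordSwap_of_ne _ _ _ _ (by omega) (by omega),
          wordSwap_of_ne _ _ _ _ (by omega) (by omega), wordSwap_left, h]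
    · push Not at hdesc
      have hmono := monotone_of_no_descent fun i hi => (hdesc i hi).not_gt
      obtain ⟨σ, rfl⟩ := hb
      -- A sorted rearrangement of a is a itself, so the hypothesis on d applies.
      have h1 : a ∘ σ = a := Tuple.unique_monotone (σ := σ) (τ := 1) hmono ha
      rw [wordElt_of_monotone d hmono]
      exact hd i hi (by rwa [h1] at h)

/-- The simple transpositions permute the elements `wordElt d b`. -/
lemma hs_wordElt {a : Fin n → Fin m} (ha : Monotone a) {d : D}
    (hd : ∀ (i : ℕ) (hi : i + 1 < n), a ⟨i + 1, hi⟩ = a ⟨i, Nat.lt_of_succ_lt hi⟩ → hs i hi • d = d)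
    {b : Fin n → Fin m} (hb : ∃ σ : Equiv.Perm (Fin n), b = a ∘ σ) (i : ℕ) (hi : i + 1 < n) :
    hs i hi • wordElt d b = wordElt d (wordSwap i hi b) := by
  rcases lt_trichotomy (b ⟨i + 1, hi⟩) (b ⟨i, Nat.lt_of_succ_lt hi⟩) with h | h | h
  · rw [(wordElt_spec ha hd b hb).1 i hi h, hs_hs]
  · rw [wordSwap_eq_self i hi h, (wordElt_spec ha hd b hb).2 i hi h]
  · obtain ⟨σ, rfl⟩ := hb
    rw [(wordElt_spec ha hd (wordSwap i hi (a ∘ σ)) ⟨σ * Equiv.swap _ _, rfl⟩).1 i hi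
      (by rwa [wordSwap_left, wordSwap_right]), wordSwap_wordSwap]

/-- Induction on the words with the same letters as a sorted word `a`. -/
lemma word_induction {a : Fin n → Fin m} (ha : Monotone a) {P : (Fin n → Fin m) → Prop} (h0 : P a)
    (hs : ∀ (b : Fin n → Fin m), (∃ σ : Equiv.Perm (Fin n), b = a ∘ σ) → ∀ (i : ℕ) (hi : i + 1 < n),
      P b → P (wordSwap i hi b)) (b : Fin n → Fin m) (hb : ∃ σ : Equiv.Perm (Fin n), b = a ∘ σ) : P b := by
  induction hl : toLex b using WellFoundedLT.induction generalizing b with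
  | ind l ih =>
  subst hl
  by_cases hdesc : ∃ (j : ℕ) (hj : j + 1 < n), b ⟨j + 1, hj⟩ < b ⟨j, Nat.lt_of_succ_lt hj⟩
  · obtain ⟨j, hj, h⟩ := hdesc
    obtain ⟨σ, rfl⟩ := hb
    have hc : ∃ τ : Equiv.Perm (Fin n), wordSwap j hj (a ∘ σ) = a ∘ τ := ⟨σ * Equiv.swap _ _, rfl⟩
    have := hs _ hc j hj (ih _ (wordSwap_lt hj h) _ hc rfl)
    rwa [wordSwap_wordSwap] at this
  · push Not at hdesc
    obtain ⟨σ, rfl⟩ := hb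
    have h1 : a ∘ σ = a := Tuple.unique_monotone (σ := σ) (τ := 1)
      (monotone_of_no_descent fun i hi => (hdesc i hi).not_gt) ha
    rwa [h1]

lemma exists_perm_of_wordWt {a b : Fin n → Fin m} (h : wordWt b = wordWt a) :
    ∃ σ : Equiv.Perm (Fin n), b = a ∘ σ := by
  have e : ∀ i, Nonempty ({k // b k = i} ≃ {k // a k = i}) := fun i => by
    refine ⟨Fintype.equivOfCardEq ?_⟩
    rw [Fintype.card_subtype, Fintype.card_subtype]
    exact Int.ofNat_inj.1 (congrFun h i)
  have f := fun i => (e i).some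
  refine ⟨(Equiv.sigmaFiberEquiv b).symm.trans
    ((Equiv.sigmaCongrRight f).trans (Equiv.sigmaFiberEquiv a)), funext fun k => ?_⟩
  exact (f (b k) ⟨k, rfl⟩).2.symm

lemma wordWt_comp (a : Fin n → Fin m) (σ : Equiv.Perm (Fin n)) : wordWt (a ∘ σ) = wordWt a := by
  funext i
  unfold wordWt
  congr 1
  exact Finset.card_equiv σ (by simp)

end WordElt

end ArakawaSuzuki

namespace ArakawaSuzuki

/-! ### Generators of the induced module -/

section Spanning

variable {m n : ℕ} {S : Type*} [CommRing S] [Algebra ℂ S] {J : Set ℕ} (χ : ParHecke n J →ₐ[ℂ] S)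

/-- The generator of the induced module. -/
noncomputable def indGen : Ind (ParHecke.toHecke n J) χ := Ind.mk _ _ 1 1

lemma smul_smul_indGen (h : Hecke n) (r : S) : r • h • indGen χ = Ind.mk _ _ h r := by
  rw [indGen, Ind.smul_mk, mul_one, Ind.smul_mk', mul_one]

lemma toHecke_smul_indGen (u : ParHecke n J) :
    ParHecke.toHecke n J u • indGen χ = χ u • indGen χ := by
  rw [indGen, Ind.smul_mk, Ind.smul_mk', mul_one, ← one_mul (ParHecke.toHecke n J u), Ind.mk_mul]

lemma toHecke_x (i : Fin n) : ParHecke.toHecke n J (ParHecke.x n J i) = ParHecke.x n Set.univ i :=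
  ParHecke.lift_x _ i

lemma toHecke_s (i : ℕ) (hi : i + 1 < n) (hJ : i ∈ J) :
    ParHecke.toHecke n J (ParHecke.s n J i hi hJ) = hs i hi :=
  ParHecke.lift_s _ i hi hJ

/-- The correction term is an integer multiple of y, hence stays in any span that contains y. Thus
stability under the x_k passes from a word to its neighbours. -/
lemma x_smul_hs_smul {D : Type*} [AddCommGroup D] [Module (Hecke n) D] (k : Fin n) (i : ℕ)
    (hi : i + 1 < n) (y : D) : ∃ (l : Fin n) (c : ℤ),
      ParHecke.x n Set.univ k • hs i hi • y = hs i hi • ParHecke.x n Set.univ l • y + c • y := by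
  have R := ParHecke.relations n Set.univ
  by_cases h1 : (k : ℕ) = i + 1
  · refine ⟨⟨i, Nat.lt_of_succ_lt hi⟩, 1, ?_⟩
    obtain rfl : k = ⟨i + 1, hi⟩ := Fin.ext h1
    rw [← mul_smul, R.x_succ_s i hi, add_smul, mul_smul, one_smul, one_smul]
  · by_cases h2 : (k : ℕ) = i
    · refine ⟨⟨i + 1, hi⟩, -1, ?_⟩
      obtain rfl : k = ⟨i, Nat.lt_of_succ_lt hi⟩ := Fin.ext h2
      have h := congrArg (fun z => hs i hi • z • hs i hi • y) (R.x_succ_s i hi (Set.mem_univ i))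
      simp only [add_smul, one_smul, mul_smul, smul_add, hs_hs] at h
      rw [h, neg_smul, one_smul, add_neg_cancel_right]
    · refine ⟨k, 0, ?_⟩
      rw [← mul_smul, R.x_s i hi _ k h2 h1, mul_smul, zero_smul, add_zero]

variable {χ} {a : Fin n → Fin m}

/-- The induced module is spanned by the elements indexed by the permutations of the word `a`. -/
lemma span_wordElt (ha : Monotone a)
    (hd : ∀ (i : ℕ) (hi : i + 1 < n), a ⟨i + 1, hi⟩ = a ⟨i, Nat.lt_of_succ_lt hi⟩ →
      hs i hi • indGen χ = indGen χ) :
    Submodule.span S (Set.range fun b : {b : Fin n → Fin m // wordWt b = wordWt a} =>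
      wordElt (indGen χ) b.1) = ⊤ := by
  set L := Submodule.span S (Set.range fun b : {b : Fin n → Fin m // wordWt b = wordWt a} =>
      wordElt (indGen χ) b.1)
  have hmem : ∀ b : Fin n → Fin m, (∃ σ : Equiv.Perm (Fin n), b = a ∘ σ) → wordElt (indGen χ) b ∈ L := by
    rintro b ⟨σ, rfl⟩
    exact Submodule.subset_span ⟨⟨_, wordWt_comp a σ⟩, rfl⟩
  have hstab : ∀ u : Hecke n, (∀ b : Fin n → Fin m, (∃ σ : Equiv.Perm (Fin n), b = a ∘ σ) →
      u • wordElt (indGen χ) b ∈ L) → ∀ y ∈ L, u • y ∈ L := by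
    intro u hu y hy
    induction hy using Submodule.span_induction with
    | mem y hy =>
      obtain ⟨b, rfl⟩ := hy
      exact hu b.1 (exists_perm_of_wordWt b.2)
    | zero => rw [smul_zero]; exact Submodule.zero_mem _
    | add x y _ _ hx hy => rw [smul_add]; exact Submodule.add_mem _ hx hy
    | smul r y _ hy => rw [smul_comm]; exact Submodule.smul_mem _ r hy
  have hsL : ∀ (i : ℕ) (hi : i + 1 < n), ∀ y ∈ L, hs i hi • y ∈ L := fun i hi =>
    hstab _ fun b hb => by
      rw [hs_wordElt ha hd hb]
      obtain ⟨σ, rfl⟩ := hb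
      exact hmem _ ⟨σ * Equiv.swap _ _, rfl⟩
  -- At the sorted word the x_k act by scalars of S, because the element is the generator of the
  -- induced module; other words are reached by adjacent exchanges.
  have hxL : ∀ b : Fin n → Fin m, (∃ σ : Equiv.Perm (Fin n), b = a ∘ σ) →
      ∀ k, ParHecke.x n Set.univ k • wordElt (indGen χ) b ∈ L := by
    refine word_induction ha (fun k => ?_) fun b hb i hi ih k => ?_
    · rw [wordElt_of_monotone _ ha, ← toHecke_x (J := J), toHecke_smul_indGen]
      refine Submodule.smul_mem _ _ ?_
      have := hmem a ⟨1, rfl⟩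
      rwa [wordElt_of_monotone _ ha] at this
    · rw [← hs_wordElt ha hd hb]
      obtain ⟨l, c, h⟩ := x_smul_hs_smul k i hi (wordElt (indGen χ) b)
      rw [h]
      exact Submodule.add_mem _ (hsL i hi _ (ih l)) (zsmul_mem (hmem b hb) c)
  have hL : ∀ u : Hecke n, ∀ y ∈ L, u • y ∈ L := fun u => by
    induction u using parHecke_induction with
    | halg c =>
      intro y hy
      rw [algebraMap_smul, ← algebraMap_smul S]
      exact Submodule.smul_mem _ _ hy
    | hx i => exact hstab _ fun b hb => hxL b hb i
    | hs i h hJ => exact hsL i h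
    | hadd u u' hu hu' =>
      intro y hy
      rw [add_smul]
      exact Submodule.add_mem _ (hu y hy) (hu' y hy)
    | hmul u u' hu hu' =>
      intro y hy
      rw [mul_smul]
      exact hu _ (hu' y hy)
  refine eq_top_iff.2 fun y _ => ?_
  induction y using Ind.induction with
  | h0 => exact Submodule.zero_mem _
  | hadd x y hx hy => exact Submodule.add_mem _ (hx trivial) (hy trivial)
  | hmk h r =>
    rw [← smul_smul_indGen]
    refine Submodule.smul_mem _ r (hL h _ ?_)
    have := hmem a ⟨1, rfl⟩
    rwa [wordElt_of_monotone _ ha] at this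

end Spanning

/-! ### The comparison map from the induced module to the functor -/

section Comparison

variable {m n : ℕ} {S : Type*} [CommRing S] [Algebra ℂ S] {J : Set ℕ} {χ : ParHecke n J →ₐ[ℂ] S}
  {a : Fin n → Fin m} {M : Type*} [AddCommGroup M] [Module ℂ M] [Module (PS m) M]
  [LieRingModule (gl m) M] [IsBimodule m M] {v : M}

lemma IsHW.el_mem (hM : IsHW m (wordWt a) v) (r : PS m) {b : Fin n → Fin m}
    (hb : wordWt b = wordWt a) : el b (r • v) ∈ wtSpace m (HomV m n M) 0 :=
  el_mem_wtSpace (by rw [hb, zero_add]; exact Submodule.smul_mem _ r hM.mem)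

/-- The singular vector corresponding to a word. -/
noncomputable def wordSing (hM : IsHW m (wordWt a) v) {b : Fin n → Fin m} (hb : wordWt b = wordWt a) :
    PS m →ₗ[ℂ] Phi m n M :=
  phiProj hM.heightBdd ∘ₗ
    { toFun := fun r => ⟨el b (r • v), hM.el_mem r hb⟩
      map_add' := fun r r' => Subtype.ext (by
        change el b ((r + r') • v) = el b (r • v) + el b (r' • v)
        rw [add_smul, map_add])
      map_smul' := fun c r => Subtype.ext (by
        change el b ((c • r) • v) = c • el b (r • v)
        rw [← algebraMap_smul (PS m) c r, ← algebraMap_smul (PS m) c (el b (r • v)), smul_assoc,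
          map_smul]) }

lemma wordSing_apply (hM : IsHW m (wordWt a) v) {b : Fin n → Fin m} (hb : wordWt b = wordWt a)
    (r : PS m) : wordSing hM hb r = phiProj hM.heightBdd ⟨el b (r • v), hM.el_mem r hb⟩ := rfl

lemma hs_smul_wordSing (hM : IsHW m (wordWt a) v) {b c : Fin n → Fin m} (hb : wordWt b = wordWt a)
    (hc : wordWt c = wordWt a) (i : ℕ) (hi : i + 1 < n) (hbc : c = wordSwap i hi b) (r : PS m) :
    hs i hi • wordSing hM hb r = wordSing hM hc r := by
  refine smul_phiProj_s hM.heightBdd i hi _ _ ?_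
  change opS M i hi (el b (r • v)) = el c (r • v)
  rw [opS_el, hbc, wordSwap]

lemma x_smul_wordSing (ha : Monotone a) (hM : IsHW m (wordWt a) v) (i : Fin n) (r : PS m) :
    ParHecke.x n Set.univ i • wordSing hM rfl r = wordSing hM rfl ((MvPowerSeries.C
      ((((Finset.univ.filter fun k => k < i ∧ a k = a i).card : ℤ) - (a i : ℕ) : ℤ) : ℂ) +
        MvPowerSeries.X (a i) : PS m) * r) := by
  refine smul_phiProj_x hM.heightBdd i _ _ ?_
  have := opX_el_sub_mem ha (Submodule.smul_mem _ r hM.mem) (fun p q h => by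
    rw [IsBimodule.lie_ps, hM.upper p q h, smul_zero]) i
  rwa [smul_smul] at this

/-- The data that identify the induced module for a sorted word `a`: the parabolic subalgebra is
that of the blocks of equal letters, and `x_i` acts by the scalar determined by the letter at `i`
and the number of its occurrences before `i`. -/
structure SortedChar (a : Fin n → Fin m) (χ : ParHecke n J →ₐ[ℂ] S) (τ : S ≃ₐ[ℂ] PS m) : Prop where
  mono : Monotone a
  mem : ∀ (i : ℕ) (hi : i + 1 < n), i ∈ J ↔ a ⟨i + 1, hi⟩ = a ⟨i, Nat.lt_of_succ_lt hi⟩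
  x : ∀ i, τ (χ (ParHecke.x n J i)) = MvPowerSeries.C
      ((((Finset.univ.filter fun k => k < i ∧ a k = a i).card : ℤ) - (a i : ℕ) : ℤ) : ℂ) +
        MvPowerSeries.X (a i)
  s : ∀ i hi hJ, χ (ParHecke.s n J i hi hJ) = 1

variable {τ : S ≃ₐ[ℂ] PS m}

lemma SortedChar.hs_smul_indGen (h : SortedChar a χ τ) (i : ℕ) (hi : i + 1 < n)
    (hia : a ⟨i + 1, hi⟩ = a ⟨i, Nat.lt_of_succ_lt hi⟩) : hs i hi • indGen χ = indGen χ := by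
  rw [← toHecke_s (J := J) i hi ((h.mem i hi).2 hia), toHecke_smul_indGen, h.s, one_smul]

/-- The parabolic algebra acts on the singular vector of the sorted word through the inducing
character; this makes `comparison` well defined. -/
lemma SortedChar.toHecke_smul (h : SortedChar a χ τ) (hM : IsHW m (wordWt a) v) (u : ParHecke n J)
    (r : S) : ParHecke.toHecke n J u • wordSing hM rfl (τ r) = wordSing hM rfl (τ (χ u * r)) := by
  induction u using parHecke_induction generalizing r with
  | halg c =>
    rw [AlgHom.commutes, AlgHom.commutes, algebraMap_smul, ← Algebra.smul_def, map_smul, map_smul]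
  | hx i => rw [toHecke_x, x_smul_wordSing h.mono, map_mul τ, h.x]
  | hs i hi hJ =>
    rw [toHecke_s, h.s, one_mul]
    refine hs_smul_wordSing hM rfl rfl i hi ?_ _
    exact (wordSwap_eq_self i hi ((h.mem i hi).1 hJ)).symm
  | hadd u u' hu hu' => rw [map_add, add_smul, hu, hu', map_add, add_mul, map_add, map_add]
  | hmul u u' hu hu' => rw [map_mul (ParHecke.toHecke n J), mul_smul, hu', hu, map_mul χ, mul_assoc]

/-- The comparison map from the induced module to the image of a highest weight module. -/
noncomputable def SortedChar.comparison (h : SortedChar a χ τ) (hM : IsHW m (wordWt a) v) :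
    Ind (ParHecke.toHecke n J) χ →ₗ[Hecke n] Phi m n M where
  toFun := Ind.lift (TensorProduct.lift
      (LinearMap.mk₂ ℂ (fun (u : Hecke n) (r : S) => u • wordSing hM rfl (τ r))
        (fun u u' r => add_smul u u' _) (fun c u r => smul_assoc c u _)
        (fun u r r' => by rw [map_add, map_add, smul_add])
        (fun c u r => by rw [map_smul, map_smul, smul_algebra_smul_comm]))).toAddMonoidHom
    fun b u r => by
      change (b * _) • wordSing hM rfl (τ r) = b • wordSing hM rfl (τ (χ u * r))
      rw [mul_smul, h.toHecke_smul]
  map_add' := map_add _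
  map_smul' u y := by
    induction y using Ind.induction with
    | h0 => rw [smul_zero, map_zero, smul_zero]
    | hadd x y hx hy => rw [smul_add, map_add, hx, hy, map_add, smul_add]
    | hmk b r =>
      rw [Ind.smul_mk, Ind.lift_mk, Ind.lift_mk]
      exact mul_smul u b _

lemma SortedChar.comparison_mk (h : SortedChar a χ τ) (hM : IsHW m (wordWt a) v) (u : Hecke n)
    (r : S) : h.comparison hM (Ind.mk _ _ u r) = u • wordSing hM rfl (τ r) :=
  rfl

lemma SortedChar.comparison_wordElt (h : SortedChar a χ τ) (hM : IsHW m (wordWt a) v) (r : S)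
    (b : Fin n → Fin m) (hb : ∃ σ : Equiv.Perm (Fin n), b = a ∘ σ) :
    ∃ hb : wordWt b = wordWt a,
      h.comparison hM (r • wordElt (indGen χ) b) = wordSing hM hb (τ r) := by
  refine word_induction (P := fun b => ∃ hb : wordWt b = wordWt a,
    h.comparison hM (r • wordElt (indGen χ) b) = wordSing hM hb (τ r)) h.mono ⟨rfl, ?_⟩
    (fun b hb i hi ih => ?_) b hb
  · rw [wordElt_of_monotone _ h.mono, ← one_smul (Hecke n) (indGen χ), smul_smul_indGen,
      h.comparison_mk, one_smul]
  · obtain ⟨hw, ih⟩ := ih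
    have hw' : wordWt (wordSwap i hi b) = wordWt a := (wordWt_comp b _).trans hw
    refine ⟨hw', ?_⟩
    rw [← hs_wordElt h.mono h.hs_smul_indGen hb, ← smul_comm, map_smul, ih]
    exact hs_smul_wordSing hM hw hw' i hi rfl _

/-- The comparison map is surjective, and its kernel is determined by the annihilator of the highest
weight vector, if the module has enough maps to the tensor power. -/
theorem SortedChar.comparison_spec (h : SortedChar a χ τ) (hM : IsHW m (wordWt a) v)
    {I : Ideal (PS m)} (hI : ∀ r ∈ I, r • v = 0)
    (hψ : ∀ b : Fin n → Fin m, ∃ ψ : (Fin n → Fin m) → M →ₗ[PS m] PS m ⧸ I,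
      (∀ c, ψ c v = if c = b then 1 else 0) ∧
      ∀ (p q : Fin m), q < p → ∀ c x, ψ c ⁅(eu p q : gl m), x⁆ =
        ∑ k, if c k = p then ψ (Function.update c k q) x else 0) :
    Function.Surjective (h.comparison hM) ∧
      ∀ y, h.comparison hM y = 0 ↔ y ∈ (I.comap (τ : S →+* PS m) • ⊤ :
        Submodule S (Ind (ParHecke.toHecke n J) χ)) := by
  have hcomp : ∀ (b : {b : Fin n → Fin m // wordWt b = wordWt a}) (r : S),
      h.comparison hM (r • wordElt (indGen χ) b.1) = wordSing hM b.2 (τ r) := fun b r =>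
    (h.comparison_wordElt hM r b.1 (exists_perm_of_wordWt b.2)).2
  have hspan : ∀ y : Ind (ParHecke.toHecke n J) χ,
      ∃ r : {b : Fin n → Fin m // wordWt b = wordWt a} → S, ∑ b, r b • wordElt (indGen χ) b.1 = y := by
    intro y
    refine (Submodule.mem_span_range_iff_exists_fun S).1 ?_
    rw [span_wordElt h.mono h.hs_smul_indGen]
    exact Submodule.mem_top
  have hsum : ∀ r : {b : Fin n → Fin m // wordWt b = wordWt a} → S,
      h.comparison hM (∑ b, r b • wordElt (indGen χ) b.1) = phiProj hM.heightBdd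
        (∑ b, ⟨el b.1 (τ (r b) • v), hM.el_mem _ b.2⟩) := fun r => by
    rw [map_sum, map_sum]
    exact Finset.sum_congr rfl fun b _ => hcomp b (r b)
  refine ⟨fun F => ?_, fun y => ⟨fun hy => ?_, fun hy => ?_⟩⟩
  · obtain ⟨l, hl, y, hy, hly⟩ := Submodule.mem_sup.1 (hM.wtSpace_zero_le (mem_sing.1 (ev_mem F)).1)
    obtain ⟨r, rfl⟩ := (Submodule.mem_span_range_iff_exists_fun (PS m)).1 hy
    refine ⟨∑ b, τ.symm (r b) • wordElt (indGen χ) b.1, ?_⟩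
    rw [hsum]
    refine phiProj_eq _ ?_
    -- The singular vector is l plus the combination of elementary maps, so the difference in
    -- question is -l.
    rw [← hly, AddSubmonoidClass.coe_finsetSum, ← neg_mem_iff]
    simpa using hl
  · obtain ⟨r, rfl⟩ := hspan y
    rw [hsum, phiProj_eq_zero_iff, AddSubmonoidClass.coe_finsetSum] at hy
    refine Submodule.sum_mem _ fun b _ => Submodule.smul_mem_smul ?_ Submodule.mem_top
    -- Independence of the elementary maps modulo lowered elements puts each coefficient in the
    -- ideal.
    exact mem_of_sum_el_mem_lowered hψ (r := fun b => τ (r b)) hy b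
  · induction hy using Submodule.smul_induction_on' with
    | smul r hr y _ =>
      obtain ⟨t, rfl⟩ := hspan y
      rw [Finset.smul_sum, map_sum]
      refine Finset.sum_eq_zero fun b _ => ?_
      rw [smul_smul, hcomp, wordSing_apply, phiProj_eq_zero_iff]
      change el b.1 (τ (r * t b) • v) ∈ _
      have : τ (r * t b) • v = 0 := hI _ (by rw [map_mul]; exact I.mul_mem_right _ hr)
      rw [this, map_zero]
      exact Submodule.zero_mem _
    | add x _ y _ hx hy => rw [map_add, hx, hy, add_zero]

end Comparison

end ArakawaSuzuki

namespace ArakawaSuzuki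

/-! ### Positions and blocks of a Kostant partition -/

section Positions

variable {β : ℤ →₀ ℕ} (π : KP β)

/-- The sum of the lengths of the first blocks. -/
noncomputable def KP.offset (t : ℕ) : ℕ := ∑ i ∈ Finset.univ.filter (fun i : Fin π.size => (i : ℕ) < t), π.len i

lemma KP.offset_mono : Monotone π.offset := fun s t h =>
  Finset.sum_le_sum_of_subset (Finset.monotone_filter_right _ fun i _ hi => lt_of_lt_of_le hi h)

lemma KP.offset_succ (k : Fin π.size) : π.offset (k + 1) = π.offset k + π.len k := by
  unfold KP.offset
  have : (Finset.univ.filter fun i : Fin π.size => (i : ℕ) < k + 1) =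
      insert k (Finset.univ.filter fun i : Fin π.size => (i : ℕ) < k) := by
    ext i
    simp only [Finset.mem_filter, Finset.mem_univ, true_and, Finset.mem_insert, Fin.ext_iff]
    omega
  rw [this, Finset.sum_insert (by simp), add_comm]

lemma KP.pos_eq (l : Fin (ht β)) : (l : ℕ) = π.offset (π.pos l).1 + (π.pos l).2 := by
  rw [π.pos_spec l]
  congr 1
  unfold KP.offset
  refine Finset.sum_bij (fun i _ => Fin.castLE (π.pos l).1.2.le i) ?_ ?_ ?_ ?_
  · intro i _
    exact Finset.mem_filter.2 ⟨Finset.mem_univ _, i.2⟩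
  · intro i _ j _ h
    exact Fin.castLE_injective _ h
  · intro i hi
    exact ⟨⟨i, (Finset.mem_filter.1 hi).2⟩, Finset.mem_univ _, rfl⟩
  · intro i _
    rfl

lemma KP.pos_mono {l l' : Fin (ht β)} (h : l ≤ l') : (π.pos l).1 ≤ (π.pos l').1 := by
  by_contra hlt
  rw [not_le] at hlt
  have h1 := π.pos_eq l
  have h2 := π.pos_eq l'
  have h3 := π.offset_mono (Nat.succ_le_of_lt (Fin.lt_def.1 hlt))
  have h4 := π.offset_succ (π.pos l').1
  have h5 := (π.pos l').2.2
  have h6 : (l : ℕ) ≤ l' := h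
  rw [Nat.succ_eq_add_one] at h3
  omega

/-- The position in the block `k` with the given index. -/
noncomputable def KP.posInv (k : Fin π.size) (c : Fin (π.len k)) : Fin (ht β) :=
  Fin.cast π.sum_len (finSigmaFinEquiv ⟨k, c⟩)

lemma KP.pos_posInv (k : Fin π.size) (c : Fin (π.len k)) : π.pos (π.posInv k c) = ⟨k, c⟩ := by
  unfold KP.pos KP.posInv
  rw [Fin.cast_cast, Fin.cast_eq_self, Equiv.symm_apply_apply]

lemma KP.posInv_pos (l : Fin (ht β)) : π.posInv (π.pos l).1 (π.pos l).2 = l := by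
  unfold KP.pos KP.posInv
  rw [Sigma.eta, Equiv.apply_symm_apply, Fin.cast_cast, Fin.cast_eq_self]

lemma KP.card_block (k : Fin π.size) : (Finset.univ.filter fun l => (π.pos l).1 = k).card = π.len k := by
  have : (Finset.univ.filter fun l => (π.pos l).1 = k) = Finset.univ.image (π.posInv k) := by
    ext l
    simp only [Finset.mem_filter, Finset.mem_univ, true_and, Finset.mem_image]
    constructor
    · rintro rfl
      exact ⟨_, π.posInv_pos l⟩
    · rintro ⟨c, rfl⟩
      rw [KP.pos_posInv]
  rw [this, Finset.card_image_of_injective, Finset.card_univ, Fintype.card_fin]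
  intro c c' h
  have := congrArg π.pos h
  rw [KP.pos_posInv, KP.pos_posInv] at this
  exact eq_of_heq (Sigma.mk.inj this).2

/-- Blocks are intervals of positions, so the index of l in its block counts the earlier positions
of that block. This translates the scalar of x_l into a statement about words. -/
lemma KP.card_before (l : Fin (ht β)) :
    (Finset.univ.filter fun k => k < l ∧ (π.pos k).1 = (π.pos l).1).card = (π.pos l).2 := by
  have : (Finset.univ.filter fun k => k < l ∧ (π.pos k).1 = (π.pos l).1) =
      (Finset.Iio (π.pos l).2).image (π.posInv (π.pos l).1) := by
    have hl := π.pos_eq l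
    ext k
    simp only [Finset.mem_filter, Finset.mem_univ, true_and, Finset.mem_image, Finset.mem_Iio]
    have hk := π.pos_eq k
    constructor
    · rintro ⟨h1, h2⟩
      have h3 : π.offset (π.pos k).1 = π.offset (π.pos l).1 := by rw [h2]
      have h1 : (k : ℕ) < l := h1
      refine ⟨⟨(π.pos k).2, by have := (π.pos l).2.2; omega⟩, by rw [Fin.lt_def]; simp; omega, ?_⟩
      conv_rhs => rw [← π.posInv_pos k]
      congr 1
      · exact h2.symm
      · rw [Fin.heq_ext_iff (congrArg π.len h2.symm)]
    · rintro ⟨c, hc, rfl⟩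
      rw [KP.pos_posInv] at hk ⊢
      have hc : (c : ℕ) < (π.pos l).2 := hc
      refine ⟨?_, rfl⟩
      rw [Fin.lt_def]
      simp only at hk
      omega
  rw [this, Finset.card_image_of_injective, Fin.card_Iio]
  intro c c' h
  have := congrArg π.pos h
  rw [KP.pos_posInv, KP.pos_posInv] at this
  exact eq_of_heq (Sigma.mk.inj this).2

end Positions

/-! ### The Kostant partition of a weight as a sorted word -/

section PiMu

variable {m : ℕ} {lam mu : Fin m → ℤ} (hlam : ∀ i, 0 < lam i) (hmu : mu ∈ weylOrbit lam)

/-- The starting points -i strictly decrease with i, so the lexicographic order sorts the roots by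
i, whatever the values of μ are. The blocks are therefore numbered like the letters. -/
lemma piMu_roots : (piMu lam mu hlam hmu).roots = List.ofFn fun i : Fin m =>
    (⟨-(i : ℤ), mu i, by have := weylOrbit_pos hlam hmu i; omega⟩ : PosRoot) := by
  unfold KP.roots piMu
  refine List.Perm.eq_of_pairwise' (r := (· ≥ ·)) (Multiset.pairwise_sort _ _) ?_ ?_
  · rw [List.pairwise_ofFn]
    intro i j hij
    refine le_of_lt ?_
    change (toLex (_, _) : ℤ ×ₗ ℤ) < toLex (_, _)
    rw [Prod.Lex.toLex_lt_toLex]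
    left
    have : (i : ℕ) < j := hij
    simp only
    omega
  · rw [← Multiset.coe_eq_coe, Multiset.sort_eq]
    exact Fin.univ_val_map _

lemma piMu_size : (piMu lam mu hlam hmu).size = m := by
  unfold KP.size
  rw [piMu_roots, List.length_ofFn]

lemma piMu_root (k : Fin (piMu lam mu hlam hmu).size) :
    ((piMu lam mu hlam hmu).root k).i = -(k : ℤ) ∧
      ((piMu lam mu hlam hmu).root k).j = mu (Fin.cast (piMu_size hlam hmu) k) := by
  have h : (piMu lam mu hlam hmu).root k = ⟨-(k : ℤ), mu (Fin.cast (piMu_size hlam hmu) k), by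
      have := weylOrbit_pos hlam hmu (Fin.cast (piMu_size hlam hmu) k); omega⟩ := by
    unfold KP.root
    refine (List.get_of_eq (piMu_roots hlam hmu) k).trans ?_
    rw [List.get_ofFn]
    rfl
  rw [h]
  exact ⟨rfl, rfl⟩

/-- The block of α(-k, μ_k), with k counted from 0, has length μ_k + k, which is the k-th coordinate
of the highest weight μ - ρ. -/
lemma piMu_len (k : Fin (piMu lam mu hlam hmu).size) :
    ((piMu lam mu hlam hmu).len k : ℤ) = (mu - rho m) (Fin.cast (piMu_size hlam hmu) k) := by
  unfold KP.len
  obtain ⟨h1, h2⟩ := piMu_root hlam hmu k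
  have := weylOrbit_pos hlam hmu (Fin.cast (piMu_size hlam hmu) k)
  rw [h1, h2, Int.toNat_of_nonneg (by omega), Pi.sub_apply, rho]
  simp

/-- Renaming of the variables of a power series ring along an equality. -/
noncomputable def psCast {s t : ℕ} (h : s = t) : PS s ≃ₐ[ℂ] PS t := by
  subst h
  exact AlgEquiv.refl

lemma psCast_C {s t : ℕ} (h : s = t) (c : ℂ) : psCast h (MvPowerSeries.C c) = MvPowerSeries.C c := by
  subst h
  rfl

lemma psCast_X {s t : ℕ} (h : s = t) (k : Fin s) :
    psCast h (MvPowerSeries.X k) = MvPowerSeries.X (Fin.cast h k) := by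
  subst h
  rfl

/-- The sorted word whose letters number the blocks of `π_μ`. -/
noncomputable def blockWord (l : Fin (ht (betaOf lam))) : Fin m :=
  Fin.cast (piMu_size hlam hmu) ((piMu lam mu hlam hmu).pos l).1

lemma blockWord_eq_iff (l l' : Fin (ht (betaOf lam))) :
    blockWord hlam hmu l = blockWord hlam hmu l' ↔
      ((piMu lam mu hlam hmu).pos l).1 = ((piMu lam mu hlam hmu).pos l').1 :=
  (Fin.cast_injective _).eq_iff

lemma wordWt_blockWord : wordWt (blockWord hlam hmu) = mu - rho m := by
  funext i
  have h : i = Fin.cast (piMu_size hlam hmu) (Fin.cast (piMu_size hlam hmu).symm i) := rfl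
  rw [h, ← piMu_len, ← KP.card_block]
  unfold wordWt
  congr 2
  ext l
  rw [Finset.mem_filter, Finset.mem_filter]
  exact and_congr_right fun _ => (Fin.cast_injective (piMu_size hlam hmu)).eq_iff

/-- The block of the letter k starts at i_k = -k, and the index inside it is the number of earlier
occurrences of k; so the two formulas for the action of x_l agree. -/
lemma sortedChar_piMu : SortedChar (blockWord hlam hmu) (piMu lam mu hlam hmu).char
    (psCast (piMu_size hlam hmu)) where
  mono l l' h := (piMu lam mu hlam hmu).pos_mono h
  mem i hi := by
    rw [blockWord_eq_iff, eq_comm]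
    exact ⟨fun ⟨_, h⟩ => h, fun h => ⟨hi, h⟩⟩
  x l := by
    unfold KP.char
    rw [ParHecke.lift_x, KP.xScalar, map_add, psCast_C, psCast_X, (piMu_root hlam hmu _).1]
    simp only [blockWord_eq_iff]
    rw [KP.card_before, neg_add_eq_sub]
    rfl
  s i hi hJ := ParHecke.lift_s _ i hi hJ

end PiMu

/-! ### Verma modules as highest weight modules with maps to the tensor power -/

section VermaModule

variable {m : ℕ} (mu : Fin m → ℤ)

lemma mem_maximalIdeal_iff (r : PS m) :
    r ∈ IsLocalRing.maximalIdeal (PS m) ↔ MvPowerSeries.constantCoeff r = 0 := by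
  rw [IsLocalRing.mem_maximalIdeal, mem_nonunits_iff, MvPowerSeries.isUnit_iff_constantCoeff,
    isUnit_iff_ne_zero, not_not]

lemma Special.smul_eq_zero {S M : Type*} [CommRing S] [IsLocalRing S] [AddCommGroup M] [Module S M]
    {r : S} (hr : r ∈ IsLocalRing.maximalIdeal S) (w : Special S M) : r • w = 0 := by
  obtain ⟨w, rfl⟩ := Special.mk_surjective S w
  rw [← map_smul]
  exact (Submodule.Quotient.mk_eq_zero _).2 (Submodule.smul_mem_smul hr Submodule.mem_top)

lemma Verma.smul_eq (r : PS m) (w : Verma m mu) : r • w = MvPowerSeries.constantCoeff r • w := by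
  have h : r - MvPowerSeries.C (MvPowerSeries.constantCoeff r) ∈ IsLocalRing.maximalIdeal (PS m) := by
    rw [mem_maximalIdeal_iff, map_sub, MvPowerSeries.constantCoeff_C, sub_self]
  have h1 := Special.smul_eq_zero h w
  rwa [sub_smul, sub_eq_zero, MvPowerSeries.c_eq_algebraMap, algebraMap_smul] at h1

lemma Verma.isHW : IsHW m (mu - rho m) (Special.mk (PS m) (DVerma.gen mu)) where
  mem := mem_wtSpace.2 fun i => by
    rw [Special.lie_mk, mem_wtSpace.1 (DVerma.isHW mu).mem, map_smul]
  upper p q h := by rw [Special.lie_mk, (DVerma.isHW mu).upper p q h, map_zero]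
  gen W hW hv := by
    have h1 := (DVerma.isHW mu).gen (W.comap (Special.mk (PS m)))
      (fun X v hv => by
        rw [Submodule.mem_comap, ← Special.lie_mk]
        exact hW X _ hv)
      (fun v hv' => by
        rw [Set.mem_singleton_iff.1 hv']
        exact hv _ (Set.mem_singleton _))
    refine eq_top_iff.2 fun w _ => ?_
    obtain ⟨w, rfl⟩ := Special.mk_surjective (PS m) w
    have h2 : w ∈ W.comap (Special.mk (PS m)) := by rw [h1]; exact Submodule.mem_top
    exact h2

lemma Verma.isBGG : IsBGG m (Verma m mu) := (Verma.isHW mu).isBGG (Verma.smul_eq mu)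

lemma DVerma.exists_wordCoef_bot {n : ℕ} (b : Fin n → Fin m) :
    ∃ ψ : (Fin n → Fin m) → DVerma m mu →ₗ[PS m] PS m ⧸ (⊥ : Ideal (PS m)),
      (∀ c, ψ c (DVerma.gen mu) = if c = b then 1 else 0) ∧
      ∀ (p q : Fin m), q < p → ∀ c x, ψ c ⁅(eu p q : gl m), x⁆ =
        ∑ k, if c k = p then ψ (Function.update c k q) x else 0 := by
  obtain ⟨ψ, h1, h2⟩ := DVerma.exists_wordCoef mu b
  refine ⟨fun c => (⊥ : Ideal (PS m)).mkQ ∘ₗ ψ c, fun c => ?_, fun p q h c x => ?_⟩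
  · rw [LinearMap.comp_apply, h1]
    split_ifs
    · rfl
    · rfl
  · rw [LinearMap.comp_apply, h2 p q h, map_sum]
    refine Finset.sum_congr rfl fun k _ => ?_
    split_ifs
    · rfl
    · rw [map_zero]

/-- The coefficient maps of the deformed Verma module are R-linear, so they descend modulo the
maximal ideal. -/
lemma Verma.exists_wordCoef {n : ℕ} (b : Fin n → Fin m) :
    ∃ ψ : (Fin n → Fin m) → Verma m mu →ₗ[PS m] PS m ⧸ IsLocalRing.maximalIdeal (PS m),
      (∀ c, ψ c (Special.mk (PS m) (DVerma.gen mu)) = if c = b then 1 else 0) ∧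
      ∀ (p q : Fin m), q < p → ∀ c x, ψ c ⁅(eu p q : gl m), x⁆ =
        ∑ k, if c k = p then ψ (Function.update c k q) x else 0 := by
  obtain ⟨ψ, h1, h2⟩ := DVerma.exists_wordCoef mu b
  have hker : ∀ c, (IsLocalRing.maximalIdeal (PS m) • ⊤ : Submodule (PS m) (DVerma m mu)) ≤
      LinearMap.ker ((IsLocalRing.maximalIdeal (PS m)).mkQ ∘ₗ ψ c) := fun c =>
    Submodule.smul_le.2 fun r hr x _ => by
      rw [LinearMap.mem_ker, LinearMap.comp_apply, map_smul]
      exact (Submodule.Quotient.mk_eq_zero _).2 (Ideal.mul_mem_right _ _ hr)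
  let Ψ : (Fin n → Fin m) → Verma m mu →ₗ[PS m] PS m ⧸ IsLocalRing.maximalIdeal (PS m) :=
    fun c => Submodule.liftQ _ _ (hker c)
  have hΨ : ∀ c x, Ψ c (Special.mk (PS m) x) = (IsLocalRing.maximalIdeal (PS m)).mkQ (ψ c x) :=
    fun c x => rfl
  refine ⟨Ψ, fun c => ?_, fun p q h c x => ?_⟩
  · rw [hΨ, h1]
    split_ifs
    · rfl
    · rfl
  · obtain ⟨x, rfl⟩ := Special.mk_surjective (PS m) x
    rw [Special.lie_mk, hΨ, h2 p q h, map_sum]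
    refine Finset.sum_congr rfl fun k _ => ?_
    split_ifs
    · rfl
    · rw [map_zero]

end VermaModule

/-! ### The three isomorphisms -/

section Main

variable {m : ℕ} {lam mu : Fin m → ℤ} (hlam : ∀ i, 0 < lam i) (hmu : mu ∈ weylOrbit lam)

/-- The functor maps deformed Verma modules to standard modules. -/
theorem phi_dverma_equiv : Nonempty (Phi m (ht (betaOf lam)) (DVerma m mu) ≃ₗ[Hecke (ht (betaOf lam))]
    StdH (piMu lam mu hlam hmu)) := by
  have hM : IsHW m (wordWt (blockWord hlam hmu)) (DVerma.gen mu) := by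
    rw [wordWt_blockWord]
    exact DVerma.isHW mu
  obtain ⟨h1, h2⟩ := (sortedChar_piMu hlam hmu).comparison_spec hM (I := ⊥)
    (fun r hr => by rw [(Submodule.mem_bot _).1 hr, zero_smul]) (DVerma.exists_wordCoef_bot mu)
  refine ⟨(LinearEquiv.ofBijective ((sortedChar_piMu hlam hmu).comparison hM) ⟨?_, h1⟩).symm⟩
  rw [injective_iff_map_eq_zero]
  intro y hy
  have h3 := (h2 y).1 hy
  have h4 : (⊥ : Ideal (PS m)).comap
      (psCast (piMu_size hlam hmu) : PS (piMu lam mu hlam hmu).size →+* PS m) = ⊥ :=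
    Ideal.comap_bot_of_injective _ (psCast (piMu_size hlam hmu)).injective
  rwa [h4, Submodule.bot_smul, Submodule.mem_bot] at h3

/-- The functor maps Verma modules to proper standard modules. -/
theorem phi_verma_equiv : Nonempty (Phi m (ht (betaOf lam)) (Verma m mu) ≃ₗ[Hecke (ht (betaOf lam))]
    PStdH (piMu lam mu hlam hmu)) := by
  have hM : IsHW m (wordWt (blockWord hlam hmu)) (Special.mk (PS m) (DVerma.gen mu)) := by
    rw [wordWt_blockWord]
    exact Verma.isHW mu
  obtain ⟨h1, h2⟩ := (sortedChar_piMu hlam hmu).comparison_spec hM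
    (I := IsLocalRing.maximalIdeal (PS m)) (fun r hr => Special.smul_eq_zero hr _)
    (Verma.exists_wordCoef mu)
  have h4 : (IsLocalRing.maximalIdeal (PS m)).comap
      (psCast (piMu_size hlam hmu) : PS (piMu lam mu hlam hmu).size →+* PS m) =
      IsLocalRing.maximalIdeal _ := by
    ext r
    rw [Ideal.mem_comap, IsLocalRing.mem_maximalIdeal, IsLocalRing.mem_maximalIdeal, mem_nonunits_iff,
      mem_nonunits_iff]
    exact not_congr (MulEquiv.isUnit_map (psCast (piMu_size hlam hmu)))
  let g : StdH (piMu lam mu hlam hmu) →ₗ[Hecke (ht (betaOf lam))] PStdH (piMu lam mu hlam hmu) :=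
    { toFun := Special.mk _
      map_add' := map_add _
      map_smul' := fun u y => rfl }
  have hg : Function.Surjective g := Special.mk_surjective _
  -- Both kernels are the submodule 𝔪Δ_H(π_μ), so both surjections induce isomorphisms from the same
  -- quotient.
  have hker : LinearMap.ker ((sortedChar_piMu hlam hmu).comparison hM) = LinearMap.ker g := by
    ext y
    rw [LinearMap.mem_ker, LinearMap.mem_ker, h2, h4]
    exact (Submodule.Quotient.mk_eq_zero _).symm
  exact ⟨(LinearMap.quotKerEquivOfSurjective _ h1).symm.trans
    ((Submodule.quotEquivOfEq _ _ hker).trans (LinearMap.quotKerEquivOfSurjective g hg))⟩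

/-- Isomorphic modules have isomorphic duals. -/
lemma CDual.equiv_of_equiv {n : ℕ} {A B : Type*} [AddCommGroup A] [Module ℂ A] [Module (Hecke n) A]
    [IsScalarTower ℂ (Hecke n) A] [AddCommGroup B] [Module ℂ B] [Module (Hecke n) B]
    [IsScalarTower ℂ (Hecke n) B] (e : A ≃ₗ[Hecke n] B) : Nonempty (CDual n A ≃ₗ[Hecke n] CDual n B) := by
  let e' : A ≃ₗ[ℂ] B := e.restrictScalars ℂ
  let E : CDual n A ≃+ CDual n B := (e'.dualMap.symm).toAddEquiv
  exact ⟨{ E with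
    map_smul' := fun u f => CDual.ext fun v => by
      change CDual.app (u • f) (e.symm v) = CDual.app (u • E f) v
      rw [CDual.app_smul, CDual.app_smul, ← map_smul e.symm]
      rfl }⟩

end Main

end ArakawaSuzuki

theorem proposition5 (m : ℕ) (hm : 2 ≤ m) :
    (∀ (lam : Fin m → ℤ) (_ : Antitone lam) (hpos : ∀ i, 0 < lam i)
      (mu : Fin m → ℤ) (hmu : mu ∈ weylOrbit lam),
      Nonempty (Phi m (ht (betaOf lam)) (DVerma m mu) ≃ₗ[Hecke (ht (betaOf lam))]
        StdH (piMu lam mu hpos hmu)) ∧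
      Nonempty (Phi m (ht (betaOf lam)) (Verma m mu) ≃ₗ[Hecke (ht (betaOf lam))]
        PStdH (piMu lam mu hpos hmu)) ∧
      Nonempty (Phi m (ht (betaOf lam)) (RDual m (Verma m mu)) ≃ₗ[Hecke (ht (betaOf lam))]
        PCStdH (piMu lam mu hpos hmu))) ∧
    (∀ (n : ℕ) (_ : 0 < n) (M : Type u) [AddCommGroup M] [Module ℂ M] [Module (PS m) M]
      [LieRingModule (gl m) M] [IsBimodule m M], IsBGG m M →
      Nonempty (Phi m n (RDual m M) ≃ₗ[Hecke n] CDual n (Phi m n M))) := by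
  refine ⟨fun lam _ hpos mu hmu => ⟨phi_dverma_equiv hpos hmu, phi_verma_equiv hpos hmu, ?_⟩,
    fun n _ M _ _ _ _ _ hM => phi_rdual_equiv n hM⟩
  -- The costandard isomorphism is duality for the Verma module followed by the dual of the
  -- isomorphism for proper standard modules.
  obtain ⟨e₁⟩ := phi_rdual_equiv (ht (betaOf lam)) (Verma.isBGG mu)
  obtain ⟨e₂⟩ := phi_verma_equiv hpos hmu
  obtain ⟨e₃⟩ := CDual.equiv_of_equiv e₂
  exact ⟨e₁.trans e₃⟩
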